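/- **Setting.** Fix $\log q,\log d\in\mathbb C$ and put $q=e^{\log q}$, $d=e^{\log d}$, $q_1=q^{-1}d$, $q_2=q^2$, $q_3=q^{-1}d^{-1}$ (complex powers are taken with respect to these logarithms). Assume $q,d$ generic: for $a,b\in\mathbb Q$, $q^ad^b=1$ only if $a=b=0$. Put $g_{i,i}(z,w)=z-q_2w$ and $g_{i,j}(z,w)=(z-q_1w)(z-q_3w)$ for $i\ne j$ in $\mathbb Z/2\mathbb Z$, $\delta(z)=\sum_{k\in\mathbb Z}z^k$, $[A,B]_p=AB-pBA$. The quantum toroidal $\mathfrak{gl}_2$ algebra $\mathcal E$ is the unital associative $\mathbb C$-algebra generated by the coefficients of $E_i(z)=\sum_{k\in\mathbb Z}E_{i,k}z^{-k}$, $F_i(z)=\sum_{k\in\mathbb Z}F_{i,k}z^{-k}$, $K_i^\pm(z)=K_i^{\pm1}\exp\bigl(\pm(q-q^{-1})\sum_{r>0}H_{i,\pm r}z^{\mp r}\bigr)$ ($i\in\mathbb Z/2\mathbb Z$) and an invertible central element $\mathsf t$, with relations: all coefficients of all $K_i^\pm(z)$ commute, and $$(-1)^{i+j}g_{i,j}(z,w)K^\pm_i(z)E_j(w)+g_{j,i}(w,z)E_j(w)K^\pm_i(z)=0,\qquad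 (-1)^{i+j}g_{j,i}(w,z)K^\pm_i(z)F_j(w)+g_{i,j}(z,w)F_j(w)K^\pm_i(z)=0,$$ $$[E_i(z),F_j(w)]=\tfrac{\delta_{i,j}}{q-q^{-1}}\delta(z/w)\bigl(K_i^+(w)-K_i^-(z)\bigr),$$ $$(-1)^{i+j}g_{i,j}(z,w)E_i(z)E_j(w)+g_{j,i}(w,z)E_j(w)E_i(z)=0,\qquad (-1)^{i+j}g_{j,i}(w,z)F_i(z)F_j(w)+g_{i,j}(z,w)F_j(w)F_i(z)=0,$$ $$\operatorname{Sym}_{z_1,z_2,z_3}[X_i(z_1),[X_i(z_2),[X_i(z_3),X_{i+1}(w)]_{q^2}]]_{q^{-2}}=0\qquad(X=E,F).$$ A rational function is *balanced* if it is regular at $0$ and $\infty$ and the product of its values there is $1$. A vector $v$ of an $\mathcal E$-module has $\ell$-weight $\phi=(\phi^0,\phi^1)$ (balanced components) if $K_i^{\pm}(z)v=\phi^i(z)v$, with $\phi^i$ expanded at $z=\infty$ for $K_i^+$ and at $z=0$ for $K_i^-$. A module is *tame* if it has a basis of $\ell$-weight vectors with distinct $\ell$-weights. **Boxes.** A box $\Box$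 has a color $c(\Box)\in\mathbb Z/2\mathbb Z$ and coordinates $(x,y,z)\in\mathbb C^3$; its position is $p(\Box)=q_1^{-x}q_2^{-y}q_3^{-z}$. Fix a set of boxes, totally ordered and divided into positive and negative boxes, such that: boxes with equal positions have equal colors; if all coordinates of two boxes differ by integers, they are ordered lexicographically, comparing first $y$, then $z$, then $x$; if the $x$- and $z$-coordinates of $\Box_1,\Box_2$ differ by integers, then $c(\Box_1)-c(\Box_2)\equiv x(\Box_1)-x(\Box_2)+z(\Box_1)-z(\Box_2)$ mod $2$. A *state* $\lambda=\lambda^+\sqcup\lambda^-$ consists of a finite set $\lambda^+$ of positive and a finite set $\lambda^-$ of negative boxes; $\emptyset$ is the reference state. Let $S$ be a set of states containing $\emptyset$. A box is *concave* in $\lambda\in S$ if it is positive and not in $\lambda^+$, or it is in $\lambda^-$, and if adding it to $\lambda^+$, respectively deleting it from $\lambda^-$, gives a state of $S$, denoted $\lambda\sqcup\Box$. It is *convex* in $\lambda$ if it is in $\lambda^+$, or it is negative and not in $\lambda^-$, and if deleting it from $\lambda^+$, respectively adding it to $\lambda^-$, gives a state of $S$, denoted $\lambda\setminus\Box$. $CC_i(\lambda)$,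 $CV_i(\lambda)$ are the sets of concave, convex boxes of color $i$. $S$ is *connected* if every $\lambda\in S$ can be brought to $\emptyset$ within $S$ by deleting the boxes of $\lambda^+$ and $\lambda^-$ one at a time. **Weights.** For $i,j\in\mathbb Z/2\mathbb Z$, the pair $A_{i,a}(z)$ has $i$-th component $\frac{q_2z-a}{z-q_2a}$ and other component $\frac{(q_1z-a)(q_3z-a)}{(z-q_1a)(z-q_3a)}$. Let $\Psi=(\Psi^0,\Psi^1)$ be a pair of balanced rational functions. Put $\epsilon(\Box)=-1$ for positive and $+1$ for negative boxes, $\phi_\lambda=\Psi\prod_{\Box\in\lambda}A^{\epsilon(\Box)}_{c(\Box),p(\Box)}$, and $$\phi_{\lambda,<\Box}=\Psi^{[\Box>0]}\prod_{\Box_1\in\lambda,\ \Box_1<\Box}A^{\epsilon(\Box_1)}_{c(\Box_1),p(\Box_1)},\qquad \phi_{\lambda,>\Box}=\Psi^{[\Box<0]}\prod_{\Box_1\in\lambda,\ \Box_1>\Box}A^{\epsilon(\Box_1)}_{c(\Box_1),p(\Box_1)},$$ where $\Psi^{[\Box>0]}$ is $\Psi$ if $\Box$ is positive and $1$ otherwise,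 and $\Psi^{[\Box<0]}$ is $\Psi$ if $\Box$ is negative and $1$ otherwise. **Assumptions.** (A1) The $\phi_\lambda$, $\lambda\in S$, are distinct. (A2) For $\lambda\in S$ the components of $\phi_\lambda$ are balanced with only simple poles. (A3) For $\lambda\in S$ and $i=0,1$, $\Box\mapsto p(\Box)$ is a bijection from $CC_i(\lambda)\sqcup CV_i(\lambda)$ to the set of poles of $\phi_\lambda^i$. (A4) For $\lambda \in S$ and $\Box\in CC_i(\lambda)\sqcup CV_i(\lambda)$: if $\Box$ is positive, $\phi^i_{\lambda,>\Box}$ is regular at $p(\Box)$; if $\Box$ is negative, $\phi^i_{\lambda,<\Box}$ is regular at $p(\Box)$. (A5) Let $(x,y,z)$ be concave in $\lambda\in S$. If $(x',y',z')$ is concave in $\lambda\sqcup(x,y,z)$ but not in $\lambda$, then $(x',y',z')\in\{(x,y,z+1),(x,y+1,z),(x+1,y,z)\}$. If $(x',y',z')$ is convex in $\lambda$ but not in $\lambda\sqcup(x,y,z)$, then $(x',y',z')\in\{(x,y,z),(x,y,z-1),(x,y-1,z),(x-1,y,z)\}$. **Theorem.** Let $S$ be connected and let $\Psi$ be a pair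 of balanced rational functions such that (A1)–(A5) hold, and let $\tau\in\mathbb C^\times$. Then there is an $\mathcal E$-module structure on $V=\bigoplus_{\lambda\in S}\mathbb C|\lambda\rangle$ in which $\mathsf t$ acts by $\tau$ and $$K_i^\pm(z)|\lambda\rangle=\phi_\lambda^i(z)|\lambda\rangle,\quad F_i(z)|\lambda\rangle=\sum_{\Box\in CC_i(\lambda)}a^i_{\lambda,\Box}\,\delta(z/p(\Box))\,|\lambda\sqcup\Box\rangle,\quad E_i(z)|\lambda\rangle=\sum_{\Box\in CV_i(\lambda)}b^i_{\lambda,\Box}\,\delta(z/p(\Box))\,|\lambda\setminus\Box\rangle,$$ where, for positive $\Box$, $a^i_{\lambda,\Box}=\phi^i_{\lambda,>\Box}(p(\Box))$ and $b^i_{\lambda,\Box}=\frac1{q-q^{-1}}\operatorname{res}_{z=p(\Box)}\phi^i_{\lambda,<\Box}(z)\frac{dz}z$, and, for negative $\Box$, $a^i_{\lambda,\Box}=\frac{-1}{q-q^{-1}}\operatorname{res}_{z=p(\Box)}\phi^i_{\lambda,>\Box}(z)\frac{dz}z$ and $b^i_{\lambda,\Box}=\phi^i_{\lambda,<\Box}(p(\Box))$;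 and this module is tame and irreducible. -/

import Mathlib

open scoped BigOperators

noncomputable section

namespace Toroidal

/-! ### Parameters -/

/-- The parameters `log q` and `log d`; all powers of `q`, `d`, `q₁`, `q₂`, `q₃` are taken
with respect to these fixed logarithms. -/
structure Params where
  logq : ℂ
  logd : ℂ

namespace Params

/-- `q` and `d` are generic: `q ^ a * d ^ b = 1` with `a`, `b` rational only for `a = b = 0`. -/
def Generic (P : Params) : Prop :=
  ∀ a b : ℚ, Complex.exp ((a : ℂ) * P.logq + (b : ℂ) * P.logd) = 1 ↔ a = 0 ∧ b = 0

def q (P : Params) : ℂ := Complex.exp P.logq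
def d (P : Params) : ℂ := Complex.exp P.logd
def q₁ (P : Params) : ℂ := P.q⁻¹ * P.d
def q₂ (P : Params) : ℂ := P.q ^ 2
def q₃ (P : Params) : ℂ := P.q⁻¹ * P.d⁻¹

end Params

/-! ### The quantum toroidal algebra of type `gl₂` in the parallel realization -/

/-- Generators: the modes `E i k`, `F i k` (`k ∈ ℤ`), the modes `Kp i k` of `K⁺_i(z)` at `z ^ (-k)`
and `Km i k` of `K⁻_i(z)` at `z ^ k` (`k ∈ ℕ`), and the split central element `t` with its inverse.
Since the Cartan modes commute and `Kp i 0` and `Km i 0` are mutually inverse, the elements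
`H_{i,± r}` are recovered as the coefficients of `± (q - q⁻¹)⁻¹ log (K_i^{∓ 1} K^±_i(z))`, so that
generating by these modes is the same as generating by `K_i^{± 1}` and `H_{i,r}`. -/
inductive Gen : Type
  | E (i : ZMod 2) (k : ℤ)
  | F (i : ZMod 2) (k : ℤ)
  | Kp (i : ZMod 2) (k : ℕ)
  | Km (i : ZMod 2) (k : ℕ)
  | t
  | tInv

section Series

variable {A : Type*} [Ring A] [Algebra ℂ A]

/-- A series `∑ T m n z ^ (-m) w ^ (-n)` is recorded by its coefficients `T`. This is the
coefficient at `z ^ (-m) w ^ (-n)` of `g_{i,j}(z,w) T(z,w)`, where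
`g_{i,i}(z,w) = z - q₂ w` and `g_{i,j}(z,w) = (z - q₁ w)(z - q₃ w)` for `i ≠ j`. -/
def mulG (P : Params) (i j : ZMod 2) (T : ℤ → ℤ → A) (m n : ℤ) : A :=
  if i = j then T (m + 1) n - P.q₂ • T m (n + 1)
  else T (m + 2) n - (P.q₁ + P.q₃) • T (m + 1) (n + 1) + (P.q₁ * P.q₃) • T m (n + 2)

/-- The sign `(-1) ^ (i + j)`. -/
def sgn (i j : ZMod 2) : ℂ := if i = j then 1 else -1

/-- The coefficient at `z ^ (-m) w ^ (-n)` of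
`(-1)^{i+j} g_{i,j}(z,w) X(z) Y(w) + g_{j,i}(w,z) Y(w) X(z)`. -/
def exchange (P : Params) (i j : ZMod 2) (X Y : ℤ → A) (m n : ℤ) : A :=
  sgn i j • mulG P i j (fun a b => X a * Y b) m n + mulG P j i (fun b a => Y b * X a) n m

/-- The coefficient at `z ^ (-m) w ^ (-n)` of
`(-1)^{i+j} g_{j,i}(w,z) X(z) Y(w) + g_{i,j}(z,w) Y(w) X(z)`. -/
def exchange' (P : Params) (i j : ZMod 2) (X Y : ℤ → A) (m n : ℤ) : A :=
  sgn i j • mulG P j i (fun b a => X a * Y b) n m + mulG P i j (fun a b => Y b * X a) m n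

/-- `[a, b]_p = a b - p b a`. -/
def qComm (p : ℂ) (a b : A) : A := a * b - p • (b * a)

/-- The coefficient at `z₁ ^ (-k 0) z₂ ^ (-k 1) z₃ ^ (-k 2) w ^ (-l)` of
`Sym_{z₁,z₂,z₃} [X(z₁), [X(z₂), [X(z₃), Y(w)]_{q²}]]_{q⁻²}`. -/
def serre (P : Params) (X Y : ℤ → A) (k : Fin 3 → ℤ) (l : ℤ) : A :=
  (1 / 6 : ℂ) • ∑ σ : Equiv.Perm (Fin 3),
    qComm (P.q ^ 2)⁻¹ (X (k (σ 0)))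
      (qComm 1 (X (k (σ 1))) (qComm (P.q ^ 2) (X (k (σ 2))) (Y l)))

end Series

/-- The free algebra on the generators. -/
abbrev Free : Type := FreeAlgebra ℂ Gen

def gE (i : ZMod 2) (k : ℤ) : Free := FreeAlgebra.ι ℂ (Gen.E i k)
def gF (i : ZMod 2) (k : ℤ) : Free := FreeAlgebra.ι ℂ (Gen.F i k)

/-- The coefficient of `z ^ (-m)` in `K⁺_i(z)`. -/
def gKp (i : ZMod 2) (m : ℤ) : Free :=
  if 0 ≤ m then FreeAlgebra.ι ℂ (Gen.Kp i m.toNat) else 0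

/-- The coefficient of `z ^ (-m)` in `K⁻_i(z)`. -/
def gKm (i : ZMod 2) (m : ℤ) : Free :=
  if m ≤ 0 then FreeAlgebra.ι ℂ (Gen.Km i (-m).toNat) else 0

def gt : Free := FreeAlgebra.ι ℂ Gen.t
def gtInv : Free := FreeAlgebra.ι ℂ Gen.tInv

/-- The defining relations, coefficient by coefficient. -/
inductive Rel (P : Params) : Free → Free → Prop
  | t_mul : Rel P (gt * gtInv) 1
  | mul_t : Rel P (gtInv * gt) 1
  | t_central (x : Gen) : Rel P (gt * FreeAlgebra.ι ℂ x) (FreeAlgebra.ι ℂ x * gt)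
  | K_mul (i : ZMod 2) : Rel P (gKp i 0 * gKm i 0) 1
  | mul_K (i : ZMod 2) : Rel P (gKm i 0 * gKp i 0) 1
  | KpKp (i j : ZMod 2) (m n : ℤ) : Rel P (gKp i m * gKp j n) (gKp j n * gKp i m)
  | KmKm (i j : ZMod 2) (m n : ℤ) : Rel P (gKm i m * gKm j n) (gKm j n * gKm i m)
  | KpKm (i j : ZMod 2) (m n : ℤ) : Rel P (gKp i m * gKm j n) (gKm j n * gKp i m)
  | KpE (i j : ZMod 2) (m n : ℤ) : Rel P (exchange P i j (gKp i) (gE j) m n) 0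
  | KmE (i j : ZMod 2) (m n : ℤ) : Rel P (exchange P i j (gKm i) (gE j) m n) 0
  | KpF (i j : ZMod 2) (m n : ℤ) : Rel P (exchange' P i j (gKp i) (gF j) m n) 0
  | KmF (i j : ZMod 2) (m n : ℤ) : Rel P (exchange' P i j (gKm i) (gF j) m n) 0
  | EF (i j : ZMod 2) (m n : ℤ) :
      Rel P (gE i m * gF j n - gF j n * gE i m)
        (if i = j then (P.q - P.q⁻¹)⁻¹ • (gKp i (m + n) - gKm i (m + n)) else 0)
  | EE (i j : ZMod 2) (m n : ℤ) : Rel P (exchange P i j (gE i) (gE j) m n) 0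
  | FF (i j : ZMod 2) (m n : ℤ) : Rel P (exchange' P i j (gF i) (gF j) m n) 0
  | serreE (i : ZMod 2) (k : Fin 3 → ℤ) (l : ℤ) : Rel P (serre P (gE i) (gE (i + 1)) k l) 0
  | serreF (i : ZMod 2) (k : Fin 3 → ℤ) (l : ℤ) : Rel P (serre P (gF i) (gF (i + 1)) k l) 0

/-- The quantum toroidal algebra of type `gl₂`. -/
abbrev QTor (P : Params) : Type := RingQuot (Rel P)

/-- The image of a generator in the quantum toroidal algebra. -/
def gen (P : Params) (x : Gen) : QTor P :=
  RingQuot.mkAlgHom ℂ (Rel P) (FreeAlgebra.ι ℂ x)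

/-! ### Rational functions -/

/-- `f` has a pole at `a ∈ ℂ` (the denominator is that of the reduced fraction). -/
def IsPole (f : RatFunc ℂ) (a : ℂ) : Prop := f.denom.IsRoot a

def IsRegularAt (f : RatFunc ℂ) (a : ℂ) : Prop := ¬ IsPole f a

/-- All poles of `f` in `ℂ` are simple. -/
def HasSimplePoles (f : RatFunc ℂ) : Prop := ∀ a : ℂ, f.denom.rootMultiplicity a ≤ 1

/-- The value of `f` at `a`. -/
def value (f : RatFunc ℂ) (a : ℂ) : ℂ := f.eval (RingHom.id ℂ) a

/-- The rational function `f(1/z)`. -/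
def atInv (f : RatFunc ℂ) : RatFunc ℂ := f.eval RatFunc.C RatFunc.X⁻¹

/-- `f` is balanced: regular at `0` and at `∞`, with `f(0) f(∞) = 1`. -/
def IsBalanced (f : RatFunc ℂ) : Prop :=
  IsRegularAt f 0 ∧ IsRegularAt (atInv f) 0 ∧ value f 0 * value (atInv f) 0 = 1

open scoped RatFunc in
/-- The coefficient of `z ^ n` in the Laurent expansion of `f(z)` at `z = 0`. -/
def laurentCoeff (f : RatFunc ℂ) (n : ℤ) : ℂ :=
  (algebraMap (RatFunc ℂ) (LaurentSeries ℂ) f).coeff n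

/-- The residue at `z = a` of `f(z) dz`, i.e. the coefficient of `z ^ (-1)` in `f(z + a)`. -/
def residue (f : RatFunc ℂ) (a : ℂ) : ℂ := laurentCoeff (RatFunc.laurent a f) (-1)

/-- The component `j` of the affine root `A_{i,a}(z)`. -/
def rootA (P : Params) (i : ZMod 2) (a : ℂ) (j : ZMod 2) : RatFunc ℂ :=
  if i = j then
    (RatFunc.C P.q₂ * RatFunc.X - RatFunc.C a) / (RatFunc.X - RatFunc.C (P.q₂ * a))
  else
    ((RatFunc.C P.q₁ * RatFunc.X - RatFunc.C a) * (RatFunc.C P.q₃ * RatFunc.X - RatFunc.C a)) /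
      ((RatFunc.X - RatFunc.C (P.q₁ * a)) * (RatFunc.X - RatFunc.C (P.q₃ * a)))

/-! ### Representations -/

section Rep

variable {P : Params} {V : Type*} [AddCommGroup V] [Module ℂ V]

/-- `v` is a vector of `ℓ`-weight `φ`: `K^±_i(z) v = φ^i(z) v`, where `φ^i(z)` is expanded in
`z⁻¹` for `K⁺` and in `z` for `K⁻`. -/
def IsLWeightVector (ρ : QTor P →ₐ[ℂ] Module.End ℂ V) (φ : ZMod 2 → RatFunc ℂ) (v : V) : Prop :=
  ∀ (i : ZMod 2) (k : ℕ),
    ρ (gen P (Gen.Kp i k)) v = laurentCoeff (atInv (φ i)) k • v ∧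
    ρ (gen P (Gen.Km i k)) v = laurentCoeff (φ i) k • v

/-- The module has a basis of `ℓ`-weight vectors with distinct (balanced) `ℓ`-weights. -/
def IsTame (ρ : QTor P →ₐ[ℂ] Module.End ℂ V) : Prop :=
  ∃ (ι : Type) (b : Module.Basis ι ℂ V) (φ : ι → ZMod 2 → RatFunc ℂ),
    Function.Injective φ ∧ (∀ k i, IsBalanced (φ k i)) ∧ ∀ k, IsLWeightVector ρ (φ k) (b k)

/-- The module is irreducible. -/
def IsIrred (ρ : QTor P →ₐ[ℂ] Module.End ℂ V) : Prop :=
  letI : Module (QTor P) V := Module.compHom V ρ.toRingHom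
  IsSimpleModule (QTor P) V

end Rep

/-! ### Boxes and states -/

/-- A box: a color and a coordinate in `ℂ³`. -/
structure Box where
  color : ZMod 2
  x : ℂ
  y : ℂ
  z : ℂ

/-- The position `q₁^{-x} q₂^{-y} q₃^{-z}`. -/
def Box.position (P : Params) (b : Box) : ℂ :=
  Complex.exp (-b.x * (P.logd - P.logq) - b.y * (2 * P.logq) - b.z * (-P.logq - P.logd))

def Box.coord (b : Box) : ℂ × ℂ × ℂ := (b.x, b.y, b.z)

/-- The set of all boxes under consideration, with a total order and with the partition into
positive boxes and negative (that is, not positive) boxes. -/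
structure BoxSystem (P : Params) where
  /-- the set of all boxes -/
  boxes : Set Box
  /-- the total order on boxes -/
  order : LinearOrder boxes
  /-- the positive boxes; all other boxes are negative -/
  positive : Set boxes
  /-- there are no boxes with the same position and different colors -/
  color_eq : ∀ b c : boxes, b.1.position P = c.1.position P → b.1.color = c.1.color
  /-- on boxes with coordinates differing by integers the order is lexicographic, `y > z > x` -/
  lex : ∀ (b c : boxes) (k l m : ℤ), b.1.x - c.1.x = k → b.1.y - c.1.y = l → b.1.z - c.1.z = m →
    (order.lt c b ↔ 0 < l ∨ (l = 0 ∧ 0 < m) ∨ (l = 0 ∧ m = 0 ∧ 0 < k))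
  /-- colors alternate in the `x` and `z` directions and do not depend on `y` -/
  color_alt : ∀ (b c : boxes) (k m : ℤ), b.1.x - c.1.x = k → b.1.z - c.1.z = m →
    b.1.color - c.1.color = ((k + m : ℤ) : ZMod 2)

namespace BoxSystem

variable {P : Params} (B : BoxSystem P)

instance : LinearOrder B.boxes := B.order

/-- A state: a finite set `s` of boxes, where `s⁺` consists of its positive and `s⁻` of its
negative boxes. The empty set is the reference state. -/
abbrev State : Type := Finset B.boxes

open Classical in
/-- `s ⊔ b`: a positive box is put into `s⁺`, a negative box is deleted from `s⁻`. -/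
def add (s : B.State) (b : B.boxes) : B.State :=
  if b ∈ B.positive then insert b s else s.erase b

open Classical in
/-- `s \ b`: a positive box is deleted from `s⁺`, a negative box is put into `s⁻`. -/
def remove (s : B.State) (b : B.boxes) : B.State :=
  if b ∈ B.positive then s.erase b else insert b s

variable (S : Set B.State)

/-- Concave boxes of a state (of any color). -/
def concave (s : B.State) : Set B.boxes :=
  {b | ((b ∈ B.positive ∧ b ∉ s) ∨ (b ∉ B.positive ∧ b ∈ s)) ∧ B.add s b ∈ S}

/-- Convex boxes of a state (of any color). -/
def convex (s : B.State) : Set B.boxes :=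
  {b | ((b ∈ B.positive ∧ b ∈ s) ∨ (b ∉ B.positive ∧ b ∉ s)) ∧ B.remove s b ∈ S}

/-- Concave boxes of color `i`. -/
def CC (i : ZMod 2) (s : B.State) : Set B.boxes := {b ∈ B.concave S s | b.1.color = i}

/-- Convex boxes of color `i`. -/
def CV (i : ZMod 2) (s : B.State) : Set B.boxes := {b ∈ B.convex S s | b.1.color = i}

/-- Every state of `S` can be brought to the reference state by deleting the boxes it consists of
(positive or negative) one at a time, staying in `S`. -/
def Connected : Prop :=
  ∀ s ∈ S, Relation.ReflTransGen
    (fun s s' : B.State => s' ∈ S ∧ ∃ b ∈ s, s' = s.erase b) s ∅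

open Classical in
/-- The contribution of a box `b` of a state to component `j` of its `ℓ`-weight:
`A⁻¹` for a positive box, `A` for a negative one. -/
def factor (b : B.boxes) (j : ZMod 2) : RatFunc ℂ :=
  if b ∈ B.positive then (rootA P b.1.color (b.1.position P) j)⁻¹
  else rootA P b.1.color (b.1.position P) j

variable (Ψ : ZMod 2 → RatFunc ℂ)

/-- The `ℓ`-weight `φ_s` of a state. -/
def weight (s : B.State) (j : ZMod 2) : RatFunc ℂ := Ψ j * ∏ b ∈ s, B.factor b j

open Classical in
/-- The partial `ℓ`-weight `φ_{s, < b}`. The factor `Ψ` belongs to it if `b` is positive. -/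
def weightLT (s : B.State) (b : B.boxes) (j : ZMod 2) : RatFunc ℂ :=
  (if b ∈ B.positive then Ψ j else 1) * ∏ c ∈ s with c < b, B.factor c j

open Classical in
/-- The partial `ℓ`-weight `φ_{s, > b}`. The factor `Ψ` belongs to it if `b` is negative. -/
def weightGT (s : B.State) (b : B.boxes) (j : ZMod 2) : RatFunc ℂ :=
  (if b ∈ B.positive then 1 else Ψ j) * ∏ c ∈ s with b < c, B.factor c j

/-! The assumptions on `S` and `Ψ`. -/

/-- The `ℓ`-weights of the states are distinct. -/
def DistinctWeights : Prop := Set.InjOn (B.weight Ψ) S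

/-- The `ℓ`-weights of the states are balanced and have only simple poles. -/
def SimplePoles : Prop :=
  ∀ s ∈ S, ∀ i, IsBalanced (B.weight Ψ s i) ∧ HasSimplePoles (B.weight Ψ s i)

/-- Positions identify the concave and convex boxes of color `i` with the poles of `φ_s^i`. -/
def PolesAreBoxes : Prop :=
  ∀ s ∈ S, ∀ i, Set.BijOn (fun b : B.boxes => b.1.position P) (B.CC S i s ∪ B.CV S i s)
    {a | IsPole (B.weight Ψ s i) a}

/-- At concave and convex boxes `b`, the partial weight `φ_{s, > b}` (for positive `b`) or
`φ_{s, < b}` (for negative `b`) is regular at the position of `b`. -/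
def PartialRegular : Prop :=
  ∀ s ∈ S, ∀ i, ∀ b ∈ B.CC S i s ∪ B.CV S i s,
    (b ∈ B.positive → IsRegularAt (B.weightGT Ψ s b i) (b.1.position P)) ∧
    (b ∉ B.positive → IsRegularAt (B.weightLT Ψ s b i) (b.1.position P))

/-- Adding a box creates concave boxes and destroys convex boxes only next to it. -/
def Aligned : Prop :=
  ∀ s ∈ S, ∀ b ∈ B.concave S s,
    (∀ c ∈ B.concave S (B.add s b), c ∉ B.concave S s →
      c.1.coord ∈ ({(b.1.x, b.1.y, b.1.z + 1), (b.1.x, b.1.y + 1, b.1.z),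
        (b.1.x + 1, b.1.y, b.1.z)} : Set (ℂ × ℂ × ℂ))) ∧
    (∀ c ∈ B.convex S s, c ∉ B.convex S (B.add s b) →
      c.1.coord ∈ ({(b.1.x, b.1.y, b.1.z), (b.1.x, b.1.y, b.1.z - 1), (b.1.x, b.1.y - 1, b.1.z),
        (b.1.x - 1, b.1.y, b.1.z)} : Set (ℂ × ℂ × ℂ)))

/-! The action. -/

open Classical in
/-- The coefficient `a_{s,b}` of the action of `F` at a concave box. -/
def aCoeff (s : B.State) (b : B.boxes) : ℂ :=
  if b ∈ B.positive then value (B.weightGT Ψ s b b.1.color) (b.1.position P)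
  else -1 / (P.q - P.q⁻¹) *
    residue (B.weightGT Ψ s b b.1.color / RatFunc.X) (b.1.position P)

open Classical in
/-- The coefficient `b_{s,b}` of the action of `E` at a convex box. -/
def bCoeff (s : B.State) (b : B.boxes) : ℂ :=
  if b ∈ B.positive then
    1 / (P.q - P.q⁻¹) * residue (B.weightLT Ψ s b b.1.color / RatFunc.X) (b.1.position P)
  else value (B.weightLT Ψ s b b.1.color) (b.1.position P)

/-- The vector space with basis labeled by `S`. -/
abbrev Space : Type := S →₀ ℂ

/-- The basis vector of a state. -/
def ket (s : B.State) (hs : s ∈ S) : B.Space S := Finsupp.single ⟨s, hs⟩ 1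

/-- The generators act by the explicit formulas: `K^±_i(z)` acts on the vector of `s` by `φ_s^i`,
`F_i(z)` by `∑_b a_{s,b} δ(z/p(b)) |s ⊔ b⟩` over concave boxes `b` of color `i`, `E_i(z)` by
`∑_b b_{s,b} δ(z/p(b)) |s \ b⟩` over convex boxes `b` of color `i`, and `t` by the number `τ`.
The coefficient of `z ^ (-k)` in `δ(z/p)` is `p ^ k`. -/
structure ActsByFormulas (τ : ℂ) (ρ : QTor P →ₐ[ℂ] Module.End ℂ (B.Space S)) : Prop where
  K : ∀ (s : B.State) (hs : s ∈ S), IsLWeightVector ρ (B.weight Ψ s) (B.ket S s hs)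
  F : ∀ (s : B.State) (hs : s ∈ S) (i : ZMod 2) (k : ℤ),
    ρ (gen P (Gen.F i k)) (B.ket S s hs) =
      ∑ᶠ b : B.CC S i s,
        (B.aCoeff Ψ s b.1 * (b.1.1.position P) ^ k) • B.ket S (B.add s b.1) b.2.1.2
  E : ∀ (s : B.State) (hs : s ∈ S) (i : ZMod 2) (k : ℤ),
    ρ (gen P (Gen.E i k)) (B.ket S s hs) =
      ∑ᶠ b : B.CV S i s,
        (B.bCoeff Ψ s b.1 * (b.1.1.position P) ^ k) • B.ket S (B.remove s b.1) b.2.1.2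
  t : ∀ (s : B.State) (hs : s ∈ S), ρ (gen P Gen.t) (B.ket S s hs) = τ • B.ket S s hs

end BoxSystem

end Toroidal

end

/-!
The space of states carries the module because the poles of the weights know which boxes can be
added and removed.

**States and weights.** A box is called *occupied* in a state if it is a positive box of the state
or a negative box missing from it (`Occ`). Adding a box to the state then always means occupying
it, removing always means freeing it, and every removal multiplies the weight by the affine root of
the box (`weight_remove`), whose simple zeros and poles sit exactly where the structure functions
`g_{i,j}` vanish (`ordAt_rootA`). Boxes related by such a zero are neighbours (`Edge`).
All weights of states have simple poles only, at the positions of the concave and convex boxes. It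
follows that two convex boxes can be removed one after the other, and two concave boxes can be
added one after the other (`convex_remove`, `concave_add`): if two boxes obstruct each other, then
the same exchange of boxes can be repeated indefinitely, and the orders of the weights are unbounded
from below. In the same way three successive additions along a directed triangle of neighbours
would repeat indefinitely (`not_wheel`). Hence a failure of two moves to commute occurs
only for neighbours, where a structure function vanishes.

**Coefficients.** The largest positive box of a state is convex and the smallest negative box is
concave. Stripping off these extremal boxes shows that at a concave or convex positive box the
pole of the weight is carried by the part below the box, while the part above it is
regular and nonzero there, and conversely for negative boxes (`ordAt_of_positive`,
`ordAt_of_negative`). So the coefficients of the action are nonzero, and they change by values of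
affine roots when another box is added or removed.

**Relations.** The currents `E` and `F` are locally finite sums of delta functions with one-box
operators `eOp`, `fOp` as coefficients. Every relation involves finitely many boxes on each vector,
so it suffices to verify it for the action truncated to finite sets of boxes
(`eventually_truncated`, `freeAction_eq`).
* The quadratic relations become exchange relations between two one-box operators: if both orders
  of the moves are possible, the coefficients differ by a value of an affine root, and otherwise
  the structure function vanishes (`exchange_eOp`, `exchange_fOp`).
* For the Serre relations, all words in four one-box operators are multiples of a single
  operator (`IsLetterFamily.words`), and the symmetrized coefficients vanish by the identity
  `serre_polynomial_identity`. The operators `fOp` satisfy the same axioms for the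
  opposite multiplication, which sends the Serre expression to a multiple of itself.
* In `[E, F]` different boxes do not contribute, and each box contributes the residue of the weight
  divided by `z` (`residue_weight`). The sum of these is the difference of the two
  expansions of the weight (`coeffInfty_sub_coeffZero`).
* The relations with the Cartan currents hold because adding or removing a box multiplies the
  weight by an affine root, which is the ratio of two structure functions
  (`IsExpansion.exchange`).

**Tameness and irreducibility.** The weights of the states are distinct. Hence a nonzero submodule
contains the vector of some state (`vec_mem_of_apply_ne_zero`); as the coefficients of the
action are nonzero and every state is connected to the empty one, it contains all of them
(`vec_mem_iff`).
-/

open scoped BigOperators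

noncomputable section

namespace Toroidal

/-! ### Orders, values and residues of rational functions -/

section RationalFunctions

open scoped Polynomial

/-- The order of vanishing of `f` at `a`: positive at zeros, negative at poles, and `0` for
`f = 0`. -/
def ordAt (a : ℂ) (f : RatFunc ℂ) : ℤ :=
  (f.num.rootMultiplicity a : ℤ) - f.denom.rootMultiplicity a

lemma ordAt_div (a : ℂ) {p q : ℂ[X]} (hp : p ≠ 0) (hq : q ≠ 0) :
    ordAt a (algebraMap _ _ p / algebraMap _ _ q) =
      (p.rootMultiplicity a : ℤ) - q.rootMultiplicity a := by
  set f : RatFunc ℂ := algebraMap _ _ p / algebraMap _ _ q with hf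
  have hf0 : f ≠ 0 := div_ne_zero (RatFunc.algebraMap_ne_zero hp) (RatFunc.algebraMap_ne_zero hq)
  have h := (RatFunc.num_mul_eq_mul_denom_iff hq).2 hf
  have h1 := congrArg (Polynomial.rootMultiplicity a) h
  rw [Polynomial.rootMultiplicity_mul (mul_ne_zero (RatFunc.num_ne_zero hf0) hq),
    Polynomial.rootMultiplicity_mul (mul_ne_zero hp f.denom_ne_zero)] at h1
  unfold ordAt
  omega

lemma ordAt_mul (a : ℂ) {f g : RatFunc ℂ} (hf : f ≠ 0) (hg : g ≠ 0) :
    ordAt a (f * g) = ordAt a f + ordAt a g := by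
  have h : f * g = algebraMap _ _ (f.num * g.num) / algebraMap _ _ (f.denom * g.denom) := by
    conv_lhs => rw [← RatFunc.num_div_denom f, ← RatFunc.num_div_denom g]
    rw [div_mul_div_comm, map_mul, map_mul]
  have h1 := mul_ne_zero (RatFunc.num_ne_zero hf) (RatFunc.num_ne_zero hg)
  have h2 := mul_ne_zero f.denom_ne_zero g.denom_ne_zero
  rw [h, ordAt_div a h1 h2, Polynomial.rootMultiplicity_mul h1, Polynomial.rootMultiplicity_mul h2]
  unfold ordAt
  push_cast
  ring

@[simp] lemma ordAt_one (a : ℂ) : ordAt a 1 = 0 := by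
  simp [ordAt]

lemma ordAt_inv (a : ℂ) {f : RatFunc ℂ} (hf : f ≠ 0) : ordAt a f⁻¹ = -ordAt a f := by
  have := ordAt_mul a hf (inv_ne_zero hf)
  rw [mul_inv_cancel₀ hf, ordAt_one] at this
  omega

lemma ordAt_nonneg_iff (a : ℂ) (f : RatFunc ℂ) : 0 ≤ ordAt a f ↔ f.denom.eval a ≠ 0 := by
  constructor
  · intro h hd
    have hr : f.denom.IsRoot a := hd
    have h1 := (Polynomial.rootMultiplicity_pos f.denom_ne_zero).2 hr
    have h2 : ¬ f.num.IsRoot a := by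
      intro hn
      obtain ⟨u, v, huv⟩ := f.isCoprime_num_denom
      have := congrArg (Polynomial.eval a) huv
      simp [hn.eq_zero, hd] at this
    have h3 := Polynomial.rootMultiplicity_eq_zero h2
    unfold ordAt at h
    omega
  · intro h
    have h3 : f.denom.rootMultiplicity a = 0 := Polynomial.rootMultiplicity_eq_zero h
    unfold ordAt
    omega

lemma isPole_iff_ordAt_neg (a : ℂ) (f : RatFunc ℂ) : IsPole f a ↔ ordAt a f < 0 := by
  rw [← not_le, ordAt_nonneg_iff]
  simp [IsPole, Polynomial.IsRoot]

lemma isRegularAt_iff (a : ℂ) (f : RatFunc ℂ) : IsRegularAt f a ↔ f.denom.eval a ≠ 0 := Iff.rfl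

lemma neg_one_le_ordAt {f : RatFunc ℂ} (hf : HasSimplePoles f) (a : ℂ) : -1 ≤ ordAt a f := by
  have := hf a
  unfold ordAt
  omega

lemma value_eq (f : RatFunc ℂ) (a : ℂ) : value f a = f.num.eval a / f.denom.eval a := rfl

lemma value_mul {f g : RatFunc ℂ} {a : ℂ} (hf : 0 ≤ ordAt a f) (hg : 0 ≤ ordAt a g) :
    value (f * g) a = value f a * value g a :=
  RatFunc.eval_mul (f := RingHom.id ℂ) (a := a) ((ordAt_nonneg_iff a f).1 hf)
    ((ordAt_nonneg_iff a g).1 hg)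

lemma value_div (a : ℂ) {p q : ℂ[X]} (hq : q.eval a ≠ 0) :
    value (algebraMap _ _ p / algebraMap _ _ q) a = p.eval a / q.eval a := by
  have hq0 : q ≠ 0 := by rintro rfl; simp at hq
  set f : RatFunc ℂ := algebraMap _ _ p / algebraMap _ _ q with hf
  have h := (RatFunc.num_mul_eq_mul_denom_iff hq0).2 hf
  have hd : f.denom.eval a ≠ 0 := by
    obtain ⟨r, hr⟩ := RatFunc.denom_div_dvd p q
    intro h0
    apply hq
    rw [hr, Polynomial.eval_mul, ← hf, h0, zero_mul]
  rw [value_eq, div_eq_div_iff hd hq, ← Polynomial.eval_mul, h, Polynomial.eval_mul]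

lemma ordAt_eq_zero_of_value_ne_zero {f : RatFunc ℂ} {a : ℂ} (h : value f a ≠ 0) :
    ordAt a f = 0 := by
  rw [value_eq, div_ne_zero_iff] at h
  simp [ordAt, Polynomial.rootMultiplicity_eq_zero h.1, Polynomial.rootMultiplicity_eq_zero h.2]

lemma value_ne_zero {f : RatFunc ℂ} {a : ℂ} (hf : f ≠ 0) (h : ordAt a f = 0) : value f a ≠ 0 := by
  have hd := (ordAt_nonneg_iff a f).1 h.ge
  rw [value_eq]
  refine div_ne_zero (fun hn => ?_) hd
  have h1 := (Polynomial.rootMultiplicity_pos (RatFunc.num_ne_zero hf)).2 hn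
  have h2 : f.denom.rootMultiplicity a = 0 := Polynomial.rootMultiplicity_eq_zero hd
  unfold ordAt at h
  omega

lemma value_inv {f : RatFunc ℂ} {a : ℂ} (hf : f ≠ 0) (h : ordAt a f = 0) :
    value f⁻¹ a = (value f a)⁻¹ := by
  have h1 : ordAt a f⁻¹ = 0 := by rw [ordAt_inv a hf, h, neg_zero]
  have := value_mul h.ge h1.ge
  rw [mul_inv_cancel₀ hf] at this
  refine eq_inv_of_mul_eq_one_right ?_
  rw [← this]
  simp [value]

lemma ne_zero_of_isBalanced {f : RatFunc ℂ} (hf : IsBalanced f) : f ≠ 0 := by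
  rintro rfl
  have := hf.2.2
  simp [value] at this

/-! ### Laurent expansions and residues -/

open scoped RatFunc LaurentSeries PowerSeries

lemma laurentCoeff_div {p q : ℂ[X]} (hq : q.coeff 0 ≠ 0) (n : ℤ) :
    laurentCoeff (algebraMap _ _ p / algebraMap _ _ q) n =
      if n < 0 then 0 else
        PowerSeries.coeff n.natAbs ((p : PowerSeries ℂ) * (q : PowerSeries ℂ)⁻¹) := by
  have key : algebraMap (RatFunc ℂ) (LaurentSeries ℂ) (algebraMap _ _ p / algebraMap _ _ q) =
      (((p : PowerSeries ℂ) * (q : PowerSeries ℂ)⁻¹ : PowerSeries ℂ) : LaurentSeries ℂ) := by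
    have h0 : PowerSeries.constantCoeff (q : PowerSeries ℂ) ≠ 0 := by simpa using hq
    have hq0 : q ≠ 0 := by rintro rfl; simp at hq
    have e : ∀ r : ℂ[X], algebraMap (RatFunc ℂ) (LaurentSeries ℂ) (algebraMap _ _ r) =
        ((r : PowerSeries ℂ) : LaurentSeries ℂ) := fun r => by
      rw [RatFunc.coe_coe, RatFunc.coePolynomial_eq_algebraMap]
    have hne : algebraMap (RatFunc ℂ) (LaurentSeries ℂ) (algebraMap _ _ q) ≠ 0 :=
      (map_ne_zero _).2 (RatFunc.algebraMap_ne_zero hq0)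
    rw [map_div₀, div_eq_iff hne, e, e, ← PowerSeries.coe_mul, mul_assoc,
      PowerSeries.inv_mul_cancel _ h0, mul_one]
  rw [laurentCoeff, key, PowerSeries.coeff_coe]

lemma laurentCoeff_add (f g : RatFunc ℂ) (n : ℤ) :
    laurentCoeff (f + g) n = laurentCoeff f n + laurentCoeff g n := by
  simp [laurentCoeff]

lemma laurentCoeff_C_mul (c : ℂ) (f : RatFunc ℂ) (n : ℤ) :
    laurentCoeff (RatFunc.C c * f) n = c * laurentCoeff f n := by
  have h : algebraMap (RatFunc ℂ) (LaurentSeries ℂ) (RatFunc.C c) = HahnSeries.C c := by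
    rw [← RatFunc.algebraMap_C, ← RatFunc.coePolynomial_eq_algebraMap, ← RatFunc.coe_coe,
      Polynomial.coe_C, PowerSeries.coe_C]
  rw [laurentCoeff, map_mul, h, HahnSeries.C_mul_eq_smul]
  simp [laurentCoeff]

lemma laurentCoeff_X_mul (f : RatFunc ℂ) (n : ℤ) :
    laurentCoeff (RatFunc.X * f) n = laurentCoeff f (n - 1) := by
  have := HahnSeries.coeff_single_mul_add (r := (1 : ℂ))
    (x := algebraMap (RatFunc ℂ) (LaurentSeries ℂ) f) (a := n - 1) (b := 1)
  rw [laurentCoeff, map_mul, RatFunc.coe_X]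
  simpa [laurentCoeff] using this

lemma laurentCoeff_of_regular {f : RatFunc ℂ} (hf : IsRegularAt f 0) :
    (∀ n < 0, laurentCoeff f n = 0) ∧ laurentCoeff f 0 = value f 0 := by
  have h0 : f.denom.coeff 0 ≠ 0 := by
    rw [Polynomial.coeff_zero_eq_eval_zero]; exact hf
  have h := laurentCoeff_div (p := f.num) h0
  rw [RatFunc.num_div_denom] at h
  refine ⟨fun n hn => by rw [h, if_pos hn], ?_⟩
  rw [h, value_eq]
  simp [Polynomial.coeff_zero_eq_eval_zero, div_eq_mul_inv]

lemma residue_eq_value {f : RatFunc ℂ} {a : ℂ} (h : 0 ≤ ordAt a ((RatFunc.X - RatFunc.C a) * f)) :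
    residue f a = value ((RatFunc.X - RatFunc.C a) * f) a := by
  set g := (RatFunc.X - RatFunc.C a) * f with hg
  have h1 : RatFunc.laurent a g = RatFunc.X * RatFunc.laurent a f := by
    rw [hg, map_mul, map_sub, RatFunc.laurent_X, RatFunc.laurent_C, add_sub_cancel_right]
  have h2 : RatFunc.laurent a g =
      algebraMap _ _ (Polynomial.taylor a g.num) /
        algebraMap _ _ (Polynomial.taylor a g.denom) := by
    conv_lhs => rw [← RatFunc.num_div_denom g, RatFunc.laurent_div]
  have h3 : (Polynomial.taylor a g.denom).coeff 0 ≠ 0 := by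
    rw [Polynomial.taylor_coeff_zero]; exact (ordAt_nonneg_iff a g).1 h
  have h4 := laurentCoeff_div (p := Polynomial.taylor a g.num) h3 0
  rw [← h2, h1, laurentCoeff_X_mul] at h4
  rw [residue]
  simpa [value_eq, Polynomial.taylor_coeff_zero, div_eq_mul_inv] using h4

lemma X_sub_C_ne_zero (a : ℂ) : (RatFunc.X - RatFunc.C a : RatFunc ℂ) ≠ 0 := by
  rw [← RatFunc.algebraMap_X, ← RatFunc.algebraMap_C, ← map_sub]
  exact RatFunc.algebraMap_ne_zero (Polynomial.X_sub_C_ne_zero a)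

lemma ordAt_X_sub_C (a b : ℂ) :
    ordAt a (RatFunc.X - RatFunc.C b : RatFunc ℂ) = if a = b then 1 else 0 := by
  have := ordAt_div a (Polynomial.X_sub_C_ne_zero b) (one_ne_zero (α := ℂ[X]))
  rw [map_one, div_one, map_sub, RatFunc.algebraMap_X, RatFunc.algebraMap_C] at this
  rw [this, Polynomial.rootMultiplicity_X_sub_C]
  have h1 : Polynomial.rootMultiplicity a (1 : ℂ[X]) = 0 :=
    Polynomial.rootMultiplicity_eq_zero (by simp)
  rw [h1]
  split_ifs <;> simp

lemma ordAt_X_sub_C_mul {f : RatFunc ℂ} (hf : f ≠ 0) (a : ℂ) :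
    ordAt a ((RatFunc.X - RatFunc.C a) * f) = ordAt a f + 1 := by
  rw [ordAt_mul a (X_sub_C_ne_zero a) hf, ordAt_X_sub_C, if_pos rfl, add_comm]

lemma residue_mul {f g : RatFunc ℂ} {a : ℂ} (hf0 : f ≠ 0) (hg0 : g ≠ 0) (hf : -1 ≤ ordAt a f)
    (hg : 0 ≤ ordAt a g) : residue (f * g) a = residue f a * value g a := by
  have h1 : 0 ≤ ordAt a ((RatFunc.X - RatFunc.C a) * f) := by
    rw [ordAt_X_sub_C_mul hf0]; omega
  have h2 : 0 ≤ ordAt a ((RatFunc.X - RatFunc.C a) * (f * g)) := by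
    rw [ordAt_X_sub_C_mul (mul_ne_zero hf0 hg0), ordAt_mul a hf0 hg0]; omega
  rw [residue_eq_value h1, residue_eq_value h2, ← mul_assoc, value_mul h1 hg]

lemma residue_ne_zero {f : RatFunc ℂ} {a : ℂ} (hf0 : f ≠ 0) (hf : ordAt a f = -1) :
    residue f a ≠ 0 := by
  have h1 : ordAt a ((RatFunc.X - RatFunc.C a) * f) = 0 := by
    rw [ordAt_X_sub_C_mul hf0]; omega
  rw [residue_eq_value h1.ge]
  exact value_ne_zero (mul_ne_zero (X_sub_C_ne_zero a) hf0) h1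

lemma residue_div_X {f : RatFunc ℂ} {a : ℂ} (ha : a ≠ 0) (hf0 : f ≠ 0) (hf : -1 ≤ ordAt a f) :
    residue (f / RatFunc.X) a = residue f a / a := by
  have hX : ordAt a (RatFunc.X : RatFunc ℂ) = 0 := by
    have := ordAt_X_sub_C a 0
    rwa [map_zero, sub_zero, if_neg ha] at this
  have h2 : ordAt a (RatFunc.X⁻¹ : RatFunc ℂ) = 0 := by
    rw [ordAt_inv a RatFunc.X_ne_zero, hX, neg_zero]
  rw [div_eq_mul_inv, residue_mul hf0 (inv_ne_zero RatFunc.X_ne_zero) hf h2.ge,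
    value_inv RatFunc.X_ne_zero hX]
  simp [value, div_eq_mul_inv]

lemma residue_add (f g : RatFunc ℂ) (a : ℂ) : residue (f + g) a = residue f a + residue g a := by
  rw [residue, map_add, laurentCoeff_add]; rfl

lemma residue_sum {ι : Type*} (s : Finset ι) (f : ι → RatFunc ℂ) (a : ℂ) :
    residue (∑ i ∈ s, f i) a = ∑ i ∈ s, residue (f i) a := by
  classical
  induction s using Finset.induction_on with
  | empty => simp [residue, laurentCoeff]
  | insert i s hi ih => rw [Finset.sum_insert hi, Finset.sum_insert hi, residue_add, ih]

lemma residue_of_regular {f : RatFunc ℂ} {a : ℂ} (h : 0 ≤ ordAt a f) : residue f a = 0 := by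
  by_cases hf : f = 0
  · subst hf; simp [residue, laurentCoeff]
  have h1 : 0 ≤ ordAt a ((RatFunc.X - RatFunc.C a) * f) := by
    rw [ordAt_X_sub_C_mul hf]; omega
  rw [residue_eq_value h1, value_mul _ h]
  · have : value (RatFunc.X - RatFunc.C a) a = 0 := by
      have := value_div a (p := Polynomial.X - Polynomial.C a) (q := 1) (by simp)
      simpa using this
    rw [this, zero_mul]
  · rw [ordAt_X_sub_C]; simp

lemma residue_simple_fraction (r a b : ℂ) :
    residue (RatFunc.C r / (RatFunc.X - RatFunc.C b)) a = if a = b then r else 0 := by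
  split_ifs with h
  · subst h
    have e : (RatFunc.X - RatFunc.C a) * (RatFunc.C r / (RatFunc.X - RatFunc.C a)) = RatFunc.C r :=
      mul_div_cancel₀ _ (X_sub_C_ne_zero a)
    have h0 : 0 ≤ ordAt a (RatFunc.C r) := by
      rw [ordAt_nonneg_iff]; simp
    rw [residue_eq_value (by rw [e]; exact h0), e]
    simp [value]
  · apply residue_of_regular
    by_cases hr : r = 0
    · subst hr; simp [ordAt]
    have hr' : (RatFunc.C r : RatFunc ℂ) ≠ 0 := by simpa using hr
    rw [div_eq_mul_inv, ordAt_mul a hr' (inv_ne_zero (X_sub_C_ne_zero b)),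
      ordAt_inv a (X_sub_C_ne_zero b), ordAt_X_sub_C, if_neg h]
    have h0 : 0 ≤ ordAt a (RatFunc.C r) := by
      rw [ordAt_nonneg_iff]; simp
    omega

/-! ### Expansions at zero and at infinity -/

lemma eval₂_inv_X_ne_zero {p : ℂ[X]} (hp : p ≠ 0) :
    Polynomial.eval₂ RatFunc.C (RatFunc.X⁻¹ : RatFunc ℂ) p ≠ 0 := by
  intro h
  refine hp ((transcendental_iff.1 ?_) p h)
  exact fun h => RatFunc.transcendental_X (IsAlgebraic.inv_iff.1 h)

lemma atInv_mul (f g : RatFunc ℂ) : atInv (f * g) = atInv f * atInv g :=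
  RatFunc.eval_mul _ _ (eval₂_inv_X_ne_zero f.denom_ne_zero) (eval₂_inv_X_ne_zero g.denom_ne_zero)

lemma atInv_add (f g : RatFunc ℂ) : atInv (f + g) = atInv f + atInv g :=
  RatFunc.eval_add _ _ (eval₂_inv_X_ne_zero f.denom_ne_zero) (eval₂_inv_X_ne_zero g.denom_ne_zero)

/-- The coefficient of `z ^ (-m)` in the expansion of `f(z)` at `z = ∞`. -/
def coeffInfty (f : RatFunc ℂ) (m : ℤ) : ℂ := laurentCoeff (atInv f) m

/-- The coefficient of `z ^ (-m)` in the expansion of `f(z)` at `z = 0`. -/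
def coeffZero (f : RatFunc ℂ) (m : ℤ) : ℂ := laurentCoeff f (-m)

/-- The properties shared by the expansions at `0` and at `∞`: the coefficients of `z ^ (-m)`
depend linearly on the function, and multiplication by `z` shifts them. -/
structure IsExpansion (c : RatFunc ℂ → ℤ → ℂ) : Prop where
  add : ∀ f g m, c (f + g) m = c f m + c g m
  C_mul : ∀ a f m, c (RatFunc.C a * f) m = a * c f m
  X_mul : ∀ f m, c (RatFunc.X * f) m = c f (m + 1)
  one : ∀ m, c 1 m = if m = 0 then 1 else 0

lemma laurentCoeff_one (m : ℤ) : laurentCoeff 1 m = if m = 0 then 1 else 0 := by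
  simp [laurentCoeff, HahnSeries.coeff_one]

lemma isExpansion_coeffZero : IsExpansion coeffZero where
  add f g m := laurentCoeff_add f g _
  C_mul a f m := laurentCoeff_C_mul a f _
  X_mul f m := by
    rw [coeffZero, laurentCoeff_X_mul, coeffZero]; congr 1; ring
  one m := by simp [coeffZero, laurentCoeff_one]

lemma isExpansion_coeffInfty : IsExpansion coeffInfty where
  add f g m := by rw [coeffInfty, atInv_add, laurentCoeff_add]; rfl
  C_mul a f m := by
    have : atInv (RatFunc.C a) = RatFunc.C a := by simp [atInv]
    rw [coeffInfty, atInv_mul, this, laurentCoeff_C_mul]; rfl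
  X_mul f m := by
    have h1 : atInv RatFunc.X = (RatFunc.X⁻¹ : RatFunc ℂ) := by simp [atInv]
    have h2 := laurentCoeff_X_mul (RatFunc.X⁻¹ * atInv f) (m + 1)
    rw [mul_inv_cancel_left₀ RatFunc.X_ne_zero, add_sub_cancel_right] at h2
    rw [coeffInfty, atInv_mul, h1, ← h2]; rfl
  one m := by
    have : atInv (1 : RatFunc ℂ) = 1 := by simp [atInv]
    rw [coeffInfty, this, laurentCoeff_one]

namespace IsExpansion

variable {c : RatFunc ℂ → ℤ → ℂ} (hc : IsExpansion c)
include hc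

lemma sum {ι : Type*} (s : Finset ι) (f : ι → RatFunc ℂ) (m : ℤ) :
    c (∑ i ∈ s, f i) m = ∑ i ∈ s, c (f i) m := by
  classical
  induction s using Finset.induction_on with
  | empty =>
    have := hc.C_mul 0 0 m
    simpa using this
  | insert i s hi ih => rw [Finset.sum_insert hi, Finset.sum_insert hi, hc.add, ih]

lemma X_sub_C_mul (a : ℂ) (f : RatFunc ℂ) (m : ℤ) :
    c ((RatFunc.X - RatFunc.C a) * f) m = c f (m + 1) - a * c f m := by
  have e : (RatFunc.X - RatFunc.C a) * f = RatFunc.X * f + RatFunc.C (-a) * f := by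
    rw [map_neg]; ring
  rw [e, hc.add, hc.X_mul, hc.C_mul]; ring

lemma C_mul_X_sub_C_mul (a b : ℂ) (f : RatFunc ℂ) (m : ℤ) :
    c ((RatFunc.C b * RatFunc.X - RatFunc.C a) * f) m = b * c f (m + 1) - a * c f m := by
  have e : (RatFunc.C b * RatFunc.X - RatFunc.C a) * f =
      RatFunc.C b * (RatFunc.X * f) + RatFunc.C (-a) * f := by
    rw [map_neg]; ring
  rw [e, hc.add, hc.C_mul, hc.X_mul, hc.C_mul]; ring

lemma simple_fraction (a : ℂ) (m : ℤ) :
    c (RatFunc.X - RatFunc.C a)⁻¹ (m + 1) - a * c (RatFunc.X - RatFunc.C a)⁻¹ m =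
      if m = 0 then 1 else 0 := by
  rw [← hc.X_sub_C_mul, mul_inv_cancel₀ (X_sub_C_ne_zero a), hc.one]

lemma X_pow (n : ℕ) (m : ℤ) : c (RatFunc.X ^ n) m = if m + n = 0 then 1 else 0 := by
  induction n generalizing m with
  | zero => simp [hc.one]
  | succ n ih =>
    rw [pow_succ', hc.X_mul, ih]
    push_cast
    congr 1
    rw [eq_iff_iff]
    constructor <;> intro h <;> linarith

lemma polynomial (p : ℂ[X]) (m : ℤ) :
    c (algebraMap _ _ p) m = if m ≤ 0 then p.coeff m.natAbs else 0 := by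
  conv_lhs => rw [p.as_sum_range_C_mul_X_pow]
  rw [map_sum, hc.sum]
  have : ∀ i ∈ Finset.range (p.natDegree + 1),
      c (algebraMap ℂ[X] (RatFunc ℂ) (Polynomial.C (p.coeff i) * Polynomial.X ^ i)) m =
        if i = m.natAbs ∧ m ≤ 0 then p.coeff i else 0 := by
    intro i _
    rw [map_mul, map_pow, RatFunc.algebraMap_C, RatFunc.algebraMap_X, hc.C_mul, hc.X_pow]
    rw [mul_ite, mul_one, mul_zero]
    congr 1
    rw [eq_iff_iff]
    omega
  rw [Finset.sum_congr rfl this]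
  split_ifs with hm
  · simp only [hm, and_true]
    rw [Finset.sum_ite_eq']
    split_ifs with h
    · rfl
    · rw [Finset.mem_range] at h
      exact (Polynomial.coeff_eq_zero_of_natDegree_lt (by omega)).symm
  · simp [hm]

end IsExpansion

lemma coeffZero_eq_zero {f : RatFunc ℂ} (hf : IsRegularAt f 0) {m : ℤ} (hm : 0 < m) :
    coeffZero f m = 0 := (laurentCoeff_of_regular hf).1 _ (by omega)

lemma coeffInfty_eq_zero {f : RatFunc ℂ} (hf : IsRegularAt (atInv f) 0) {m : ℤ} (hm : m < 0) :
    coeffInfty f m = 0 := (laurentCoeff_of_regular hf).1 _ hm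

lemma coeffInfty_simple_fraction_of_nonpos (a : ℂ) {m : ℤ} (hm : m ≤ 0) :
    coeffInfty (RatFunc.X - RatFunc.C a)⁻¹ m = 0 := by
  have h1 : atInv (RatFunc.X - RatFunc.C a)⁻¹ =
      algebraMap _ _ (Polynomial.X : ℂ[X]) /
        algebraMap _ _ (1 - Polynomial.C a * Polynomial.X) := by
    have hne : (1 - Polynomial.C a * Polynomial.X : ℂ[X]) ≠ 0 := by
      intro h
      have := congrArg (Polynomial.eval 0) h
      simp at this
    have h2 : atInv (RatFunc.X - RatFunc.C a) * atInv (RatFunc.X - RatFunc.C a)⁻¹ = 1 := by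
      rw [← atInv_mul, mul_inv_cancel₀ (X_sub_C_ne_zero a)]; simp [atInv]
    have h3 : atInv (RatFunc.X - RatFunc.C a) = RatFunc.X⁻¹ - RatFunc.C a := by
      rw [sub_eq_add_neg, ← map_neg, atInv_add, atInv, atInv, RatFunc.eval_X, RatFunc.eval_C,
        map_neg, sub_eq_add_neg]
    rw [eq_div_iff (RatFunc.algebraMap_ne_zero hne)]
    have h4 : algebraMap ℂ[X] (RatFunc ℂ) (1 - Polynomial.C a * Polynomial.X) =
        RatFunc.X * atInv (RatFunc.X - RatFunc.C a) := by
      rw [h3, mul_sub, mul_inv_cancel₀ RatFunc.X_ne_zero, map_sub, map_mul, map_one,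
        RatFunc.algebraMap_C, RatFunc.algebraMap_X, mul_comm]
    rw [h4, mul_comm, mul_assoc, h2, mul_one, RatFunc.algebraMap_X]
  have h2 := laurentCoeff_div (p := Polynomial.X)
    (q := 1 - Polynomial.C a * Polynomial.X) (by simp) m
  rw [← h1] at h2
  rw [coeffInfty, h2]
  split_ifs with h
  · rfl
  · obtain rfl : m = 0 := by omega
    simp

lemma coeffZero_simple_fraction_of_pos {a : ℂ} (ha : a ≠ 0) {m : ℤ} (hm : 0 < m) :
    coeffZero (RatFunc.X - RatFunc.C a)⁻¹ m = 0 := by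
  refine coeffZero_eq_zero ?_ hm
  rw [isRegularAt_iff, ← ordAt_nonneg_iff, ordAt_inv _ (X_sub_C_ne_zero a), ordAt_X_sub_C,
    if_neg ha.symm, neg_zero]

lemma simple_fraction_difference {a : ℂ} (ha : a ≠ 0) (m : ℤ) :
    coeffInfty (RatFunc.X - RatFunc.C a)⁻¹ m - coeffZero (RatFunc.X - RatFunc.C a)⁻¹ m =
      a ^ (m - 1) := by
  set u : RatFunc ℂ := (RatFunc.X - RatFunc.C a)⁻¹ with hu
  have hrec : ∀ k : ℤ, coeffInfty u (k + 1) - coeffZero u (k + 1) =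
      a * (coeffInfty u k - coeffZero u k) := by
    intro k
    have h1 := isExpansion_coeffInfty.simple_fraction a k
    have h2 := isExpansion_coeffZero.simple_fraction a k
    linear_combination h1 - h2
  have h1 : coeffInfty u 1 - coeffZero u 1 = 1 := by
    have h1 := isExpansion_coeffInfty.simple_fraction a 0
    rw [coeffInfty_simple_fraction_of_nonpos a le_rfl] at h1
    rw [coeffZero_simple_fraction_of_pos ha one_pos]
    simpa using h1
  induction m using Int.inductionOn' (b := 1) with
  | zero => simpa using h1
  | succ k _ ih =>
    rw [hrec, ih, ← zpow_one_add₀ ha]; congr 1; ring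
  | pred k _ ih =>
    have := hrec (k - 1)
    rw [sub_add_cancel, ih] at this
    rw [zpow_sub_one₀ ha, this]
    field_simp

/-- The residue theorem for a rational function with simple poles that is regular at `0`:
its expansions at `∞` and at `0` differ by delta functions supported at the poles. -/
theorem coeffInfty_sub_coeffZero {f : RatFunc ℂ} (h0 : IsRegularAt f 0)
    (hs : HasSimplePoles f) (m : ℤ) :
    coeffInfty f m - coeffZero f m =
      ∑ a ∈ f.denom.roots.toFinset, residue (f / RatFunc.X) a * a ^ m := by
  set A := f.denom.roots.toFinset with hA
  have hA0 : ∀ a ∈ A, a ≠ 0 := by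
    rintro a ha rfl
    rw [hA, Multiset.mem_toFinset, Polynomial.mem_roots f.denom_ne_zero] at ha
    exact h0 ha
  have hden : f.denom = ∏ a ∈ A, (Polynomial.X - Polynomial.C a) := by
    have hnd : f.denom.roots.Nodup := by
      rw [Multiset.nodup_iff_count_le_one]
      intro a
      rw [Polynomial.count_roots]; exact hs a
    conv_lhs => rw [(IsAlgClosed.splits f.denom).eq_prod_roots_of_monic f.monic_denom]
    rw [hA, Finset.prod, Multiset.toFinset_val, hnd.dedup]
  obtain ⟨q, r, hr, hf⟩ := Polynomial.div_prod_eq_quo_add_sum_rem_div (K := RatFunc ℂ) f.num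
    (s := A)
    (g := fun a : ℂ => Polynomial.X - Polynomial.C a) (fun a _ => Polynomial.monic_X_sub_C a)
    (fun a _ b _ hab => Polynomial.isCoprime_X_sub_C_of_isUnit_sub (sub_ne_zero.2 hab).isUnit)
  have hr' : ∀ a ∈ A, r a = Polynomial.C ((r a).coeff 0) := by
    intro a ha
    apply Polynomial.eq_C_of_degree_le_zero
    have := hr a ha
    rw [Polynomial.degree_X_sub_C] at this
    exact Order.le_of_lt_succ this
  have hf2 : f = algebraMap _ _ q +
      ∑ a ∈ A, RatFunc.C ((r a).coeff 0) / (RatFunc.X - RatFunc.C a) := by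
    conv_lhs => rw [← RatFunc.num_div_denom f, hden, map_prod]
    refine hf.trans ?_
    congr 1
    refine Finset.sum_congr rfl fun a ha => ?_
    conv_lhs => rw [hr' a ha]
    simp [RatFunc.algebraMap_C, RatFunc.algebraMap_X]
  have hexp : ∀ c, IsExpansion c → ∀ m, c f m = c (algebraMap _ _ q) m +
      ∑ a ∈ A, (r a).coeff 0 * c (RatFunc.X - RatFunc.C a)⁻¹ m := by
    intro c hc m
    conv_lhs => rw [hf2]
    rw [hc.add, hc.sum]
    congr 1
    refine Finset.sum_congr rfl fun a _ => ?_
    rw [div_eq_mul_inv, hc.C_mul]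
  have hq : coeffInfty (algebraMap _ _ q) m = coeffZero (algebraMap _ _ q) m := by
    rw [isExpansion_coeffInfty.polynomial, isExpansion_coeffZero.polynomial]
  have hres : ∀ a ∈ A, residue (f / RatFunc.X) a = (r a).coeff 0 / a := by
    intro a ha
    by_cases hf0 : f = 0
    · subst hf0; simp [hA] at ha
    rw [residue_div_X (hA0 a ha) hf0 (neg_one_le_ordAt hs a)]
    congr 1
    conv_lhs => rw [hf2]
    rw [residue_add, residue_sum]
    have h1 : residue (algebraMap ℂ[X] (RatFunc ℂ) q) a = 0 := by
      apply residue_of_regular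
      rw [ordAt_nonneg_iff]; simp
    rw [h1, zero_add, Finset.sum_congr rfl fun b _ => residue_simple_fraction _ a b]
    rw [Finset.sum_ite_eq, if_pos ha]
  rw [hexp _ isExpansion_coeffInfty, hexp _ isExpansion_coeffZero, hq, add_sub_add_left_eq_sub,
    ← Finset.sum_sub_distrib]
  refine Finset.sum_congr rfl fun a ha => ?_
  rw [← mul_sub, simple_fraction_difference (hA0 a ha), hres a ha, zpow_sub_one₀ (hA0 a ha)]
  field_simp

end RationalFunctions
end Toroidal

namespace Toroidal

/-! ### Generic parameters and the structure functions -/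

namespace Params

variable (P : Params)

/-- The monomial `q ^ a * d ^ b`. -/
def mon (a b : ℤ) : ℂ := Complex.exp (a * P.logq + b * P.logd)

lemma mon_ne_zero (a b : ℤ) : P.mon a b ≠ 0 := Complex.exp_ne_zero _

lemma mon_mul_mon (a b a' b' : ℤ) : P.mon a b * P.mon a' b' = P.mon (a + a') (b + b') := by
  rw [mon, mon, mon, ← Complex.exp_add]
  congr 1
  push_cast
  ring

lemma mon_mul_mon_mul (a b a' b' : ℤ) (z : ℂ) :
    P.mon a b * (P.mon a' b' * z) = P.mon (a + a') (b + b') * z := by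
  rw [← mul_assoc, mon_mul_mon]

lemma mon_zero : P.mon 0 0 = 1 := by simp [mon]

lemma q₁_eq : P.q₁ = P.mon (-1) 1 := by
  rw [q₁, q, d, mon, ← Complex.exp_neg, ← Complex.exp_add]
  congr 1
  push_cast
  ring

lemma q₂_eq : P.q₂ = P.mon 2 0 := by
  rw [q₂, q, mon, ← Complex.exp_nat_mul]
  congr 1
  push_cast
  ring

lemma q₃_eq : P.q₃ = P.mon (-1) (-1) := by
  rw [q₃, q, d, mon, ← Complex.exp_neg, ← Complex.exp_neg, ← Complex.exp_add]
  congr 1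
  push_cast
  ring

lemma q₁_mul_q₂_mul_q₃ : P.q₁ * P.q₂ * P.q₃ = 1 := by
  rw [q₁_eq, q₂_eq, q₃_eq, mon_mul_mon, mon_mul_mon]
  norm_num [mon_zero]

variable {P}

lemma Generic.mon_mul_eq (hP : P.Generic) {a b a' b' : ℤ} {z : ℂ} (hz : z ≠ 0)
    (h : P.mon a b * z = P.mon a' b' * z) : a = a' ∧ b = b' := by
  have h1 : P.mon (a - a') (b - b') = 1 := by
    have h2 : P.mon (a - a') (b - b') * P.mon a' b' = 1 * P.mon a' b' := by
      rw [mon_mul_mon, sub_add_cancel, sub_add_cancel, one_mul]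
      exact mul_right_cancel₀ hz h
    exact mul_right_cancel₀ (P.mon_ne_zero _ _) h2
  have h3 := (hP ((a - a' : ℤ) : ℚ) ((b - b' : ℤ) : ℚ)).1 (by
    rw [← h1, mon]; push_cast; rfl)
  have h4 := h3.1
  have h5 := h3.2
  norm_cast at h4 h5
  omega

lemma Generic.mon_mul_eq_self (hP : P.Generic) {a b : ℤ} {z : ℂ} (hz : z ≠ 0)
    (h : P.mon a b * z = z) : a = 0 ∧ b = 0 := by
  refine hP.mon_mul_eq hz (a' := 0) (b' := 0) ?_
  rw [h, mon_zero, one_mul]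

lemma Generic.q_sub_inv_ne_zero (hP : P.Generic) : P.q - P.q⁻¹ ≠ 0 := by
  intro h
  have h0 : P.q ≠ 0 := Complex.exp_ne_zero _
  have h1 : P.mon 2 0 * 1 = 1 := by
    rw [← q₂_eq, q₂, mul_one, sq]
    nth_rewrite 1 [sub_eq_zero.1 h]
    exact inv_mul_cancel₀ h0
  have := (hP.mon_mul_eq_self one_ne_zero h1).1
  norm_num at this

end Params

variable {P : Params}

/-- The value `g_{i,j}(z, w)` of the structure function. -/
def gval (P : Params) (i j : ZMod 2) (z w : ℂ) : ℂ :=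
  if i = j then z - P.q₂ * w else (z - P.q₁ * w) * (z - P.q₃ * w)

/-- The ratios `z / w` for which `g_{i,j}(z, w)` vanishes, as exponents of `q` and `d`. -/
def IsStep (i j : ZMod 2) (a b : ℤ) : Prop :=
  (i = j ∧ a = 2 ∧ b = 0) ∨ (i ≠ j ∧ a = -1 ∧ (b = 1 ∨ b = -1))

lemma gval_eq_zero_iff (i j : ZMod 2) (z w : ℂ) :
    gval P i j z w = 0 ↔ ∃ a b, IsStep i j a b ∧ z = P.mon a b * w := by
  unfold gval IsStep
  rw [P.q₁_eq, P.q₂_eq, P.q₃_eq]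
  constructor
  · intro h
    split_ifs at h with hij
    · exact ⟨2, 0, Or.inl ⟨hij, rfl, rfl⟩, sub_eq_zero.1 h⟩
    · rcases mul_eq_zero.1 h with h | h
      · exact ⟨-1, 1, Or.inr ⟨hij, rfl, Or.inl rfl⟩, sub_eq_zero.1 h⟩
      · exact ⟨-1, -1, Or.inr ⟨hij, rfl, Or.inr rfl⟩, sub_eq_zero.1 h⟩
  · rintro ⟨a, b, (⟨hij, rfl, rfl⟩ | ⟨hij, rfl, (rfl | rfl)⟩), h⟩
    · rw [if_pos hij, h, sub_self]
    · rw [if_neg hij, h, sub_self, zero_mul]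
    · rw [if_neg hij, h, sub_self, mul_zero]

lemma gval_self_ne_zero (hP : P.Generic) (i : ZMod 2) {z : ℂ} (hz : z ≠ 0) :
    gval P i i z z ≠ 0 := by
  rw [Ne, gval_eq_zero_iff]
  rintro ⟨a, b, h, e⟩
  have := hP.mon_mul_eq_self hz e.symm
  unfold IsStep at h
  omega

lemma gval_swap_ne_zero (hP : P.Generic) {i j : ZMod 2} {z w : ℂ} (hw : w ≠ 0)
    (h : gval P i j z w = 0) : gval P j i w z ≠ 0 := by
  rw [Ne, gval_eq_zero_iff]
  obtain ⟨a, b, h1, rfl⟩ := (gval_eq_zero_iff i j z w).1 h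
  rintro ⟨a', b', h2, e⟩
  rw [P.mon_mul_mon_mul] at e
  have := hP.mon_mul_eq_self hw e.symm
  unfold IsStep at h1 h2
  omega

section RootOrders

open scoped Polynomial

lemma linear_ne_zero {k a : ℂ} (hk : k ≠ 0) :
    (RatFunc.C k * RatFunc.X - RatFunc.C a : RatFunc ℂ) ≠ 0 := by
  have h : (RatFunc.C k * RatFunc.X - RatFunc.C a : RatFunc ℂ) =
      algebraMap ℂ[X] _ (Polynomial.C k * Polynomial.X - Polynomial.C a) := by
    simp [RatFunc.algebraMap_C, RatFunc.algebraMap_X]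
  rw [h]
  refine RatFunc.algebraMap_ne_zero fun h0 => hk ?_
  have := congrArg (fun p => Polynomial.coeff p 1) h0
  simpa using this

lemma ordAt_linear {k : ℂ} (hk : k ≠ 0) (a x : ℂ) :
    ordAt x (RatFunc.C k * RatFunc.X - RatFunc.C a : RatFunc ℂ) = if a = k * x then 1 else 0 := by
  have hC : (RatFunc.C k : RatFunc ℂ) ≠ 0 := by simpa using hk
  have h1 : (RatFunc.C k * RatFunc.X - RatFunc.C a : RatFunc ℂ) =
      RatFunc.C k * (RatFunc.X - RatFunc.C (a / k)) := by
    rw [mul_sub, ← map_mul, mul_div_cancel₀ _ hk]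
  have h2 : ordAt x (RatFunc.C k : RatFunc ℂ) = 0 :=
    ordAt_eq_zero_of_value_ne_zero (by simpa [value] using hk)
  rw [h1, ordAt_mul x hC (X_sub_C_ne_zero _), h2, ordAt_X_sub_C, zero_add]
  congr 1
  rw [eq_iff_iff, eq_div_iff hk, eq_comm, mul_comm]

lemma q₁_ne_zero : P.q₁ ≠ 0 := by rw [P.q₁_eq]; exact P.mon_ne_zero _ _
lemma q₂_ne_zero : P.q₂ ≠ 0 := by rw [P.q₂_eq]; exact P.mon_ne_zero _ _
lemma q₃_ne_zero : P.q₃ ≠ 0 := by rw [P.q₃_eq]; exact P.mon_ne_zero _ _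

lemma rootA_ne_zero (i : ZMod 2) (a : ℂ) (j : ZMod 2) : rootA P i a j ≠ 0 := by
  unfold rootA
  split_ifs
  · exact div_ne_zero (linear_ne_zero q₂_ne_zero) (X_sub_C_ne_zero _)
  · exact div_ne_zero (mul_ne_zero (linear_ne_zero q₁_ne_zero) (linear_ne_zero q₃_ne_zero))
      (mul_ne_zero (X_sub_C_ne_zero _) (X_sub_C_ne_zero _))

/-- The zeros and the poles of the components of an affine root are simple, and they are where
the structure function vanishes. -/
lemma ordAt_rootA (hP : P.Generic) (i j : ZMod 2) {a : ℂ} (ha : a ≠ 0) (x : ℂ) :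
    ordAt x (rootA P i a j) =
      (if gval P i j a x = 0 then 1 else 0) - (if gval P j i x a = 0 then 1 else 0) := by
  have hq : P.q₁ ≠ P.q₃ := by
    rw [P.q₁_eq, P.q₃_eq]
    intro h
    have := hP.mon_mul_eq one_ne_zero (congrArg (· * (1 : ℂ)) h)
    omega
  unfold rootA gval
  by_cases hij : i = j
  · rw [if_pos hij, if_pos hij, if_pos hij.symm, div_eq_mul_inv,
      ordAt_mul x (linear_ne_zero q₂_ne_zero) (inv_ne_zero (X_sub_C_ne_zero _)),
      ordAt_inv x (X_sub_C_ne_zero _), ordAt_linear q₂_ne_zero, ordAt_X_sub_C]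
    simp only [sub_eq_zero (a := a), sub_eq_zero (a := x)]
    rw [← sub_eq_add_neg]
  · rw [if_neg hij, if_neg hij, if_neg (Ne.symm hij), div_eq_mul_inv,
      ordAt_mul x (mul_ne_zero (linear_ne_zero q₁_ne_zero) (linear_ne_zero q₃_ne_zero))
        (inv_ne_zero (mul_ne_zero (X_sub_C_ne_zero _) (X_sub_C_ne_zero _))),
      ordAt_inv x (mul_ne_zero (X_sub_C_ne_zero _) (X_sub_C_ne_zero _)),
      ordAt_mul x (linear_ne_zero q₁_ne_zero) (linear_ne_zero q₃_ne_zero),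
      ordAt_mul x (X_sub_C_ne_zero _) (X_sub_C_ne_zero _),
      ordAt_linear q₁_ne_zero, ordAt_linear q₃_ne_zero, ordAt_X_sub_C, ordAt_X_sub_C]
    simp only [mul_eq_zero, sub_eq_zero (a := a), sub_eq_zero (a := x)]
    have h1 : ¬ (a = P.q₁ * x ∧ a = P.q₃ * x) := by
      rintro ⟨h1, h2⟩
      have hx : x ≠ 0 := by rintro rfl; exact ha (by simpa using h1)
      exact hq (mul_right_cancel₀ hx (h1.symm.trans h2))
    have h2 : ¬ (x = P.q₁ * a ∧ x = P.q₃ * a) := by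
      rintro ⟨h1, h2⟩
      exact hq (mul_right_cancel₀ ha (h1.symm.trans h2))
    split_ifs <;> first | rfl | (exfalso; tauto)

lemma value_rootA (i j : ZMod 2) {a x : ℂ} (h : gval P j i x a ≠ 0) :
    value (rootA P i a j) x = -sgn i j * gval P i j a x / gval P j i x a := by
  unfold rootA gval sgn at *
  by_cases hij : i = j
  · rw [if_pos hij.symm] at h
    rw [if_pos hij, if_pos hij, if_pos hij, if_pos hij.symm]
    have := value_div x (p := Polynomial.C P.q₂ * Polynomial.X - Polynomial.C a)
      (q := Polynomial.X - Polynomial.C (P.q₂ * a)) (by simpa using h)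
    simp only [map_sub, map_mul, RatFunc.algebraMap_C, RatFunc.algebraMap_X] at this ⊢
    rw [this]
    simp
  · rw [if_neg (Ne.symm hij)] at h
    rw [if_neg hij, if_neg hij, if_neg hij, if_neg (Ne.symm hij)]
    have := value_div x
      (p := (Polynomial.C P.q₁ * Polynomial.X - Polynomial.C a) *
        (Polynomial.C P.q₃ * Polynomial.X - Polynomial.C a))
      (q := (Polynomial.X - Polynomial.C (P.q₁ * a)) * (Polynomial.X - Polynomial.C (P.q₃ * a)))
      (by simpa using h)
    simp only [map_sub, map_mul, RatFunc.algebraMap_C, RatFunc.algebraMap_X] at this ⊢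
    rw [this]
    simp only [Polynomial.eval_mul, Polynomial.eval_sub, Polynomial.eval_C, Polynomial.eval_X]
    congr 1
    ring

end RootOrders

end Toroidal

namespace Toroidal

variable {P : Params}

/-! ### States, their weights and the orders of the weights -/

lemma Box.position_ne_zero (b : Box) : b.position P ≠ 0 := Complex.exp_ne_zero _

namespace BoxSystem

variable {B : BoxSystem P} {S : Set B.State} {Ψ : ZMod 2 → RatFunc ℂ}

/-- A box is occupied in a state `s` if it is in `s⁺`, or if it is negative and not in `s⁻`. In
these terms `add` occupies a box and `remove` frees it, whatever its sign is. -/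
def Occ (s : B.State) (b : B.boxes) : Prop := b ∈ s ↔ b ∈ B.positive

lemma occ_add (s : B.State) (b c : B.boxes) : Occ (B.add s b) c ↔ c = b ∨ Occ s c := by
  unfold Occ add
  by_cases hcb : c = b
  · subst hcb
    by_cases hb : c ∈ B.positive <;> simp [hb]
  · by_cases hb : b ∈ B.positive <;> simp [hb, hcb]

lemma occ_remove (s : B.State) (b c : B.boxes) : Occ (B.remove s b) c ↔ c ≠ b ∧ Occ s c := by
  unfold Occ remove
  by_cases hcb : c = b
  · subst hcb
    by_cases hb : c ∈ B.positive <;> simp [hb]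
  · by_cases hb : b ∈ B.positive <;> simp [hb, hcb]

lemma state_ext {s t : B.State} (h : ∀ c, Occ s c ↔ Occ t c) : s = t := by
  ext c
  have := h c
  unfold Occ at this
  tauto

lemma mem_concave {s : B.State} {b : B.boxes} :
    b ∈ B.concave S s ↔ ¬ Occ s b ∧ B.add s b ∈ S := by
  unfold concave Occ
  simp only [Set.mem_ofPred_eq]
  tauto

lemma mem_convex {s : B.State} {b : B.boxes} :
    b ∈ B.convex S s ↔ Occ s b ∧ B.remove s b ∈ S := by
  unfold convex Occ
  simp only [Set.mem_ofPred_eq]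
  tauto

lemma remove_add {s : B.State} {b : B.boxes} (h : ¬ Occ s b) : B.remove (B.add s b) b = s := by
  apply state_ext; intro c
  rw [occ_remove, occ_add]
  by_cases hc : c = b
  · subst hc; tauto
  · tauto

lemma add_remove {s : B.State} {b : B.boxes} (h : Occ s b) : B.add (B.remove s b) b = s := by
  apply state_ext; intro c
  rw [occ_add, occ_remove]
  by_cases hc : c = b
  · subst hc; tauto
  · tauto

lemma add_comm (s : B.State) (b c : B.boxes) : B.add (B.add s b) c = B.add (B.add s c) b := by
  apply state_ext; intro x
  simp only [occ_add]; tauto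

lemma remove_comm (s : B.State) (b c : B.boxes) :
    B.remove (B.remove s b) c = B.remove (B.remove s c) b := by
  apply state_ext; intro x
  simp only [occ_remove]; tauto

lemma remove_add_comm (s : B.State) {b c : B.boxes} (h : b ≠ c) :
    B.remove (B.add s b) c = B.add (B.remove s c) b := by
  apply state_ext; intro x
  simp only [occ_remove, occ_add]
  by_cases hx : x = b
  · subst hx; tauto
  · tauto

lemma mem_convex_add {s : B.State} (hs : s ∈ S) {b : B.boxes} (h : ¬ Occ s b) :
    b ∈ B.convex S (B.add s b) := by
  rw [mem_convex, occ_add, remove_add h]; exact ⟨Or.inl rfl, hs⟩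

lemma mem_concave_remove {s : B.State} (hs : s ∈ S) {b : B.boxes} (h : Occ s b) :
    b ∈ B.concave S (B.remove s b) := by
  rw [mem_concave, occ_remove, add_remove h]; exact ⟨fun h => h.1 rfl, hs⟩

/-- The component `j` of the affine root attached to a box. -/
def boxRoot (b : B.boxes) (j : ZMod 2) : RatFunc ℂ := rootA P b.1.color (b.1.position P) j

lemma boxRoot_ne_zero (b : B.boxes) (j : ZMod 2) : boxRoot b j ≠ 0 := rootA_ne_zero _ _ _

lemma factor_ne_zero (b : B.boxes) (j : ZMod 2) : B.factor b j ≠ 0 := by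
  unfold factor
  split_ifs
  · exact inv_ne_zero (rootA_ne_zero _ _ _)
  · exact rootA_ne_zero _ _ _

lemma prod_factor_remove {s : B.State} {b : B.boxes} (h : Occ s b) (p : B.boxes → Prop)
    [DecidablePred p] (j : ZMod 2) :
    ∏ c ∈ B.remove s b with p c, B.factor c j =
      (∏ c ∈ s with p c, B.factor c j) * if p b then boxRoot b j else 1 := by
  unfold Occ at h
  by_cases hb : b ∈ B.positive
  · have hbs := h.2 hb
    have e : B.remove s b = s.erase b := by ext c; simp [remove, hb]
    have hf : B.factor b j = (boxRoot b j)⁻¹ := by rw [factor, if_pos hb]; rfl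
    rw [e]
    conv_rhs => rw [← Finset.insert_erase hbs, Finset.filter_insert]
    split_ifs with hp
    · rw [Finset.prod_insert (by simp), hf, mul_right_comm, inv_mul_cancel₀ (boxRoot_ne_zero b j),
        one_mul]
    · rw [mul_one]
  · have hbs : b ∉ s := fun h' => hb (h.1 h')
    have e : B.remove s b = insert b s := by ext c; simp [remove, hb]
    have hf : B.factor b j = boxRoot b j := by rw [factor, if_neg hb]; rfl
    rw [e, Finset.filter_insert]
    split_ifs with hp
    · rw [Finset.prod_insert (by simp [hbs]), hf, mul_comm]
    · rw [mul_one]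

lemma weight_remove {s : B.State} {b : B.boxes} (h : Occ s b) (j : ZMod 2) :
    B.weight Ψ (B.remove s b) j = B.weight Ψ s j * boxRoot b j := by
  have := prod_factor_remove h (fun _ => True) j
  simp only [Finset.filter_true, if_true] at this
  rw [weight, this, weight, mul_assoc]

lemma weightLT_remove {s : B.State} {b : B.boxes} (h : Occ s b) (c : B.boxes) (j : ZMod 2) :
    B.weightLT Ψ (B.remove s b) c j =
      B.weightLT Ψ s c j * if b < c then boxRoot b j else 1 := by
  rw [weightLT, prod_factor_remove h (fun x => x < c), weightLT, mul_assoc]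

lemma weightGT_remove {s : B.State} {b : B.boxes} (h : Occ s b) (c : B.boxes) (j : ZMod 2) :
    B.weightGT Ψ (B.remove s b) c j =
      B.weightGT Ψ s c j * if c < b then boxRoot b j else 1 := by
  rw [weightGT, prod_factor_remove h (fun x => c < x), weightGT, mul_assoc]

open Classical in
lemma weight_eq_mul (s : B.State) (b : B.boxes) (j : ZMod 2) :
    B.weight Ψ s j =
      B.weightLT Ψ s b j * B.weightGT Ψ s b j * if b ∈ s then B.factor b j else 1 := by
  have h1 : ∏ c ∈ s, B.factor c j = (∏ c ∈ s with c < b, B.factor c j) *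
      ((∏ c ∈ s with b < c, B.factor c j) * if b ∈ s then B.factor b j else 1) := by
    rw [← Finset.prod_filter_mul_prod_filter_not s (fun c => c < b)]
    congr 1
    rw [← Finset.prod_filter_mul_prod_filter_not (s.filter fun c => ¬ c < b) (fun c => b < c),
      Finset.filter_filter, Finset.filter_filter]
    congr 1
    · refine Finset.prod_congr (Finset.filter_congr fun c _ => ?_) fun _ _ => rfl
      exact ⟨fun h => h.2, fun h => ⟨h.not_gt, h⟩⟩
    · have : s.filter (fun c => ¬ c < b ∧ ¬ b < c) = if b ∈ s then {b} else ∅ := by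
        ext c
        rw [Finset.mem_filter]
        have : ¬ c < b ∧ ¬ b < c ↔ c = b :=
          ⟨fun h => le_antisymm (not_lt.1 h.2) (not_lt.1 h.1), by rintro rfl; simp⟩
        rw [this]
        split_ifs with hb
        · rw [Finset.mem_singleton]; exact ⟨fun h => h.2, by rintro rfl; exact ⟨hb, rfl⟩⟩
        · simp only [Finset.notMem_empty, iff_false]; rintro ⟨h, rfl⟩; exact hb h
      rw [this]
      split_ifs <;> simp
  rw [weight, h1, weightLT, weightGT]
  split_ifs <;> ring

variable (S Ψ) in
/-- The hypotheses on the parameters, the states and the reference weight which the construction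
of the module uses. -/
structure Admissible : Prop where
  generic : P.Generic
  empty_mem : (∅ : B.State) ∈ S
  connected : B.Connected S
  simple : B.SimplePoles S Ψ
  poles : B.PolesAreBoxes S Ψ
  aligned : B.Aligned S

/-- The boxes `u` and `v` are neighbours as far as colors and positions are concerned: `v` looks
like the result of moving `u` by `1` in one of the three coordinate directions. -/
def Edge (u v : B.boxes) : Prop :=
  gval P u.1.color v.1.color (u.1.position P) (v.1.position P) = 0

/-- The order of the affine root of the box `b`. -/
def rootOrd (b : B.boxes) (i : ZMod 2) (a : ℂ) : ℤ := ordAt a (boxRoot b i)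

/-- The order of the affine root of the box `b` at the box `c`. -/
def boxOrd (b c : B.boxes) : ℤ := rootOrd b c.1.color (c.1.position P)

/-- Two boxes have the same color and the same position. -/
def Same (b c : B.boxes) : Prop := b.1.color = c.1.color ∧ b.1.position P = c.1.position P

lemma Same.symm {b c : B.boxes} (h : Same b c) : Same c b := ⟨h.1.symm, h.2.symm⟩

lemma Same.trans {b c d : B.boxes} (h : Same b c) (h' : Same c d) : Same b d :=
  ⟨h.1.trans h'.1, h.2.trans h'.2⟩

lemma Same.rootOrd_eq {b c : B.boxes} (h : Same b c) (i : ZMod 2) (a : ℂ) :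
    rootOrd b i a = rootOrd c i a := by
  rw [rootOrd, rootOrd, boxRoot, boxRoot, h.1, h.2]

lemma Same.boxOrd_eq {b b' c c' : B.boxes} (h : Same b b') (h' : Same c c') :
    boxOrd b c = boxOrd b' c' := by
  rw [boxOrd, boxOrd, h.rootOrd_eq, h'.1, h'.2]

lemma Same.edge_iff {b b' c c' : B.boxes} (h : Same b b') (h' : Same c c') :
    Edge b c ↔ Edge b' c' := by
  rw [Edge, Edge, h.1, h.2, h'.1, h'.2]

lemma Edge.exists_step {u v : B.boxes} (h : Edge u v) :
    ∃ a b, IsStep u.1.color v.1.color a b ∧ u.1.position P = P.mon a b * v.1.position P :=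
  (gval_eq_zero_iff _ _ _ _).1 h

lemma Edge.not_symm (hP : P.Generic) {u v : B.boxes} (h : Edge u v) : ¬ Edge v u :=
  gval_swap_ne_zero hP (Box.position_ne_zero _) h

open Classical in
lemma boxOrd_eq (hP : P.Generic) (b c : B.boxes) :
    boxOrd b c = (if Edge b c then 1 else 0) - (if Edge c b then 1 else 0) := by
  rw [boxOrd, rootOrd, boxRoot, ordAt_rootA hP _ _ (Box.position_ne_zero _)]
  congr

lemma boxOrd_swap (hP : P.Generic) (b c : B.boxes) : boxOrd c b = -boxOrd b c := by
  rw [boxOrd_eq hP, boxOrd_eq hP]; ring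

lemma boxOrd_of_edge (hP : P.Generic) {b c : B.boxes} (h : Edge b c) : boxOrd b c = 1 := by
  rw [boxOrd_eq hP, if_pos h, if_neg (h.not_symm hP)]; rfl

lemma boxOrd_self (hP : P.Generic) (b : B.boxes) : boxOrd b b = 0 := by
  have := boxOrd_swap hP b b
  omega

lemma not_edge_of_boxOrd_eq_zero (hP : P.Generic) {b c : B.boxes} (h : boxOrd b c = 0) :
    ¬ Edge b c ∧ ¬ Edge c b := by
  constructor <;> intro h'
  · rw [boxOrd_of_edge hP h'] at h; omega
  · rw [boxOrd_swap hP, boxOrd_of_edge hP h'] at h; omega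

variable (Ψ) in
/-- The order of the weight of a state. -/
def wOrd (s : B.State) (i : ZMod 2) (a : ℂ) : ℤ := ordAt a (B.weight Ψ s i)

/-! Neighbouring boxes in the sense of coordinates. -/

lemma eq_of_coord_eq {b c : B.boxes} (h : c.1.coord = b.1.coord) : c = b := by
  simp only [Box.coord, Prod.mk.injEq] at h
  have h1 := B.lex b c 0 0 0 (by simp [h]) (by simp [h]) (by simp [h])
  have h2 := B.lex c b 0 0 0 (by simp [h]) (by simp [h]) (by simp [h])
  simp only [lt_self_iff_false, and_false, or_self, iff_false] at h1 h2
  exact le_antisymm (not_lt.1 h2) (not_lt.1 h1)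

/-- Boxes whose coordinates differ by a unit vector are neighbours, and they are ordered
accordingly. -/
lemma edge_and_lt_of_coord {b c : B.boxes}
    (h : c.1.coord ∈ ({(b.1.x, b.1.y, b.1.z + 1), (b.1.x, b.1.y + 1, b.1.z),
        (b.1.x + 1, b.1.y, b.1.z)} : Set (ℂ × ℂ × ℂ))) : Edge b c ∧ b < c := by
  have hcol : ∀ i j : ZMod 2, i - j = 1 → j ≠ i := by decide
  simp only [Box.coord, Set.mem_insert_iff, Set.mem_singleton_iff, Prod.mk.injEq] at h
  rw [Edge, gval_eq_zero_iff]
  rcases h with ⟨hx, hy, hz⟩ | ⟨hx, hy, hz⟩ | ⟨hx, hy, hz⟩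
  · refine ⟨⟨-1, -1, Or.inr ⟨?_, rfl, Or.inr rfl⟩, ?_⟩, ?_⟩
    · have := B.color_alt c b 0 1 (by simp [hx]) (by simp [hz])
      exact hcol _ _ (by simpa using this)
    · rw [Box.position, Box.position, Params.mon, ← Complex.exp_add, hx, hy, hz]
      congr 1; push_cast; ring
    · exact (B.lex c b 0 0 1 (by simp [hx]) (by simp [hy]) (by simp [hz])).2 (by simp)
  · refine ⟨⟨2, 0, Or.inl ⟨?_, rfl, rfl⟩, ?_⟩, ?_⟩
    · have := B.color_alt c b 0 0 (by simp [hx]) (by simp [hz])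
      exact (sub_eq_zero.1 (by simpa using this)).symm
    · rw [Box.position, Box.position, Params.mon, ← Complex.exp_add, hx, hy, hz]
      congr 1; push_cast; ring
    · exact (B.lex c b 0 1 0 (by simp [hx]) (by simp [hy]) (by simp [hz])).2 (by simp)
  · refine ⟨⟨-1, 1, Or.inr ⟨?_, rfl, Or.inl rfl⟩, ?_⟩, ?_⟩
    · have := B.color_alt c b 1 0 (by simp [hx]) (by simp [hz])
      exact hcol _ _ (by simpa using this)
    · rw [Box.position, Box.position, Params.mon, ← Complex.exp_add, hx, hy, hz]
      congr 1; push_cast; ring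
    · exact (B.lex c b 1 0 0 (by simp [hx]) (by simp [hy]) (by simp [hz])).2 (by simp)

namespace Admissible

variable (h : Admissible S Ψ)
include h

lemma edge_of_new_concave {s : B.State} (hs : s ∈ S) {b c : B.boxes} (hb : b ∈ B.concave S s)
    (hc : c ∈ B.concave S (B.add s b)) (hc' : c ∉ B.concave S s) : Edge b c ∧ b < c :=
  edge_and_lt_of_coord ((h.aligned s hs b hb).1 c hc hc')

lemma edge_of_lost_convex {s : B.State} (hs : s ∈ S) {b c : B.boxes} (hb : b ∈ B.concave S s)
    (hc : c ∈ B.convex S s) (hc' : c ∉ B.convex S (B.add s b)) : Edge c b ∧ c < b := by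
  have h1 := (h.aligned s hs b hb).2 c hc hc'
  have hne : c ≠ b := by
    rintro rfl
    exact (mem_concave.1 hb).1 (mem_convex.1 hc).1
  apply edge_and_lt_of_coord
  simp only [Box.coord, Set.mem_insert_iff, Set.mem_singleton_iff, Prod.mk.injEq] at h1 ⊢
  rcases h1 with h1 | h1 | h1 | h1
  · exact absurd (eq_of_coord_eq (by simp [Box.coord, h1])) hne
  · simp [h1]
  · simp [h1]
  · simp [h1]

lemma weight_ne_zero {s : B.State} (hs : s ∈ S) (i : ZMod 2) : B.weight Ψ s i ≠ 0 :=
  ne_zero_of_isBalanced (h.simple s hs i).1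

lemma neg_one_le_wOrd {s : B.State} (hs : s ∈ S) (i : ZMod 2) (a : ℂ) : -1 ≤ wOrd Ψ s i a :=
  neg_one_le_ordAt (h.simple s hs i).2 a

lemma wOrd_eq_neg_one {s : B.State} (hs : s ∈ S) {b : B.boxes}
    (hb : b ∈ B.concave S s ∨ b ∈ B.convex S s) :
    wOrd Ψ s b.1.color (b.1.position P) = -1 := by
  have h1 := (h.poles s hs b.1.color).mapsTo (x := b) (by
    rcases hb with hb | hb
    · exact Or.inl ⟨hb, rfl⟩
    · exact Or.inr ⟨hb, rfl⟩)
  have h2 := (isPole_iff_ordAt_neg _ _).1 h1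
  have h3 := h.neg_one_le_wOrd hs b.1.color (b.1.position P)
  unfold wOrd at *
  omega

lemma exists_box {s : B.State} (hs : s ∈ S) {c : B.boxes}
    (hw : wOrd Ψ s c.1.color (c.1.position P) = -1) :
    ∃ b, Same b c ∧ (b ∈ B.concave S s ∨ b ∈ B.convex S s) := by
  have h1 : IsPole (B.weight Ψ s c.1.color) (c.1.position P) := by
    rw [isPole_iff_ordAt_neg]; unfold wOrd at hw; omega
  obtain ⟨b, hb, hbp⟩ := (h.poles s hs c.1.color).surjOn h1
  rcases hb with hb | hb
  · exact ⟨b, ⟨hb.2, hbp⟩, Or.inl hb.1⟩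
  · exact ⟨b, ⟨hb.2, hbp⟩, Or.inr hb.1⟩

lemma eq_of_same {s : B.State} (hs : s ∈ S) {b c : B.boxes}
    (hb : b ∈ B.concave S s ∨ b ∈ B.convex S s) (hc : c ∈ B.concave S s ∨ c ∈ B.convex S s)
    (hbc : Same b c) : b = c := by
  refine (h.poles s hs b.1.color).injOn ?_ ?_ hbc.2
  · rcases hb with hb | hb
    · exact Or.inl ⟨hb, rfl⟩
    · exact Or.inr ⟨hb, rfl⟩
  · rcases hc with hb | hb
    · exact Or.inl ⟨hb, hbc.1.symm⟩
    · exact Or.inr ⟨hb, hbc.1.symm⟩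

lemma wOrd_remove {s : B.State} (hs : s ∈ S) {b : B.boxes} (hb : Occ s b) (i : ZMod 2) (a : ℂ) :
    wOrd Ψ (B.remove s b) i a = wOrd Ψ s i a + rootOrd b i a := by
  rw [wOrd, weight_remove hb, ordAt_mul a (h.weight_ne_zero hs i) (boxRoot_ne_zero b i)]; rfl

lemma wOrd_add {s : B.State} (hs : s ∈ S) {b : B.boxes} (hb : ¬ Occ s b) (i : ZMod 2) (a : ℂ) :
    wOrd Ψ (B.add s b) i a = wOrd Ψ s i a - rootOrd b i a := by
  have h1 : Occ (B.add s b) b := (occ_add s b b).2 (Or.inl rfl)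
  have h2 := weight_remove (Ψ := Ψ) h1 i
  rw [remove_add hb] at h2
  have h3 : B.weight Ψ (B.add s b) i ≠ 0 := fun h0 => by
    rw [h0, zero_mul] at h2; exact h.weight_ne_zero hs i h2
  have h4 := ordAt_mul a h3 (boxRoot_ne_zero b i)
  rw [← h2] at h4
  unfold wOrd rootOrd
  omega

/-! ### Commuting moves -/

/-- If along states of `S` the orders of the weights move away from those of a fixed state in
multiples of `ρ`, then `ρ` is nonnegative, because the poles of all weights are simple. -/
lemma nonneg_of_unbounded (ρ : ZMod 2 → ℂ → ℤ) (s : B.State)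
    (hρ : ∀ n : ℕ, ∃ t ∈ S, ∀ i a, wOrd Ψ t i a = wOrd Ψ s i a + n * ρ i a) (i : ZMod 2) (a : ℂ) :
    0 ≤ ρ i a := by
  by_contra! hneg
  obtain ⟨t, ht, htw⟩ := hρ (wOrd Ψ s i a + 2).toNat
  have h1 := h.neg_one_le_wOrd ht i a
  rw [htw] at h1
  have h2 := Int.self_le_toNat (wOrd Ψ s i a + 2)
  have h3 : (0 : ℤ) ≤ ((wOrd Ψ s i a + 2).toNat : ℤ) := Int.natCast_nonneg _
  nlinarith

/-- The affine roots of two convex boxes are regular and nonzero at each other's positions: the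
two poles stay simple when one of the boxes is removed. -/
lemma boxOrd_eq_zero_of_convex {v : B.State} (hv : v ∈ S) {b c : B.boxes} (hb : b ∈ B.convex S v)
    (hc : c ∈ B.convex S v) : boxOrd c b = 0 := by
  have h1 := h.neg_one_le_wOrd (mem_convex.1 hc).2 b.1.color (b.1.position P)
  have h2 := h.neg_one_le_wOrd (mem_convex.1 hb).2 c.1.color (c.1.position P)
  rw [h.wOrd_remove hv (mem_convex.1 hc).1, h.wOrd_eq_neg_one hv (Or.inr hb)] at h1
  rw [h.wOrd_remove hv (mem_convex.1 hb).1, h.wOrd_eq_neg_one hv (Or.inr hc)] at h2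
  have h3 := boxOrd_swap h.generic b c
  unfold boxOrd at *
  omega

lemma boxOrd_eq_zero_of_concave {w : B.State} (hw : w ∈ S) {b c : B.boxes}
    (hb : b ∈ B.concave S w) (hc : c ∈ B.concave S w) : boxOrd c b = 0 := by
  have h1 := h.neg_one_le_wOrd (mem_concave.1 hc).2 b.1.color (b.1.position P)
  have h2 := h.neg_one_le_wOrd (mem_concave.1 hb).2 c.1.color (c.1.position P)
  rw [h.wOrd_add hw (mem_concave.1 hc).1, h.wOrd_eq_neg_one hw (Or.inl hb)] at h1
  rw [h.wOrd_add hw (mem_concave.1 hb).1, h.wOrd_eq_neg_one hw (Or.inl hc)] at h2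
  have h3 := boxOrd_swap h.generic b c
  unfold boxOrd at *
  omega

/-- Two boxes that can be removed separately but not together. -/
def Blocked (S : Set B.State) (v : B.State) (b c : B.boxes) : Prop :=
  v ∈ S ∧ b ∈ B.convex S v ∧ c ∈ B.convex S v ∧ b ≠ c ∧ b ∉ B.convex S (B.remove v c)

/-- A blocked pair produces another blocked pair in a state that differs by freeing a box like `c`
and occupying a box like `b`. -/
lemma exists_blocked {v : B.State} {b c : B.boxes} (hbl : Blocked S v b c) :
    ∃ v' b' c', Blocked S v' b' c' ∧ Same b' b ∧ Same c' c ∧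
      ∀ i a, wOrd Ψ v' i a = wOrd Ψ v i a + (rootOrd c i a - rootOrd b i a) := by
  have hP := h.generic
  obtain ⟨hv, hb, hc, hne, hbad⟩ := hbl
  have hnS : ¬ Same b c := fun hs => hne (h.eq_of_same hv (Or.inr hb) (Or.inr hc) hs)
  obtain ⟨hbo, hbS⟩ := mem_convex.1 hb
  obtain ⟨hco, hcS⟩ := mem_convex.1 hc
  have hvb := h.wOrd_eq_neg_one hv (Or.inr hb)
  have hzero : boxOrd c b = 0 := h.boxOrd_eq_zero_of_convex hv hb hc
  set u := B.remove v c with hu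
  have hcu : c ∈ B.concave S u := mem_concave_remove hv hco
  have huv : B.add u c = v := add_remove hco
  have hub : wOrd Ψ u b.1.color (b.1.position P) = -1 := by
    rw [hu, h.wOrd_remove hv hco, hvb]; unfold boxOrd at hzero; omega
  obtain ⟨b', hb'b, hb'⟩ := h.exists_box hcS hub
  have hb'c : boxOrd b' c = 0 := by
    rw [hb'b.boxOrd_eq ⟨rfl, rfl⟩, boxOrd_swap hP, hzero, neg_zero]
  have hb'ne : b' ≠ c := by rintro rfl; exact hnS hb'b.symm
  have hb'cc : b' ∈ B.concave S u := by
    refine hb'.resolve_right fun hcv => ?_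
    by_cases hcv' : b' ∈ B.convex S v
    · have := h.eq_of_same hv (Or.inr hcv') (Or.inr hb) hb'b
      subst this
      exact hbad hcv
    · rw [← huv] at hcv'
      exact (not_edge_of_boxOrd_eq_zero hP hb'c).1 (h.edge_of_lost_convex hcS hcu hcv hcv').1
  obtain ⟨hb'o, hb'S⟩ := mem_concave.1 hb'cc
  set v' := B.add u b' with hv'
  have hv'c : wOrd Ψ v' c.1.color (c.1.position P) = -1 := by
    rw [hv', h.wOrd_add hcS hb'o, h.wOrd_eq_neg_one hcS (Or.inl hcu)]
    unfold boxOrd at hb'c; omega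
  obtain ⟨c', hc'c, hc'⟩ := h.exists_box hb'S hv'c
  have hc'ne : b' ≠ c' := by
    rintro rfl; exact hnS (hb'b.symm.trans hc'c)
  have hc'cv : c' ∈ B.convex S v' := by
    refine hc'.resolve_left fun hcc => ?_
    by_cases hcc' : c' ∈ B.concave S u
    · have := h.eq_of_same hcS (Or.inl hcc') (Or.inl hcu) hc'c
      subst this
      have hb'v : b' ∈ B.concave S v := by
        rw [mem_concave, ← huv, occ_add, add_comm]
        exact ⟨by tauto, (mem_concave.1 hcc).2⟩
      have := h.eq_of_same hv (Or.inl hb'v) (Or.inr hb) hb'b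
      subst this
      exact (mem_concave.1 hb'v).1 hbo
    · have h1 := (h.edge_of_new_concave hcS hb'cc hcc hcc').1
      refine (not_edge_of_boxOrd_eq_zero hP hb'c).1 ?_
      rwa [← Same.edge_iff ⟨rfl, rfl⟩ hc'c]
  refine ⟨v', b', c', ⟨hb'S, mem_convex_add hcS hb'o, hc'cv, hc'ne, fun hbad' => ?_⟩, hb'b, hc'c,
    fun i a => ?_⟩
  · have h1 := (mem_convex.1 hbad').2
    rw [remove_comm, hv', remove_add hb'o] at h1
    have h2 : Occ u c' := by
      have := (mem_convex.1 hc'cv).1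
      rw [hv', occ_add] at this
      exact this.resolve_left hc'ne.symm
    have := h.eq_of_same hcS (Or.inr (mem_convex.2 ⟨h2, h1⟩)) (Or.inl hcu) hc'c
    subst this
    exact (mem_concave.1 hcu).1 h2
  · rw [hv', h.wOrd_add hcS hb'o, hu, h.wOrd_remove hv hco, hb'b.rootOrd_eq]; ring

/-- Two convex boxes can be removed one after the other: otherwise blocked pairs could be moved
indefinitely, and the weights would acquire poles of arbitrarily high order. -/
theorem convex_remove {v : B.State} (hv : v ∈ S) {b c : B.boxes} (hb : b ∈ B.convex S v)
    (hc : c ∈ B.convex S v) (hne : b ≠ c) : b ∈ B.convex S (B.remove v c) := by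
  have hP := h.generic
  by_contra hbad
  have hnS : ¬ Same b c := fun hs => hne (h.eq_of_same hv (Or.inr hb) (Or.inr hc) hs)
  have key : ∀ n : ℕ, ∃ t b' c', Blocked S t b' c' ∧ Same b' b ∧ Same c' c ∧
      ∀ i a, wOrd Ψ t i a = wOrd Ψ v i a + n * (rootOrd c i a - rootOrd b i a) := by
    intro n
    induction n with
    | zero => exact ⟨v, b, c, ⟨hv, hb, hc, hne, hbad⟩, ⟨rfl, rfl⟩, ⟨rfl, rfl⟩, by simp⟩
    | succ n ih =>
      obtain ⟨t, b', c', hbl, hb', hc', hw⟩ := ih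
      obtain ⟨t', b'', c'', hbl', hb'', hc'', hw'⟩ := h.exists_blocked hbl
      refine ⟨t', b'', c'', hbl', hb''.trans hb', hc''.trans hc', fun i a => ?_⟩
      rw [hw', hw, hb'.rootOrd_eq, hc'.rootOrd_eq]; push_cast; ring
  have hnn := h.nonneg_of_unbounded (fun i a => rootOrd c i a - rootOrd b i a) v fun n => by
    obtain ⟨t, b', c', hbl, -, -, hw⟩ := key n
    exact ⟨t, hbl.1, hw⟩
  have contra : ∀ i a, a ≠ 0 → gval P b.1.color i (b.1.position P) a = 0 →
      gval P c.1.color i (c.1.position P) a = 0 := by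
    intro i a ha hz
    by_contra hz'
    have h1 := hnn i a
    simp only [rootOrd, boxRoot] at h1
    rw [ordAt_rootA hP _ _ (Box.position_ne_zero _), ordAt_rootA hP _ _ (Box.position_ne_zero _),
      if_pos hz, if_neg hz', if_neg (gval_swap_ne_zero hP ha hz)] at h1
    split_ifs at h1 <;> omega
  have hbp : b.1.position P ≠ 0 := Box.position_ne_zero _
  have hmon : ∀ x y : ℤ, P.mon x y * b.1.position P ≠ 0 := fun x y =>
    mul_ne_zero (P.mon_ne_zero x y) hbp
  by_cases hcol : b.1.color = c.1.color
  · have h1 := contra b.1.color _ (hmon (-2) 0) ((gval_eq_zero_iff _ _ _ _).2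
      ⟨2, 0, Or.inl ⟨rfl, rfl, rfl⟩, by rw [P.mon_mul_mon_mul]; simp [Params.mon_zero]⟩)
    obtain ⟨x, y, hst, e⟩ := (gval_eq_zero_iff _ _ _ _).1 h1
    rw [P.mon_mul_mon_mul] at e
    unfold IsStep at hst
    obtain ⟨rfl, rfl⟩ : x = 2 ∧ y = 0 := by
      rcases hst with hst | hst
      · exact hst.2
      · exact absurd hcol.symm hst.1
    exact hnS ⟨hcol, by simpa [Params.mon_zero] using e.symm⟩
  · have hstep : ∀ y : ℤ, y = 1 ∨ y = -1 →
        c.1.position P = P.mon 3 (-y) * b.1.position P := by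
      intro y hy
      have h1 := contra c.1.color _ (hmon 1 (-y)) ((gval_eq_zero_iff _ _ _ _).2
        ⟨-1, y, Or.inr ⟨hcol, rfl, hy⟩, by rw [P.mon_mul_mon_mul]; simp [Params.mon_zero]⟩)
      obtain ⟨x, y', hst, e⟩ := (gval_eq_zero_iff _ _ _ _).1 h1
      rw [P.mon_mul_mon_mul] at e
      unfold IsStep at hst
      obtain ⟨rfl, rfl⟩ : x = 2 ∧ y' = 0 := by
        rcases hst with hst | hst
        · exact hst.2
        · exact absurd rfl hst.1
      rw [e]; norm_num
    have h1 := hP.mon_mul_eq hbp ((hstep 1 (Or.inl rfl)).symm.trans (hstep (-1) (Or.inr rfl)))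
    omega

/-- Two concave boxes `b` and `c` can be added one after the other: if `b` did not stay concave
after adding `c`, a box like `b` would be convex there, hence already before by `convex_remove`. -/
theorem concave_add {w : B.State} (hw : w ∈ S) {b c : B.boxes} (hb : b ∈ B.concave S w)
    (hc : c ∈ B.concave S w) (hne : b ≠ c) : b ∈ B.concave S (B.add w c) := by
  have hP := h.generic
  have hnS : ¬ Same b c := fun hs => hne (h.eq_of_same hw (Or.inl hb) (Or.inl hc) hs)
  obtain ⟨hbo, hbS⟩ := mem_concave.1 hb
  obtain ⟨hco, hcS⟩ := mem_concave.1 hc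
  have hwb := h.wOrd_eq_neg_one hw (Or.inl hb)
  have hzero : boxOrd c b = 0 := h.boxOrd_eq_zero_of_concave hw hb hc
  have hvb : wOrd Ψ (B.add w c) b.1.color (b.1.position P) = -1 := by
    rw [h.wOrd_add hw hco, hwb]; unfold boxOrd at hzero; omega
  obtain ⟨b', hb'b, hb'⟩ := h.exists_box hcS hvb
  rcases hb' with hb' | hb'
  · by_cases hb'w : b' ∈ B.concave S w
    · have := h.eq_of_same hw (Or.inl hb'w) (Or.inl hb) hb'b
      exact this ▸ hb'
    · have h1 := (h.edge_of_new_concave hw hc hb' hb'w).1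
      rw [Same.edge_iff ⟨rfl, rfl⟩ hb'b] at h1
      exact absurd h1 (not_edge_of_boxOrd_eq_zero hP hzero).1
  · have hb'ne : b' ≠ c := by rintro rfl; exact hnS hb'b.symm
    have h1 := h.convex_remove hcS hb' (mem_convex_add hw hco) hb'ne
    rw [remove_add hco] at h1
    have := h.eq_of_same hw (Or.inr h1) (Or.inl hb) hb'b
    subst this
    exact absurd (mem_convex.1 h1).1 hbo

end Admissible

end BoxSystem

end Toroidal

namespace Toroidal

variable {P : Params}

namespace BoxSystem

variable {B : BoxSystem P} {S : Set B.State} {Ψ : ZMod 2 → RatFunc ℂ}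

/-! ### Extremal boxes of a state -/

lemma remove_eq_erase {s : B.State} {b : B.boxes} (hb : b ∈ B.positive) :
    B.remove s b = s.erase b := by
  ext c; simp [remove, hb]

lemma add_eq_erase {s : B.State} {b : B.boxes} (hb : b ∉ B.positive) :
    B.add s b = s.erase b := by
  ext c; simp [add, hb]

lemma Connected.exists_erase (hc : B.Connected S) {s : B.State} (hs : s ∈ S) (hne : s.Nonempty) :
    ∃ b ∈ s, s.erase b ∈ S := by
  rcases Relation.ReflTransGen.cases_head (hc s hs) with h | ⟨s', ⟨hs', b, hb, rfl⟩, -⟩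
  · exact absurd h hne.ne_empty
  · exact ⟨b, hb, hs'⟩

namespace Admissible

variable (h : Admissible S Ψ)
include h

/-- The largest positive box of a state is convex. -/
lemma convex_of_max {s : B.State} (hs : s ∈ S) {m : B.boxes} (hm : m ∈ s) (hmp : m ∈ B.positive)
    (hmax : ∀ c ∈ s, c ∈ B.positive → c ≤ m) : m ∈ B.convex S s := by
  induction s using Finset.strongInduction with
  | H s ih =>
    obtain ⟨b, hbs, hbS⟩ := h.connected.exists_erase hs ⟨m, hm⟩
    by_cases hbm : b = m
    · subst hbm
      rw [mem_convex, remove_eq_erase hmp]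
      exact ⟨⟨fun _ => hmp, fun _ => hm⟩, hbS⟩
    have hm' := ih _ (Finset.erase_ssubset hbs) hbS (Finset.mem_erase.2 ⟨Ne.symm hbm, hm⟩)
      fun c hc => hmax c (Finset.mem_of_mem_erase hc)
    by_cases hbp : b ∈ B.positive
    · have hbo : Occ s b := ⟨fun _ => hbp, fun _ => hbs⟩
      rw [← remove_eq_erase hbp] at hm' hbS
      by_contra hms
      rw [← add_remove hbo] at hms
      have := (h.edge_of_lost_convex hbS (mem_concave_remove hs hbo) hm' hms).2
      exact absurd (hmax b hbs hbp) (not_le.2 this)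
    · have hbo : ¬ Occ s b := fun ho => hbp (ho.1 hbs)
      rw [← add_eq_erase hbp] at hm' hbS
      have := h.convex_remove hbS hm' (mem_convex_add hs hbo) (Ne.symm hbm)
      rwa [remove_add hbo] at this

/-- The smallest negative box of a state is concave. -/
lemma concave_of_min {s : B.State} (hs : s ∈ S) {m : B.boxes} (hm : m ∈ s) (hmp : m ∉ B.positive)
    (hmin : ∀ c ∈ s, c ∉ B.positive → m ≤ c) : m ∈ B.concave S s := by
  induction s using Finset.strongInduction with
  | H s ih =>
    obtain ⟨b, hbs, hbS⟩ := h.connected.exists_erase hs ⟨m, hm⟩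
    by_cases hbm : b = m
    · subst hbm
      rw [mem_concave, add_eq_erase hmp]
      exact ⟨fun ho => hmp (ho.1 hm), hbS⟩
    have hm' := ih _ (Finset.erase_ssubset hbs) hbS (Finset.mem_erase.2 ⟨Ne.symm hbm, hm⟩)
      fun c hc => hmin c (Finset.mem_of_mem_erase hc)
    by_cases hbp : b ∈ B.positive
    · have hbo : Occ s b := ⟨fun _ => hbp, fun _ => hbs⟩
      rw [← remove_eq_erase hbp] at hm' hbS
      have := h.concave_add hbS hm' (mem_concave_remove hs hbo) (Ne.symm hbm)
      rwa [add_remove hbo] at this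
    · have hbo : ¬ Occ s b := fun ho => hbp (ho.1 hbs)
      rw [← add_eq_erase hbp] at hm' hbS
      by_contra hms
      have := (h.edge_of_new_concave hs (mem_concave.2 ⟨hbo, hbS⟩) hm' hms).2
      exact absurd (hmin b hbs hbp) (not_le.2 this)

open Classical in
lemma exists_max {s : B.State} (hs : s ∈ S) {c : B.boxes} (hc : c ∈ s) (hcp : c ∈ B.positive) :
    ∃ m ∈ s, m ∈ B.positive ∧ c ≤ m ∧ m ∈ B.convex S s := by
  have hne : (s.filter (· ∈ B.positive)).Nonempty := ⟨c, Finset.mem_filter.2 ⟨hc, hcp⟩⟩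
  have hmem := Finset.mem_filter.1 (Finset.max'_mem _ hne)
  have hle : ∀ x ∈ s, x ∈ B.positive → x ≤ (s.filter (· ∈ B.positive)).max' hne :=
    fun x hx hxp => Finset.le_max' _ _ (Finset.mem_filter.2 ⟨hx, hxp⟩)
  exact ⟨_, hmem.1, hmem.2, hle c hc hcp, h.convex_of_max hs hmem.1 hmem.2 hle⟩

open Classical in
lemma exists_min {s : B.State} (hs : s ∈ S) {c : B.boxes} (hc : c ∈ s) (hcp : c ∉ B.positive) :
    ∃ m ∈ s, m ∉ B.positive ∧ m ≤ c ∧ m ∈ B.concave S s := by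
  have hne : (s.filter (· ∉ B.positive)).Nonempty := ⟨c, Finset.mem_filter.2 ⟨hc, hcp⟩⟩
  have hmem := Finset.mem_filter.1 (Finset.min'_mem _ hne)
  have hle : ∀ x ∈ s, x ∉ B.positive → (s.filter (· ∉ B.positive)).min' hne ≤ x :=
    fun x hx hxp => Finset.min'_le _ _ (Finset.mem_filter.2 ⟨hx, hxp⟩)
  exact ⟨_, hmem.1, hmem.2, hle c hc hcp, h.concave_of_min hs hmem.1 hmem.2 hle⟩

/-! ### Orders of the partial weights -/

lemma reference_ne_zero (i : ZMod 2) : Ψ i ≠ 0 := by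
  have := h.weight_ne_zero h.empty_mem i
  simpa [weight] using this

lemma weightLT_ne_zero (s : B.State) (b : B.boxes) (j : ZMod 2) : B.weightLT Ψ s b j ≠ 0 := by
  unfold weightLT
  refine mul_ne_zero ?_ (Finset.prod_ne_zero_iff.2 fun c _ => factor_ne_zero c j)
  split_ifs
  · exact h.reference_ne_zero j
  · exact one_ne_zero

lemma weightGT_ne_zero (s : B.State) (b : B.boxes) (j : ZMod 2) : B.weightGT Ψ s b j ≠ 0 := by
  unfold weightGT
  refine mul_ne_zero ?_ (Finset.prod_ne_zero_iff.2 fun c _ => factor_ne_zero c j)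
  split_ifs
  · exact one_ne_zero
  · exact h.reference_ne_zero j

lemma ordAt_weightGT_remove {s : B.State} {m b : B.boxes} (hm : Occ s m) (hmb : boxOrd m b = 0) :
    ordAt (b.1.position P) (B.weightGT Ψ (B.remove s m) b b.1.color) =
      ordAt (b.1.position P) (B.weightGT Ψ s b b.1.color) := by
  rw [weightGT_remove hm]
  split_ifs
  · rw [ordAt_mul _ (h.weightGT_ne_zero s b _) (boxRoot_ne_zero m _)]
    unfold boxOrd rootOrd at hmb
    omega
  · rw [mul_one]

lemma ordAt_weightLT_remove {s : B.State} {m b : B.boxes} (hm : Occ s m) (hmb : boxOrd m b = 0) :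
    ordAt (b.1.position P) (B.weightLT Ψ (B.remove s m) b b.1.color) =
      ordAt (b.1.position P) (B.weightLT Ψ s b b.1.color) := by
  rw [weightLT_remove hm]
  split_ifs
  · rw [ordAt_mul _ (h.weightLT_ne_zero s b _) (boxRoot_ne_zero m _)]
    unfold boxOrd rootOrd at hmb
    omega
  · rw [mul_one]

/-- At a concave positive box the partial weight `φ_{s, > b}` neither vanishes nor has a pole.
The box stays concave while the largest positive boxes and then all negative boxes are stripped
off, which leaves no boxes above it. -/
lemma ordAt_weightGT_of_concave {s : B.State} (hs : s ∈ S) {b : B.boxes} (hbp : b ∈ B.positive)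
    (hb : b ∈ B.concave S s) : ordAt (b.1.position P) (B.weightGT Ψ s b b.1.color) = 0 := by
  induction s using Finset.strongInduction with
  | H s ih =>
    by_cases hA : ∃ c ∈ s, c ∈ B.positive ∧ b < c
    · obtain ⟨c, hcs, hcp, hbc⟩ := hA
      obtain ⟨m, hms, hmp, hcm, hm⟩ := h.exists_max hs hcs hcp
      obtain ⟨hmo, hmS⟩ := mem_convex.1 hm
      have hb' : b ∈ B.concave S (B.remove s m) := by
        by_contra hb'
        have hbs : b ∈ B.concave S (B.add (B.remove s m) m) := by rwa [add_remove hmo]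
        have := (h.edge_of_new_concave hmS (mem_concave_remove hs hmo) hbs hb').2
        exact lt_asymm this (hbc.trans_le hcm)
      have hmb : boxOrd m b = 0 := by
        have h1 := h.wOrd_remove hs hmo b.1.color (b.1.position P)
        rw [h.wOrd_eq_neg_one hs (Or.inl hb), h.wOrd_eq_neg_one hmS (Or.inl hb')] at h1
        unfold boxOrd; omega
      rw [← h.ordAt_weightGT_remove hmo hmb]
      refine ih _ ?_ hmS hb'
      rw [remove_eq_erase hmp]
      exact Finset.erase_ssubset hms
    by_cases hN : ∃ c ∈ s, c ∉ B.positive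
    · obtain ⟨c, hcs, hcp⟩ := hN
      obtain ⟨m, hms, hmp, -, hm⟩ := h.exists_min hs hcs hcp
      obtain ⟨hmo, hmS⟩ := mem_concave.1 hm
      have hne : b ≠ m := by rintro rfl; exact hmp hbp
      have hb' := h.concave_add hs hb hm hne
      have hmb := h.boxOrd_eq_zero_of_concave hs hb hm
      have h1 := h.ordAt_weightGT_remove (s := B.add s m) ((occ_add s m m).2 (Or.inl rfl)) hmb
      rw [remove_add hmo] at h1
      rw [h1]
      refine ih _ ?_ hmS hb'
      rw [add_eq_erase hmp]
      exact Finset.erase_ssubset hms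
    · push Not at hA hN
      have : B.weightGT Ψ s b b.1.color = 1 := by
        rw [weightGT, if_pos hbp, one_mul]
        refine Finset.prod_eq_one fun c hc => ?_
        rw [Finset.mem_filter] at hc
        exact absurd hc.2 (not_lt.2 (hA c hc.1 (hN c hc.1)))
      rw [this, ordAt_one]

/-- At a convex negative box the partial weight `φ_{s, < b}` neither vanishes nor has a pole, by
the argument of `ordAt_weightGT_of_concave` with the two signs interchanged. -/
lemma ordAt_weightLT_of_convex {s : B.State} (hs : s ∈ S) {b : B.boxes} (hbp : b ∉ B.positive)
    (hb : b ∈ B.convex S s) : ordAt (b.1.position P) (B.weightLT Ψ s b b.1.color) = 0 := by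
  induction s using Finset.strongInduction with
  | H s ih =>
    by_cases hA : ∃ c ∈ s, c ∉ B.positive ∧ c < b
    · obtain ⟨c, hcs, hcp, hbc⟩ := hA
      obtain ⟨m, hms, hmp, hcm, hm⟩ := h.exists_min hs hcs hcp
      obtain ⟨hmo, hmS⟩ := mem_concave.1 hm
      have hb' : b ∈ B.convex S (B.add s m) := by
        by_contra hb'
        have := (h.edge_of_lost_convex hs hm hb hb').2
        exact lt_asymm this (hcm.trans_lt hbc)
      have hmb : boxOrd m b = 0 := by
        have h1 := h.wOrd_add hs hmo b.1.color (b.1.position P)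
        rw [h.wOrd_eq_neg_one hs (Or.inr hb), h.wOrd_eq_neg_one hmS (Or.inr hb')] at h1
        unfold boxOrd; omega
      have h1 := h.ordAt_weightLT_remove (s := B.add s m) ((occ_add s m m).2 (Or.inl rfl)) hmb
      rw [remove_add hmo] at h1
      rw [h1]
      refine ih _ ?_ hmS hb'
      rw [add_eq_erase hmp]
      exact Finset.erase_ssubset hms
    by_cases hN : ∃ c ∈ s, c ∈ B.positive
    · obtain ⟨c, hcs, hcp⟩ := hN
      obtain ⟨m, hms, hmp, -, hm⟩ := h.exists_max hs hcs hcp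
      obtain ⟨hmo, hmS⟩ := mem_convex.1 hm
      have hne : b ≠ m := by rintro rfl; exact hbp hmp
      have hb' := h.convex_remove hs hb hm hne
      rw [← h.ordAt_weightLT_remove hmo (h.boxOrd_eq_zero_of_convex hs hb hm)]
      refine ih _ ?_ hmS hb'
      rw [remove_eq_erase hmp]
      exact Finset.erase_ssubset hms
    · push Not at hA hN
      have : B.weightLT Ψ s b b.1.color = 1 := by
        rw [weightLT, if_neg hbp, one_mul]
        refine Finset.prod_eq_one fun c hc => ?_
        rw [Finset.mem_filter] at hc
        exact absurd hc.2 (not_lt.2 (hA c hc.1 (hN c hc.1)))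
      rw [this, ordAt_one]

lemma ordAt_weightLT_add_weightGT {s : B.State} (hs : s ∈ S) {b : B.boxes}
    (hb : b ∈ B.concave S s ∨ b ∈ B.convex S s) :
    ordAt (b.1.position P) (B.weightLT Ψ s b b.1.color) +
      ordAt (b.1.position P) (B.weightGT Ψ s b b.1.color) = -1 := by
  have h1 := h.wOrd_eq_neg_one hs hb
  have h2 : ordAt (b.1.position P) (boxRoot b b.1.color) = 0 := boxOrd_self h.generic b
  have hL := h.weightLT_ne_zero s b b.1.color
  have hG := h.weightGT_ne_zero s b b.1.color
  rw [wOrd, weight_eq_mul s b] at h1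
  split_ifs at h1
  · rw [ordAt_mul _ (mul_ne_zero hL hG) (factor_ne_zero _ _), ordAt_mul _ hL hG] at h1
    have h3 : ordAt (b.1.position P) (B.factor b b.1.color) = 0 := by
      unfold factor
      split_ifs
      · rw [ordAt_inv _ (rootA_ne_zero _ _ _)]
        change -ordAt _ (boxRoot b b.1.color) = 0
        rw [h2, neg_zero]
      · exact h2
    omega
  · rwa [mul_one, ordAt_mul _ hL hG] at h1

/-- At a concave or convex positive box the simple pole of the weight is carried by the part below
the box. -/
lemma ordAt_of_positive {s : B.State} (hs : s ∈ S) {b : B.boxes} (hbp : b ∈ B.positive)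
    (hb : b ∈ B.concave S s ∨ b ∈ B.convex S s) :
    ordAt (b.1.position P) (B.weightLT Ψ s b b.1.color) = -1 ∧
      ordAt (b.1.position P) (B.weightGT Ψ s b b.1.color) = 0 := by
  have h1 := h.ordAt_weightLT_add_weightGT hs hb
  have h2 : ordAt (b.1.position P) (B.weightGT Ψ s b b.1.color) = 0 := by
    rcases hb with hb | hb
    · exact h.ordAt_weightGT_of_concave hs hbp hb
    · obtain ⟨hbo, hbS⟩ := mem_convex.1 hb
      have := h.ordAt_weightGT_of_concave hbS hbp (mem_concave_remove hs hbo)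
      rwa [h.ordAt_weightGT_remove hbo (boxOrd_self h.generic b)] at this
  omega

/-- At a concave or convex negative box the simple pole of the weight is carried by the part above
the box. -/
lemma ordAt_of_negative {s : B.State} (hs : s ∈ S) {b : B.boxes} (hbp : b ∉ B.positive)
    (hb : b ∈ B.concave S s ∨ b ∈ B.convex S s) :
    ordAt (b.1.position P) (B.weightLT Ψ s b b.1.color) = 0 ∧
      ordAt (b.1.position P) (B.weightGT Ψ s b b.1.color) = -1 := by
  have h1 := h.ordAt_weightLT_add_weightGT hs hb
  have h2 : ordAt (b.1.position P) (B.weightLT Ψ s b b.1.color) = 0 := by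
    rcases hb with hb | hb
    · obtain ⟨hbo, hbS⟩ := mem_concave.1 hb
      have := h.ordAt_weightLT_of_convex hbS hbp (mem_convex_add hs hbo)
      have h3 := h.ordAt_weightLT_remove (s := B.add s b) ((occ_add s b b).2 (Or.inl rfl))
        (boxOrd_self h.generic b)
      rw [remove_add hbo] at h3
      rwa [h3]
    · exact h.ordAt_weightLT_of_convex hs hbp hb
  omega

/-! ### Exclusion of wheels -/

omit h in
/-- Three boxes that can be added to a state in this order, although their positions and colors
form a directed triangle. -/
def Wheel (S : Set B.State) (t : B.State) (u v w : B.boxes) : Prop :=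
  t ∈ S ∧ u ∈ B.concave S t ∧ v ∈ B.concave S (B.add t u) ∧
    w ∈ B.concave S (B.add (B.add t u) v) ∧ Edge u v ∧ Edge v w ∧ Edge w u

/-- Below a wheel there is another one: the position of the last box is already a pole of the
weight before the first box is added, and the box causing it can be removed. -/
lemma exists_lower_wheel {t : B.State} {u v w : B.boxes} (hw : Wheel S t u v w) :
    ∃ t' u', Wheel S t' u' u v ∧ Same u' w ∧
      ∀ i a, wOrd Ψ t' i a = wOrd Ψ t i a + rootOrd w i a := by
  have hP := h.generic
  obtain ⟨ht, hu, hv, hw, huv, hvw, hwu⟩ := hw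
  obtain ⟨huo, huS⟩ := mem_concave.1 hu
  obtain ⟨hvo, hvS⟩ := mem_concave.1 hv
  have huw : boxOrd u w = -1 := by rw [boxOrd_swap hP, boxOrd_of_edge hP hwu]
  have h1 : wOrd Ψ t w.1.color (w.1.position P) = -1 := by
    have h2 := h.wOrd_eq_neg_one hvS (Or.inl hw)
    rw [h.wOrd_add huS hvo, h.wOrd_add ht huo] at h2
    have h3 := boxOrd_of_edge hP hvw
    unfold boxOrd at *
    omega
  obtain ⟨u', hsame, hu'⟩ := h.exists_box ht h1
  have hu'c : u' ∈ B.convex S t := by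
    refine hu'.resolve_left fun hcc => ?_
    have := h.boxOrd_eq_zero_of_concave ht hcc hu
    rw [Same.boxOrd_eq ⟨rfl, rfl⟩ hsame, huw] at this
    omega
  obtain ⟨hu'o, hu'S⟩ := mem_convex.1 hu'c
  refine ⟨B.remove t u', u', ⟨hu'S, mem_concave_remove ht hu'o, ?_, ?_, ?_, huv, ?_⟩, hsame, ?_⟩
  · rwa [add_remove hu'o]
  · rwa [add_remove hu'o]
  · rwa [Same.edge_iff hsame ⟨rfl, rfl⟩]
  · rwa [Same.edge_iff ⟨rfl, rfl⟩ hsame]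
  · intro i a
    rw [h.wOrd_remove ht hu'o, hsame.rootOrd_eq]

omit h in
/-- The product of the affine roots of a directed triangle has a pole. -/
lemma exists_neg_of_triangle (hP : P.Generic) {u v w : B.boxes} (huv : Edge u v) (hvw : Edge v w)
    (hwu : Edge w u) : ∃ i a, rootOrd u i a + rootOrd v i a + rootOrd w i a < 0 := by
  -- Two consecutive vertices of the same color exist; the pole is one step beyond them.
  have key : ∀ u v w : B.boxes, Edge u v → Edge w u → u.1.color = v.1.color →
      ∃ i a, rootOrd u i a + rootOrd v i a + rootOrd w i a < 0 := by
    intro u v w huv hwu hcol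
    have hu0 : u.1.position P ≠ 0 := Box.position_ne_zero _
    have ha : P.mon 2 0 * u.1.position P ≠ 0 := mul_ne_zero (P.mon_ne_zero _ _) hu0
    refine ⟨u.1.color, P.mon 2 0 * u.1.position P, ?_⟩
    simp only [rootOrd, boxRoot]
    have h1 : gval P u.1.color u.1.color (P.mon 2 0 * u.1.position P) (u.1.position P) = 0 :=
      (gval_eq_zero_iff _ _ _ _).2 ⟨2, 0, Or.inl ⟨rfl, rfl, rfl⟩, rfl⟩
    have h2 : gval P v.1.color u.1.color (v.1.position P) (P.mon 2 0 * u.1.position P) ≠ 0 := by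
      rw [Ne, gval_eq_zero_iff]
      rintro ⟨x, y, hst, e⟩
      obtain ⟨x', y', hst', e'⟩ := huv.exists_step
      rw [e', P.mon_mul_mon_mul, P.mon_mul_mon_mul] at e
      have := hP.mon_mul_eq_self (Box.position_ne_zero _) e.symm
      have hx' : x' = 2 := by
        rcases hst' with hst' | hst'
        · exact hst'.2.1
        · exact absurd hcol hst'.1
      unfold IsStep at hst
      omega
    have h3 : gval P w.1.color u.1.color (w.1.position P) (P.mon 2 0 * u.1.position P) ≠ 0 := by
      rw [Ne, gval_eq_zero_iff]
      rintro ⟨x, y, hst, e⟩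
      obtain ⟨x', y', hst', e'⟩ := hwu.exists_step
      rw [e', P.mon_mul_mon_mul] at e
      have := hP.mon_mul_eq hu0 e
      unfold IsStep at hst hst'
      omega
    rw [ordAt_rootA hP _ _ (Box.position_ne_zero _), ordAt_rootA hP _ _ (Box.position_ne_zero _),
      ordAt_rootA hP _ _ (Box.position_ne_zero _), if_neg h2, if_neg h3, if_pos h1,
      if_neg (gval_swap_ne_zero hP hu0 h1)]
    split_ifs <;> omega
  have hcol : ∀ i j k : ZMod 2, i = j ∨ j = k ∨ k = i := by decide
  rcases hcol u.1.color v.1.color w.1.color with hc | hc | hc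
  · exact key u v w huv hwu hc
  · obtain ⟨i, a, hia⟩ := key v w u hvw huv hc
    exact ⟨i, a, by omega⟩
  · obtain ⟨i, a, hia⟩ := key w u v hwu hvw hc
    exact ⟨i, a, by omega⟩

/-- There are no wheels: three descents replace a wheel by one with the same colors and positions,
and multiply the weight by the roots of a directed triangle, which cannot be repeated indefinitely. -/
theorem not_wheel (t : B.State) (u v w : B.boxes) : ¬ Wheel S t u v w := by
  intro hw
  have key : ∀ n : ℕ, ∃ t' u' v' w', Wheel S t' u' v' w' ∧ Same u' u ∧ Same v' v ∧ Same w' w ∧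
      ∀ i a, wOrd Ψ t' i a =
        wOrd Ψ t i a + n * (rootOrd u i a + rootOrd v i a + rootOrd w i a) := by
    intro n
    induction n with
    | zero =>
      exact ⟨t, u, v, w, hw, ⟨rfl, rfl⟩, ⟨rfl, rfl⟩, ⟨rfl, rfl⟩, by simp⟩
    | succ n ih =>
      obtain ⟨t₀, u₀, v₀, w₀, hw₀, hu, hv, hw, e₀⟩ := ih
      obtain ⟨t₁, w₁, hw₁, hsw, e₁⟩ := h.exists_lower_wheel hw₀
      obtain ⟨t₂, v₂, hw₂, hsv, e₂⟩ := h.exists_lower_wheel hw₁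
      obtain ⟨t₃, u₃, hw₃, hsu, e₃⟩ := h.exists_lower_wheel hw₂
      refine ⟨t₃, u₃, v₂, w₁, hw₃, hsu.trans hu, hsv.trans hv, hsw.trans hw, fun i a => ?_⟩
      rw [e₃, e₂, e₁, e₀, hu.rootOrd_eq, hv.rootOrd_eq, hw.rootOrd_eq]
      push_cast
      ring
  obtain ⟨i, a, hneg⟩ := exists_neg_of_triangle h.generic hw.2.2.2.2.1 hw.2.2.2.2.2.1
    hw.2.2.2.2.2.2
  have := h.nonneg_of_unbounded (fun i a => rootOrd u i a + rootOrd v i a + rootOrd w i a) t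
    (fun n => by
      obtain ⟨t', u', v', w', hw', -, -, -, e⟩ := key n
      exact ⟨t', hw'.1, e⟩) i a
  exact absurd this (not_le.2 hneg)

end Admissible

end BoxSystem

end Toroidal

namespace Toroidal

variable {P : Params}

/-! ### The Serre relation for currents with a delta-function expansion -/

lemma IsStep.cases {i j : ZMod 2} {a b : ℤ} (h : IsStep i j a b) :
    (a = 2 ∧ b = 0) ∨ (a = -1 ∧ b = 1) ∨ (a = -1 ∧ b = -1) := by
  rcases h with h | ⟨-, h, h' | h'⟩
  · exact Or.inl h.2
  · exact Or.inr (Or.inl ⟨h, h'⟩)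
  · exact Or.inr (Or.inr ⟨h, h'⟩)

lemma IsStep.color_add {i j : ZMod 2} {a b : ℤ} (h : IsStep i j a b) : i + j = (a : ZMod 2) := by
  have key : ∀ i j : ZMod 2, i ≠ j → i + j = 1 := by decide
  rcases h with ⟨rfl, rfl, -⟩ | ⟨h, rfl, -⟩
  · rw [CharTwo.add_self_eq_zero]; rfl
  · rw [key i j h]; rfl

/-- A family of elements of an algebra, indexed by letters with a color and a position, which
satisfies the relations that the one-box parts of the currents `E_i(z)` satisfy. -/
structure IsLetterFamily (P : Params) {ι A : Type*} [Ring A] [Algebra ℂ A] (col : ι → ZMod 2)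
    (pos : ι → ℂ) (X : ι → A) : Prop where
  pos_ne_zero : ∀ b, pos b ≠ 0
  exchange : ∀ b c, (sgn (col b) (col c) * gval P (col b) (col c) (pos b) (pos c)) • (X b * X c) +
    gval P (col c) (col b) (pos c) (pos b) • (X c * X b) = 0
  same : ∀ b c, col b = col c → pos b = pos c → X b * X c = 0
  triangle : ∀ u v w, gval P (col u) (col v) (pos u) (pos v) = 0 →
    gval P (col v) (col w) (pos v) (pos w) = 0 → gval P (col w) (col u) (pos w) (pos u) = 0 →
    X u * X v * X w = 0

lemma sgn_ne_zero (i j : ZMod 2) : sgn i j ≠ 0 := by unfold sgn; split_ifs <;> norm_num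

namespace IsLetterFamily

variable {ι A : Type*} [Ring A] [Algebra ℂ A] {col : ι → ZMod 2} {pos : ι → ℂ} {X : ι → A}
  (hX : IsLetterFamily P col pos X)

variable (P col pos) in
/-- The letter `u` may stand to the left of the letter `v` in a nonzero word. -/
def Ordered (u v : ι) : Prop :=
  gval P (col v) (col u) (pos v) (pos u) ≠ 0 ∧ ¬ (col u = col v ∧ pos u = pos v)

include hX

lemma swap (u v : ι) (h : gval P (col u) (col v) (pos u) (pos v) ≠ 0) :
    ∃ k : ℂ, X u * X v = k • (X v * X u) := by
  have hs := mul_ne_zero (sgn_ne_zero (col u) (col v)) h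
  refine ⟨-((sgn (col u) (col v) * gval P (col u) (col v) (pos u) (pos v))⁻¹ *
    gval P (col v) (col u) (pos v) (pos u)), ?_⟩
  have h1 := eq_neg_of_add_eq_zero_left (hX.exchange u v)
  rw [neg_smul, mul_smul, ← smul_neg, ← h1, smul_smul, inv_mul_cancel₀ hs, one_smul]

lemma ordered_two (hP : P.Generic) {u v : ι} (h : X u * X v ≠ 0) : Ordered P col pos u v := by
  refine ⟨fun hg => h ?_, fun hs => h (hX.same u v hs.1 hs.2)⟩
  have hg' := gval_swap_ne_zero hP (hX.pos_ne_zero u) hg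
  have h1 := hX.exchange u v
  rw [hg, zero_smul, add_zero] at h1
  exact (smul_eq_zero.1 h1).resolve_left (mul_ne_zero (sgn_ne_zero _ _) hg')

/-- In a nonzero word of three letters the first and the last one are ordered: if the middle letter
commutes with a neighbour up to a scalar, it can be moved out of the way, and otherwise the three
letters lie along a path of two steps, which the triangle relation prevents from closing up. -/
lemma ordered_three (hP : P.Generic) {u a v : ι} (h : X u * X a * X v ≠ 0) :
    Ordered P col pos u v := by
  by_cases hua : gval P (col u) (col a) (pos u) (pos a) = 0
  swap
  · obtain ⟨k, hk⟩ := hX.swap u a hua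
    refine hX.ordered_two hP fun h0 => h ?_
    rw [hk, smul_mul_assoc, mul_assoc, h0, mul_zero, smul_zero]
  by_cases hav : gval P (col a) (col v) (pos a) (pos v) = 0
  swap
  · obtain ⟨k, hk⟩ := hX.swap a v hav
    refine hX.ordered_two hP fun h0 => h ?_
    rw [mul_assoc, hk, mul_smul_comm, ← mul_assoc, h0, zero_mul, smul_zero]
  refine ⟨fun hvu => h (hX.triangle u a v hua hav hvu), fun hs => ?_⟩
  rw [← hs.1, ← hs.2] at hav
  exact gval_swap_ne_zero hP (hX.pos_ne_zero a) hua hav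

/-- In a nonzero word of four letters the first and the last one are ordered. The condition on the
colors excludes four letters at the corners of a unit square. -/
lemma ordered_four (hP : P.Generic) {u a b v : ι} (hcol : col u + col a + col b + col v = 1)
    (h : X u * X a * X b * X v ≠ 0) : Ordered P col pos u v := by
  by_cases hua : gval P (col u) (col a) (pos u) (pos a) = 0
  swap
  · obtain ⟨k, hk⟩ := hX.swap u a hua
    refine hX.ordered_three hP (a := b) fun h0 => h ?_
    rw [hk, smul_mul_assoc, smul_mul_assoc, mul_assoc (X a), mul_assoc (X a), h0, mul_zero,
      smul_zero]
  by_cases hbv : gval P (col b) (col v) (pos b) (pos v) = 0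
  swap
  · obtain ⟨k, hk⟩ := hX.swap b v hbv
    refine hX.ordered_three hP (a := a) fun h0 => h ?_
    rw [mul_assoc, hk, mul_smul_comm, ← mul_assoc, h0, zero_mul, smul_zero]
  by_cases hab : gval P (col a) (col b) (pos a) (pos b) = 0
  · refine ⟨fun hvu => ?_, fun hs => ?_⟩
    · obtain ⟨x₁, y₁, s₁, e₁⟩ := (gval_eq_zero_iff _ _ _ _).1 hua
      obtain ⟨x₂, y₂, s₂, e₂⟩ := (gval_eq_zero_iff _ _ _ _).1 hab
      obtain ⟨x₃, y₃, s₃, e₃⟩ := (gval_eq_zero_iff _ _ _ _).1 hbv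
      obtain ⟨x₄, y₄, s₄, e₄⟩ := (gval_eq_zero_iff _ _ _ _).1 hvu
      have f : x₁ + x₂ + x₃ + x₄ = 0 ∧ y₁ + y₂ + y₃ + y₄ = 0 := by
        refine hP.mon_mul_eq_self (hX.pos_ne_zero u) ?_
        rw [← P.mon_mul_mon, ← P.mon_mul_mon, ← P.mon_mul_mon, mul_assoc, mul_assoc, mul_assoc,
          ← e₄, ← e₃, ← e₂, ← e₁]
      have c₁ := s₁.cases
      have c₂ := s₂.cases
      have c₃ := s₃.cases
      have c₄ := s₄.cases
      omega
    · refine h ?_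
      rw [← hs.1, ← hs.2] at hbv
      rw [hX.triangle u a b hua hab hbv, zero_mul]
  obtain ⟨k, hk⟩ := hX.swap a b hab
  have h' : X u * X b * X a * X v ≠ 0 := fun h0 => h (by
    rw [mul_assoc (X u), hk, mul_smul_comm, smul_mul_assoc, ← mul_assoc, h0, smul_zero])
  by_cases hub : gval P (col u) (col b) (pos u) (pos b) = 0
  swap
  · obtain ⟨k, hk⟩ := hX.swap u b hub
    refine hX.ordered_three hP (a := a) fun h0 => h' ?_
    rw [hk, smul_mul_assoc, smul_mul_assoc, mul_assoc (X b), mul_assoc (X b), h0, mul_zero,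
      smul_zero]
  by_cases hav : gval P (col a) (col v) (pos a) (pos v) = 0
  swap
  · obtain ⟨k, hk⟩ := hX.swap a v hav
    refine hX.ordered_three hP (a := b) fun h0 => h' ?_
    rw [mul_assoc, hk, mul_smul_comm, ← mul_assoc, h0, zero_mul, smul_zero]
  refine ⟨fun hvu => ?_, fun hs => ?_⟩
  · obtain ⟨x₁, y₁, s₁, e₁⟩ := (gval_eq_zero_iff _ _ _ _).1 hua
    obtain ⟨x₂, y₂, s₂, e₂⟩ := (gval_eq_zero_iff _ _ _ _).1 hav
    obtain ⟨x₃, y₃, s₃, e₃⟩ := (gval_eq_zero_iff _ _ _ _).1 hvu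
    obtain ⟨x₄, y₄, s₄, e₄⟩ := (gval_eq_zero_iff _ _ _ _).1 hub
    obtain ⟨x₅, y₅, s₅, e₅⟩ := (gval_eq_zero_iff _ _ _ _).1 hbv
    have f₁ : x₁ + x₂ + x₃ = 0 ∧ y₁ + y₂ + y₃ = 0 := by
      refine hP.mon_mul_eq_self (hX.pos_ne_zero u) ?_
      rw [← P.mon_mul_mon, ← P.mon_mul_mon, mul_assoc, mul_assoc, ← e₃, ← e₂, ← e₁]
    have f₂ : x₄ + x₅ + x₃ = 0 ∧ y₄ + y₅ + y₃ = 0 := by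
      refine hP.mon_mul_eq_self (hX.pos_ne_zero u) ?_
      rw [← P.mon_mul_mon, ← P.mon_mul_mon, mul_assoc, mul_assoc, ← e₃, ← e₅, ← e₄]
    have hcase : (x₁ = x₄ ∧ y₁ = y₄) ∨ x₅ = x₁ := by
      have c₁ := s₁.cases
      have c₂ := s₂.cases
      have c₃ := s₃.cases
      have c₄ := s₄.cases
      have c₅ := s₅.cases
      omega
    rcases hcase with ⟨rfl, rfl⟩ | rfl
    · refine h ?_
      have hc : col a = col b := by
        have c₁ := s₁.color_add
        rw [← s₄.color_add] at c₁
        exact add_left_cancel c₁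
      have hp : pos a = pos b := mul_left_cancel₀ (P.mon_ne_zero x₁ y₁) (e₁.symm.trans e₄)
      rw [mul_assoc (X u), hX.same a b hc hp, mul_zero, zero_mul]
    · have c₁ := s₁.color_add
      have c₅ := s₅.color_add
      rw [add_assoc, c₁, c₅, CharTwo.add_self_eq_zero] at hcol
      exact zero_ne_one hcol
  · rw [← hs.1, ← hs.2] at hav
    exact gval_swap_ne_zero hP (hX.pos_ne_zero a) hua hav

end IsLetterFamily

section Words

variable {A : Type*} [Ring A] [Algebra ℂ A]

/-- If four elements commute up to the scalars `h i j / h j i`, then all words in them are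
proportional to the same element with the expected coefficients. -/
lemma exists_word_eq_smul (X : Fin 4 → A) (h : Fin 4 → Fin 4 → ℂ)
    (hex : ∀ i j, i ≠ j → h j i • (X i * X j) = h i j • (X j * X i))
    (hne : ∀ i j, i < j → h i j ≠ 0) :
    ∃ κ : A, ∀ a b c d : Fin 4, a ≠ b → a ≠ c → a ≠ d → b ≠ c → b ≠ d → c ≠ d →
      X a * X b * X c * X d = (h a b * h a c * h a d * h b c * h b d * h c d) • κ := by
  set Q : A → Fin 4 → Fin 4 → Fin 4 → Fin 4 → Prop := fun κ a b c d =>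
    X a * X b * X c * X d = (h a b * h a c * h a d * h b c * h b d * h c d) • κ with hQ
  have hsw : ∀ i j, i < j → X j * X i = (h j i / h i j) • (X i * X j) := by
    intro i j hij
    rw [div_eq_inv_mul, mul_smul, hex i j hij.ne, smul_smul, inv_mul_cancel₀ (hne i j hij),
      one_smul]
  have s₁ : ∀ κ a b c d, a < b → Q κ a b c d → Q κ b a c d := by
    intro κ a b c d hab hq
    simp only [hQ] at hq ⊢
    rw [hsw a b hab, smul_mul_assoc, smul_mul_assoc, hq, smul_smul]
    congr 1
    field_simp [hne a b hab]
  have s₂ : ∀ κ a b c d, b < c → Q κ a b c d → Q κ a c b d := by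
    intro κ a b c d hab hq
    simp only [hQ] at hq ⊢
    rw [mul_assoc (X a), hsw b c hab, mul_smul_comm, smul_mul_assoc, ← mul_assoc, hq, smul_smul]
    congr 1
    field_simp [hne b c hab]
  have s₃ : ∀ κ a b c d, c < d → Q κ a b c d → Q κ a b d c := by
    intro κ a b c d hab hq
    simp only [hQ] at hq ⊢
    rw [mul_assoc, hsw c d hab, mul_smul_comm, ← mul_assoc, hq, smul_smul]
    congr 1
    field_simp [hne c d hab]
  set H := h 0 1 * h 0 2 * h 0 3 * h 1 2 * h 1 3 * h 2 3 with hH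
  have hH0 : H ≠ 0 := by
    have h01 := hne 0 1 (by decide)
    have h02 := hne 0 2 (by decide)
    have h03 := hne 0 3 (by decide)
    have h12 := hne 1 2 (by decide)
    have h13 := hne 1 3 (by decide)
    have h23 := hne 2 3 (by decide)
    rw [hH]
    positivity
  refine ⟨H⁻¹ • (X 0 * X 1 * X 2 * X 3), ?_⟩
  set κ := H⁻¹ • (X 0 * X 1 * X 2 * X 3) with hκ
  have q0123 : Q κ 0 1 2 3 := by
    simp only [hQ, ← hH, hκ]
    rw [smul_smul, mul_inv_cancel₀ hH0, one_smul]
  have q0132 := s₃ _ _ _ _ _ (by decide) q0123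
  have q0213 := s₂ _ _ _ _ _ (by decide) q0123
  have q1023 := s₁ _ _ _ _ _ (by decide) q0123
  have q0312 := s₂ _ _ _ _ _ (by decide) q0132
  have q0231 := s₃ _ _ _ _ _ (by decide) q0213
  have q0321 := s₃ _ _ _ _ _ (by decide) q0312
  have q1032 := s₃ _ _ _ _ _ (by decide) q1023
  have q1203 := s₂ _ _ _ _ _ (by decide) q1023
  have q1302 := s₂ _ _ _ _ _ (by decide) q1032
  have q1230 := s₃ _ _ _ _ _ (by decide) q1203
  have q1320 := s₃ _ _ _ _ _ (by decide) q1302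
  have q2013 := s₁ _ _ _ _ _ (by decide) q0213
  have q2031 := s₁ _ _ _ _ _ (by decide) q0231
  have q2103 := s₁ _ _ _ _ _ (by decide) q1203
  have q2130 := s₁ _ _ _ _ _ (by decide) q1230
  have q2301 := s₂ _ _ _ _ _ (by decide) q2031
  have q2310 := s₂ _ _ _ _ _ (by decide) q2130
  have q3012 := s₁ _ _ _ _ _ (by decide) q0312
  have q3021 := s₁ _ _ _ _ _ (by decide) q0321
  have q3102 := s₁ _ _ _ _ _ (by decide) q1302
  have q3120 := s₁ _ _ _ _ _ (by decide) q1320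
  have q3201 := s₁ _ _ _ _ _ (by decide) q2301
  have q3210 := s₁ _ _ _ _ _ (by decide) q2310
  intro a b c d hab hac had hbc hbd hcd
  fin_cases a <;> fin_cases b <;> first | exact absurd rfl hab | skip
  all_goals fin_cases c <;> first | exact absurd rfl hac | exact absurd rfl hbc | skip
  all_goals fin_cases d <;>
    first | exact absurd rfl had | exact absurd rfl hbd | exact absurd rfl hcd | assumption

end Words

/-- The exchange coefficient for moving the letter `u` to the left of `v`, with positions `z`
and `w`. -/
def exchangeCoeff (P : Params) (i j : ZMod 2) (z w : ℂ) : ℂ :=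
  if i = j then (P.q₂ * z - w) / (z - w) else gval P j i w z

lemma IsLetterFamily.exchangeCoeff_smul {ι A : Type*} [Ring A] [Algebra ℂ A] {col : ι → ZMod 2}
    {pos : ι → ℂ} {X : ι → A} (hX : IsLetterFamily P col pos X) {u v : ι}
    (h : ¬ (col u = col v ∧ pos u = pos v)) :
    exchangeCoeff P (col v) (col u) (pos v) (pos u) • (X u * X v) =
      exchangeCoeff P (col u) (col v) (pos u) (pos v) • (X v * X u) := by
  have h1 := hX.exchange u v
  unfold exchangeCoeff
  by_cases hc : col u = col v
  · have hp : pos u - pos v ≠ 0 := sub_ne_zero.2 fun hp => h ⟨hc, hp⟩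
    have hp' : pos v - pos u ≠ 0 := sub_ne_zero.2 fun hp => h ⟨hc, hp.symm⟩
    rw [if_pos hc, if_pos hc.symm, ← sub_eq_zero]
    rw [sgn, if_pos hc, gval, if_pos hc, gval, if_pos hc.symm, one_mul] at h1
    have h2 := congrArg (fun x => (pos u - pos v)⁻¹ • x) h1
    simp only [smul_add, smul_smul, smul_zero] at h2
    rw [← h2, sub_eq_add_neg, ← neg_smul]
    congr 2
    · rw [← neg_sub (pos u) (pos v)]; field_simp; ring
    · field_simp; ring
  · rw [if_neg hc, if_neg (Ne.symm hc)]
    rw [sgn, if_neg hc, neg_one_mul, neg_smul] at h1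
    exact (neg_add_eq_zero.1 h1)

lemma exchangeCoeff_ne_zero {i j : ZMod 2} {z w : ℂ} (h : gval P j i w z ≠ 0)
    (h' : ¬ (i = j ∧ z = w)) : exchangeCoeff P i j z w ≠ 0 := by
  unfold exchangeCoeff
  split_ifs with hc
  · refine div_ne_zero (fun h0 => h ?_) (sub_ne_zero.2 fun hp => h' ⟨hc, hp⟩)
    rw [gval, if_pos hc.symm, ← neg_sub, h0, neg_zero]
  · exact h

/-- All words in four given letters are proportional to one element, with the coefficients that
the exchange relations predict: this element is zero if all words vanish, and otherwise a nonzero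
word fixes an order of the letters in which no exchange coefficient degenerates. -/
lemma IsLetterFamily.words {ι A : Type*} [Ring A] [Algebra ℂ A] {col : ι → ZMod 2} {pos : ι → ℂ}
    {X : ι → A} (hX : IsLetterFamily P col pos X) (hP : P.Generic) (L : Fin 4 → ι)
    (hcol : ∑ e, col (L e) = 1) :
    ∃ κ : A, ∀ a b c d : Fin 4, a ≠ b → a ≠ c → a ≠ d → b ≠ c → b ≠ d → c ≠ d →
        X (L a) * X (L b) * X (L c) * X (L d) =
          (exchangeCoeff P (col (L a)) (col (L b)) (pos (L a)) (pos (L b)) *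
            exchangeCoeff P (col (L a)) (col (L c)) (pos (L a)) (pos (L c)) *
            exchangeCoeff P (col (L a)) (col (L d)) (pos (L a)) (pos (L d)) *
            exchangeCoeff P (col (L b)) (col (L c)) (pos (L b)) (pos (L c)) *
            exchangeCoeff P (col (L b)) (col (L d)) (pos (L b)) (pos (L d)) *
            exchangeCoeff P (col (L c)) (col (L d)) (pos (L c)) (pos (L d))) • κ := by
  by_cases hall : ∀ a b c d : Fin 4, a ≠ b → a ≠ c → a ≠ d → b ≠ c → b ≠ d → c ≠ d →
      X (L a) * X (L b) * X (L c) * X (L d) = 0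
  · refine ⟨0, fun a b c d h1 h2 h3 h4 h5 h6 => ?_⟩
    rw [hall a b c d h1 h2 h3 h4 h5 h6, smul_zero]
  push Not at hall
  -- A nonzero word is used as the reference order of the letters.
  obtain ⟨a₀, b₀, c₀, d₀, h1, h2, h3, h4, h5, h6, hne⟩ := hall
  set τ : Fin 4 → Fin 4 := ![a₀, b₀, c₀, d₀] with hτ
  have hinj : Function.Injective τ := by
    intro i j hij
    fin_cases i <;> fin_cases j <;> simp [hτ] at hij ⊢ <;>
      first | exact h1 hij | exact h2 hij | exact h3 hij | exact h4 hij | exact h5 hij |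
        exact h6 hij | exact h1 hij.symm | exact h2 hij.symm | exact h3 hij.symm |
        exact h4 hij.symm | exact h5 hij.symm | exact h6 hij.symm
  have hbij : Function.Bijective τ := Finite.injective_iff_bijective.1 hinj
  have hcol' : col (L a₀) + col (L b₀) + col (L c₀) + col (L d₀) = 1 := by
    rw [← hcol, ← hbij.sum_comp (fun e => col (L e)), Fin.sum_univ_four]; rfl
  have n2 : ∀ {x y : A}, x * y ≠ 0 → x ≠ 0 ∧ y ≠ 0 := fun hxy =>
    ⟨fun h => hxy (by rw [h, zero_mul]), fun h => hxy (by rw [h, mul_zero])⟩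
  have hord : ∀ i j, i < j → IsLetterFamily.Ordered P col pos (L (τ i)) (L (τ j)) := by
    have o01 := hX.ordered_two hP (n2 (n2 hne).1).1
    have o02 := hX.ordered_three hP (n2 hne).1
    have o03 := hX.ordered_four hP hcol' hne
    have o12 := hX.ordered_two hP (n2 (by rw [mul_assoc (X (L a₀))] at hne; exact (n2 hne).1)).2
    have o13 := hX.ordered_three hP
      (n2 (by rw [mul_assoc (X (L a₀)), mul_assoc (X (L a₀))] at hne; exact hne)).2
    have o23 := hX.ordered_two hP (n2 (by rw [mul_assoc] at hne; exact hne)).2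
    intro i j hij
    fin_cases i <;> fin_cases j <;> first | exact absurd hij (by decide) | assumption
  obtain ⟨κ, hκ⟩ := exists_word_eq_smul (fun i => X (L (τ i)))
    (fun i j => exchangeCoeff P (col (L (τ i))) (col (L (τ j))) (pos (L (τ i))) (pos (L (τ j))))
    (fun i j hij => by
      rcases lt_or_gt_of_ne hij with hlt | hlt
      · exact hX.exchangeCoeff_smul (hord i j hlt).2
      · exact hX.exchangeCoeff_smul fun hs => (hord j i hlt).2 ⟨hs.1.symm, hs.2.symm⟩)
    (fun i j hij => exchangeCoeff_ne_zero (hord i j hij).1 (hord i j hij).2)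
  refine ⟨κ, fun a b c d => ?_⟩
  obtain ⟨i, rfl⟩ := hbij.2 a
  obtain ⟨j, rfl⟩ := hbij.2 b
  obtain ⟨k, rfl⟩ := hbij.2 c
  obtain ⟨l, rfl⟩ := hbij.2 d
  intro h1 h2 h3 h4 h5 h6
  exact hκ i j k l (ne_of_apply_ne τ h1) (ne_of_apply_ne τ h2) (ne_of_apply_ne τ h3)
    (ne_of_apply_ne τ h4) (ne_of_apply_ne τ h5) (ne_of_apply_ne τ h6)

/-- The identity of rational functions behind the Serre relation, after the sums over the orders of
the letters which stand on the same side of the letter of the other color. -/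
lemma serre_identity_reduced (z₁ z₂ z₃ W s p : ℂ) (α β : ℂ → ℂ)
    (hα : ∀ z, α z = W - s * z + p * z ^ 2) (hβ : ∀ z, β z = z ^ 2 - s * z + p * W) :
    p * ((z₁ - z₂) * (z₁ - z₃) * (z₂ - z₃)) * (α z₁ * α z₂ * α z₃ - β z₁ * β z₂ * β z₃) =
    (z₁ - z₂) * (z₁ - p * z₃) * (z₂ - p * z₃) * (α z₁ * α z₂ * β z₃)
    - (z₁ - z₃) * (z₁ - p * z₂) * (z₃ - p * z₂) * (α z₁ * α z₃ * β z₂)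
    + (z₂ - z₃) * (z₂ - p * z₁) * (z₃ - p * z₁) * (α z₂ * α z₃ * β z₁)
    - (z₂ - z₃) * (z₁ - p * z₂) * (z₁ - p * z₃) * (α z₁ * β z₂ * β z₃)
    + (z₁ - z₃) * (z₂ - p * z₁) * (z₂ - p * z₃) * (α z₂ * β z₁ * β z₃)
    - (z₁ - z₂) * (z₃ - p * z₁) * (z₃ - p * z₂) * (α z₃ * β z₁ * β z₂) := by
  simp only [hα, hβ]
  ring

/-- The antisymmetrized form of the identity. Antisymmetrizing the products `∏ (zᵢ - p zⱼ)` in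
three, respectively two, of the variables gives Vandermonde products with the factors
`(1 + p) (1 + p + p ^ 2)`, respectively `1 + p`. -/
lemma serre_polynomial_identity (z₁ z₂ z₃ w s p : ℂ) (α β : ℂ → ℂ)
    (hα : ∀ z, α z = w ^ 2 - s * w * z + p * z ^ 2)
    (hβ : ∀ z, β z = z ^ 2 - s * w * z + p * w ^ 2) (F : ℂ → ℂ → ℂ → ℂ)
    (hF : ∀ a b c, F a b c = p * (α a * α b * α c - β a * β b * β c) -
      (1 + p + p ^ 2) * (α a * α b * β c - α a * β b * β c)) :
    (z₁ - p * z₂) * (z₁ - p * z₃) * (z₂ - p * z₃) * F z₁ z₂ z₃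
    - (z₁ - p * z₃) * (z₁ - p * z₂) * (z₃ - p * z₂) * F z₁ z₃ z₂
    - (z₂ - p * z₁) * (z₂ - p * z₃) * (z₁ - p * z₃) * F z₂ z₁ z₃
    + (z₂ - p * z₃) * (z₂ - p * z₁) * (z₃ - p * z₁) * F z₂ z₃ z₁
    + (z₃ - p * z₁) * (z₃ - p * z₂) * (z₁ - p * z₂) * F z₃ z₁ z₂
    - (z₃ - p * z₂) * (z₃ - p * z₁) * (z₂ - p * z₁) * F z₃ z₂ z₁ = 0 := by
  have h := serre_identity_reduced z₁ z₂ z₃ (w ^ 2) (s * w) p α β hα hβ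
  simp only [hF]
  linear_combination (1 + p) * (1 + p + p ^ 2) * h

/-- The same identity with the exchange coefficients `q (a - p b) / (a - b)`. It holds for equal
arguments as well, with the value of the quotient being zero there. -/
lemma serre_fraction_identity (q p : ℂ) {z₁ z₂ z₃ : ℂ} (F : ℂ → ℂ → ℂ → ℂ)
    (hF : (z₁ - p * z₂) * (z₁ - p * z₃) * (z₂ - p * z₃) * F z₁ z₂ z₃
      - (z₁ - p * z₃) * (z₁ - p * z₂) * (z₃ - p * z₂) * F z₁ z₃ z₂
      - (z₂ - p * z₁) * (z₂ - p * z₃) * (z₁ - p * z₃) * F z₂ z₁ z₃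
      + (z₂ - p * z₃) * (z₂ - p * z₁) * (z₃ - p * z₁) * F z₂ z₃ z₁
      + (z₃ - p * z₁) * (z₃ - p * z₂) * (z₁ - p * z₂) * F z₃ z₁ z₂
      - (z₃ - p * z₂) * (z₃ - p * z₁) * (z₂ - p * z₁) * F z₃ z₂ z₁ = 0) :
    let e : ℂ → ℂ → ℂ := fun a b => q * (a - p * b) / (a - b)
    e z₁ z₂ * e z₁ z₃ * e z₂ z₃ * (q * F z₁ z₂ z₃) +
      e z₁ z₃ * e z₁ z₂ * e z₃ z₂ * (q * F z₁ z₃ z₂) +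
      e z₂ z₁ * e z₂ z₃ * e z₁ z₃ * (q * F z₂ z₁ z₃) +
      e z₂ z₃ * e z₂ z₁ * e z₃ z₁ * (q * F z₂ z₃ z₁) +
      e z₃ z₁ * e z₃ z₂ * e z₁ z₂ * (q * F z₃ z₁ z₂) +
      e z₃ z₂ * e z₃ z₁ * e z₂ z₁ * (q * F z₃ z₂ z₁) = 0 := by
  intro e
  have he : ∀ a b, e a b = q * (a - p * b) * (a - b)⁻¹ := fun a b => div_eq_mul_inv _ _
  have he' : ∀ a b, e b a = -(q * (b - p * a) * (a - b)⁻¹) := fun a b => by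
    rw [he, ← neg_sub a b, inv_neg, mul_neg]
  rw [he z₁ z₂, he z₁ z₃, he z₂ z₃, he' z₁ z₂, he' z₁ z₃, he' z₂ z₃]
  linear_combination (q ^ 4 * (z₁ - z₂)⁻¹ * (z₁ - z₃)⁻¹ * (z₂ - z₃)⁻¹) * hF

lemma sum_perm_three {M : Type*} [AddCommMonoid M] (f : Fin 3 → Fin 3 → Fin 3 → M) :
    ∑ σ : Equiv.Perm (Fin 3), f (σ 0) (σ 1) (σ 2) =
      f 0 1 2 + f 0 2 1 + f 1 0 2 + f 1 2 0 + f 2 0 1 + f 2 1 0 := by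
  have h : (Finset.univ : Finset (Equiv.Perm (Fin 3))) =
      {1, Equiv.swap 1 2, Equiv.swap 0 1, Equiv.swap 0 1 * Equiv.swap 1 2,
        Equiv.swap 1 2 * Equiv.swap 0 1, Equiv.swap 0 2} := by decide
  rw [h, Finset.sum_insert (by decide),
    Finset.sum_insert (by decide), Finset.sum_insert (by decide),
    Finset.sum_insert (by decide), Finset.sum_insert (by decide), Finset.sum_singleton]
  simp only [add_assoc]
  rfl

section SerreSum

variable {A : Type*} [Ring A] [Algebra ℂ A]

omit [Algebra ℂ A] in
lemma sum_perm_comp (τ : Equiv.Perm (Fin 3)) (f : Fin 3 → Fin 3 → Fin 3 → A) :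
    ∑ σ : Equiv.Perm (Fin 3), f (σ (τ 0)) (σ (τ 1)) (σ (τ 2)) =
      ∑ σ : Equiv.Perm (Fin 3), f (σ 0) (σ 1) (σ 2) :=
  Equiv.sum_comp (Equiv.mulRight τ) fun σ => f (σ 0) (σ 1) (σ 2)

/-- The symmetrized Serre expression in its expanded form. -/
lemma sum_qComm_eq (P : Params) (X : Fin 3 → A) (Y : A) :
    ∑ σ : Equiv.Perm (Fin 3), qComm (P.q ^ 2)⁻¹ (X (σ 0))
        (qComm 1 (X (σ 1)) (qComm (P.q ^ 2) (X (σ 2)) Y)) =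
      ∑ σ : Equiv.Perm (Fin 3), (X (σ 0) * X (σ 1) * X (σ 2) * Y -
        (P.q₂ + 1 + P.q₂⁻¹) • (X (σ 0) * X (σ 1) * Y * X (σ 2)) +
        (P.q₂ + 1 + P.q₂⁻¹) • (X (σ 0) * Y * X (σ 1) * X (σ 2)) -
        Y * X (σ 0) * X (σ 1) * X (σ 2)) := by
  have hq0 : P.q₂ ≠ 0 := q₂_ne_zero
  have expand : ∀ a b c : A, qComm P.q₂⁻¹ a (qComm 1 b (qComm P.q₂ c Y)) =
      a * b * c * Y - P.q₂ • (a * b * Y * c) - a * c * Y * b + P.q₂ • (a * Y * c * b) -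
        P.q₂⁻¹ • (b * c * Y * a) + b * Y * c * a + P.q₂⁻¹ • (c * Y * b * a) - Y * c * b * a := by
    intro a b c
    simp only [qComm, mul_sub, sub_mul, smul_sub, smul_smul, mul_smul_comm, smul_mul_assoc,
      one_smul, inv_mul_cancel₀ hq0, ← mul_assoc, one_mul]
    abel
  have m2 := fun τ => sum_perm_comp τ fun a b c => X a * X b * Y * X c
  have m1 := fun τ => sum_perm_comp τ fun a b c => X a * Y * X b * X c
  have m0 := fun τ => sum_perm_comp τ fun a b c => Y * X a * X b * X c
  have e1 : ∑ σ : Equiv.Perm (Fin 3), X (σ 0) * X (σ 2) * Y * X (σ 1) = _ := m2 (Equiv.swap 1 2)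
  have e2 : ∑ σ : Equiv.Perm (Fin 3), X (σ 1) * X (σ 2) * Y * X (σ 0) = _ := m2 (finRotate 3)
  have e3 : ∑ σ : Equiv.Perm (Fin 3), X (σ 0) * Y * X (σ 2) * X (σ 1) = _ := m1 (Equiv.swap 1 2)
  have e4 : ∑ σ : Equiv.Perm (Fin 3), X (σ 1) * Y * X (σ 2) * X (σ 0) = _ := m1 (finRotate 3)
  have e5 : ∑ σ : Equiv.Perm (Fin 3), X (σ 2) * Y * X (σ 1) * X (σ 0) = _ := m1 (Equiv.swap 0 2)
  have e6 : ∑ σ : Equiv.Perm (Fin 3), Y * X (σ 2) * X (σ 1) * X (σ 0) = _ := m0 (Equiv.swap 0 2)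
  rw [show P.q ^ 2 = P.q₂ from rfl]
  simp only [expand, Finset.sum_add_distrib, Finset.sum_sub_distrib, ← Finset.smul_sum, e1, e2, e3,
    e4, e5, e6]
  module

/-- The cubic Serre relation for a letter family. -/
theorem IsLetterFamily.serre {ι : Type*} {col : ι → ZMod 2} {pos : ι → ℂ} {X : ι → A}
    (hX : IsLetterFamily P col pos X) (hP : P.Generic) (i : ZMod 2) (x : Fin 3 → ι)
    (hx : ∀ l, col (x l) = i) (y : ι) (hy : col y = i + 1) :
    ∑ σ : Equiv.Perm (Fin 3), (X (x (σ 0)) * X (x (σ 1)) * X (x (σ 2)) * X y -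
        (P.q₂ + 1 + P.q₂⁻¹) • (X (x (σ 0)) * X (x (σ 1)) * X y * X (x (σ 2))) +
        (P.q₂ + 1 + P.q₂⁻¹) • (X (x (σ 0)) * X y * X (x (σ 1)) * X (x (σ 2))) -
        X y * X (x (σ 0)) * X (x (σ 1)) * X (x (σ 2))) = 0 := by
  set L : Fin 4 → ι := ![x 0, x 1, x 2, y] with hLdef
  have hL : ∀ a : Fin 3, L a.castSucc = x a := fun a => by fin_cases a <;> rfl
  have hLy : L (Fin.last 3) = y := rfl
  obtain ⟨κ, hw⟩ := hX.words hP L (by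
    rw [Fin.sum_univ_castSucc, hLy, hy]
    simp only [hL, hx]
    generalize i = j
    revert j
    decide)
  set z : Fin 3 → ℂ := fun a => pos (x a) with hz
  set w := pos y with hwdef
  set e : Fin 3 → Fin 3 → ℂ := fun a b => (P.q₂ * z a - z b) / (z a - z b) with he
  set α : ℂ → ℂ := fun u => w ^ 2 - (P.q₁ + P.q₃) * w * u + P.q₁ * P.q₃ * u ^ 2 with hα
  set β : ℂ → ℂ := fun u => u ^ 2 - (P.q₁ + P.q₃) * w * u + P.q₁ * P.q₃ * w ^ 2 with hβ
  have hi1 : i ≠ i + 1 := (by decide : ∀ j : ZMod 2, j ≠ j + 1) i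
  have cxx : ∀ a b, exchangeCoeff P (col (x a)) (col (x b)) (pos (x a)) (pos (x b)) = e a b := by
    intro a b
    rw [exchangeCoeff, if_pos (by rw [hx, hx])]
  have cxy : ∀ a, exchangeCoeff P (col (x a)) (col y) (pos (x a)) (pos y) = α (z a) := by
    intro a
    rw [exchangeCoeff, hx, hy, if_neg hi1, gval, if_neg hi1.symm]
    simp only [hα]; ring
  have cyx : ∀ a, exchangeCoeff P (col y) (col (x a)) (pos y) (pos (x a)) = β (z a) := by
    intro a
    rw [exchangeCoeff, hx, hy, if_neg hi1.symm, gval, if_neg hi1]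
    simp only [hβ]; ring
  have hcs : ∀ a b : Fin 3, a ≠ b → a.castSucc ≠ b.castSucc := fun a b hab h =>
    hab (Fin.castSucc_injective 3 h)
  have hcl : ∀ a : Fin 3, a.castSucc ≠ Fin.last 3 := fun a => (Fin.castSucc_lt_last a).ne
  set t := P.q₂ + 1 + P.q₂⁻¹ with ht
  set F : ℂ → ℂ → ℂ → ℂ := fun a b c => P.q₁ * P.q₃ * (α a * α b * α c - β a * β b * β c) -
      (1 + P.q₁ * P.q₃ + (P.q₁ * P.q₃) ^ 2) * (α a * α b * β c - α a * β b * β c) with hF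
  have hq := P.q₁_mul_q₂_mul_q₃
  have hq₂ : P.q₂ * (P.q₁ * P.q₃) = 1 := by linear_combination hq
  have hq₂' : P.q₂⁻¹ = P.q₁ * P.q₃ := inv_eq_of_mul_eq_one_right hq₂
  have hterm : ∀ σ : Equiv.Perm (Fin 3), (X (x (σ 0)) * X (x (σ 1)) * X (x (σ 2)) * X y -
        t • (X (x (σ 0)) * X (x (σ 1)) * X y * X (x (σ 2))) +
        t • (X (x (σ 0)) * X y * X (x (σ 1)) * X (x (σ 2))) -
        X y * X (x (σ 0)) * X (x (σ 1)) * X (x (σ 2))) =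
      (e (σ 0) (σ 1) * e (σ 0) (σ 2) * e (σ 1) (σ 2) *
        (P.q₂ * F (z (σ 0)) (z (σ 1)) (z (σ 2)))) • κ := by
    intro σ
    have h01 : σ 0 ≠ σ 1 := fun h => absurd (σ.injective h) (by decide)
    have h02 : σ 0 ≠ σ 2 := fun h => absurd (σ.injective h) (by decide)
    have h12 : σ 1 ≠ σ 2 := fun h => absurd (σ.injective h) (by decide)
    have w1 := hw _ _ _ _ (hcs _ _ h01) (hcs _ _ h02) (hcl _) (hcs _ _ h12) (hcl _) (hcl _)
    have w2 := hw _ _ _ _ (hcs _ _ h01) (hcl _) (hcs _ _ h02) (hcl _) (hcs _ _ h12) (hcl _).symm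
    have w3 := hw _ _ _ _ (hcl (σ 0)) (hcs _ _ h01) (hcs _ _ h02) (hcl _).symm (hcl _).symm
      (hcs _ _ h12)
    have w4 := hw _ _ _ _ (hcl _).symm (hcl _).symm (hcl _).symm (hcs _ _ h01) (hcs _ _ h02)
      (hcs _ _ h12)
    simp only [hL, hLy, cxx, cxy, cyx] at w1 w2 w3 w4
    rw [w1, w2, w3, w4]
    simp only [smul_smul]
    rw [← sub_smul, ← add_smul, ← sub_smul]
    congr 1
    simp only [hF, ht, hq₂']
    generalize e (σ 0) (σ 1) = e01
    generalize e (σ 0) (σ 2) = e02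
    generalize e (σ 1) (σ 2) = e12
    generalize α (z (σ 0)) = α0
    generalize α (z (σ 1)) = α1
    generalize α (z (σ 2)) = α2
    generalize β (z (σ 0)) = β0
    generalize β (z (σ 1)) = β1
    generalize β (z (σ 2)) = β2
    linear_combination (-(e01 * e02 * e12) * (α0 * α1 * α2 - β0 * β1 * β2 -
      (1 + P.q₁ * P.q₃) * (α0 * α1 * β2 - α0 * β1 * β2))) * hq₂
  rw [Finset.sum_congr rfl fun σ _ => hterm σ, ← Finset.sum_smul]
  have hid := serre_polynomial_identity (z 0) (z 1) (z 2) w (P.q₁ + P.q₃) (P.q₁ * P.q₃) α β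
    (fun _ => rfl) (fun _ => rfl) F (fun _ _ _ => rfl)
  have he' : ∀ a b, e a b = P.q₂ * (z a - P.q₁ * P.q₃ * z b) / (z a - z b) := by
    intro a b
    simp only [he]
    congr 1
    linear_combination (z b) * hq₂
  convert zero_smul ℂ κ using 2
  rw [sum_perm_three (fun a b c => e a b * e a c * e b c * (P.q₂ * F (z a) (z b) (z c)))]
  simp only [he']
  exact serre_fraction_identity P.q₂ _ F hid

end SerreSum

end Toroidal

namespace Toroidal

variable {P : Params}

/-! ### Finite sums of delta functions -/

/-- Triples as functions on `Fin 3`. -/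
def tripleEquiv (T : Type*) : (Fin 3 → T) ≃ T × T × T where
  toFun x := (x 0, x 1, x 2)
  invFun t := ![t.1, t.2.1, t.2.2]
  left_inv x := by ext a; fin_cases a <;> rfl
  right_inv _ := rfl

lemma sum_triple {M T : Type*} [AddCommMonoid M] [Fintype T] (H : T → T → T → M) :
    ∑ a, ∑ b, ∑ c, H a b c = ∑ x : Fin 3 → T, H (x 0) (x 1) (x 2) := by
  rw [Fintype.sum_equiv (tripleEquiv T) (fun x => H (x 0) (x 1) (x 2))
    (fun t => H t.1 t.2.1 t.2.2) fun _ => rfl, Fintype.sum_prod_type]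
  exact Finset.sum_congr rfl fun a _ =>
    (Fintype.sum_prod_type fun t : T × T => H a t.1 t.2).symm

section Currents

variable {A : Type*} [Ring A] [Algebra ℂ A]

lemma mulG_add (i j : ZMod 2) (T U : ℤ → ℤ → A) (m n : ℤ) :
    mulG P i j (fun a b => T a b + U a b) m n = mulG P i j T m n + mulG P i j U m n := by
  unfold mulG
  split_ifs <;> module

lemma mulG_zero (i j : ZMod 2) (m n : ℤ) :
    mulG P i j (fun _ _ => (0 : A)) m n = 0 := by
  unfold mulG
  split_ifs <;> simp

lemma mulG_sum {κ : Type*} (s : Finset κ) (i j : ZMod 2) (T : κ → ℤ → ℤ → A) (m n : ℤ) :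
    mulG P i j (fun a b => ∑ u ∈ s, T u a b) m n = ∑ u ∈ s, mulG P i j (T u) m n := by
  classical
  induction s using Finset.induction_on with
  | empty => simp [mulG_zero]
  | insert u s hu ih =>
    simp only [Finset.sum_insert hu]
    rw [mulG_add, ih]

/-- Multiplication of `δ(z/x) δ(w/y)` by the structure function. -/
lemma mulG_zpow (i j : ZMod 2) {x y : ℂ} (hx : x ≠ 0) (hy : y ≠ 0) (M : A) (m n : ℤ) :
    mulG P i j (fun a b => (x ^ a * y ^ b) • M) m n =
      (x ^ m * y ^ n * gval P i j x y) • M := by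
  unfold mulG gval
  split_ifs
  · simp only [smul_smul, ← sub_smul]
    congr 1
    rw [zpow_add_one₀ hx, zpow_add_one₀ hy]
    ring
  · simp only [smul_smul, ← sub_smul, ← add_smul]
    congr 1
    rw [zpow_add_one₀ hx, zpow_add_one₀ hy, zpow_add₀ hx, zpow_add₀ hy]
    norm_cast
    ring

variable {ι : Type*}

/-- The coefficient of `z ^ (-k)` in `∑ δ(z / pos b) X b`, where `b` runs over the letters of
color `i` in a finite set. -/
def current (col : ι → ZMod 2) (pos : ι → ℂ) (X : ι → A) (s : Finset ι) (i : ZMod 2) (k : ℤ) : A :=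
  ∑ b ∈ s with col b = i, pos b ^ k • X b

variable {col : ι → ZMod 2} {pos : ι → ℂ} {X : ι → A} (s : Finset ι)

lemma current_mul_current (Y : ι → A) (i j : ZMod 2) (m n : ℤ) :
    current col pos X s i m * current col pos Y s j n =
      ∑ b ∈ s with col b = i, ∑ c ∈ s with col c = j, (pos b ^ m * pos c ^ n) • (X b * Y c) := by
  unfold current
  rw [Finset.sum_mul_sum]
  refine Finset.sum_congr rfl fun b _ => Finset.sum_congr rfl fun c _ => ?_
  rw [smul_mul_smul_comm]

lemma IsLetterFamily.exchange_current (hX : IsLetterFamily P col pos X) (i j : ZMod 2) (m n : ℤ) :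
    Toroidal.exchange P i j (current col pos X s i) (current col pos X s j) m n = 0 := by
  unfold Toroidal.exchange
  have e1 : ∀ a b, current col pos X s i a * current col pos X s j b =
      ∑ u ∈ s with col u = i, ∑ v ∈ s with col v = j, (pos u ^ a * pos v ^ b) • (X u * X v) :=
    fun a b => current_mul_current s X i j a b
  have e2 : ∀ b a, current col pos X s j b * current col pos X s i a =
      ∑ u ∈ s with col u = i, ∑ v ∈ s with col v = j, (pos v ^ b * pos u ^ a) • (X v * X u) := by
    intro b a
    rw [current_mul_current, Finset.sum_comm]
  simp only [e1, e2, mulG_sum]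
  rw [Finset.smul_sum, ← Finset.sum_add_distrib]
  refine Finset.sum_eq_zero fun u hu => ?_
  rw [Finset.smul_sum, ← Finset.sum_add_distrib]
  refine Finset.sum_eq_zero fun v hv => ?_
  rw [mulG_zpow _ _ (hX.pos_ne_zero _) (hX.pos_ne_zero _),
    mulG_zpow _ _ (hX.pos_ne_zero _) (hX.pos_ne_zero _)]
  have h := hX.exchange u v
  rw [(Finset.mem_filter.1 hu).2, (Finset.mem_filter.1 hv).2] at h
  have h2 := congrArg (fun x => (pos u ^ m * pos v ^ n) • x) h
  simp only [smul_add, smul_zero, smul_smul] at h2 ⊢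
  rw [← h2]
  congr 2 <;> ring

/-- The multilinear expression whose symmetrization in the first three arguments is the Serre
relation. -/
def serreWord (P : Params) (x₁ x₂ x₃ y : A) : A :=
  x₁ * x₂ * x₃ * y - (P.q₂ + 1 + P.q₂⁻¹) • (x₁ * x₂ * y * x₃) +
    (P.q₂ + 1 + P.q₂⁻¹) • (x₁ * y * x₂ * x₃) - y * x₁ * x₂ * x₃

lemma serreWord_sum {κ : Type*} (t : Finset κ) (u : Finset ι) (c₁ c₂ c₃ : κ → ℂ) (c : ι → ℂ)
    (Z : κ → A) (Y : ι → A) :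
    serreWord P (∑ a ∈ t, c₁ a • Z a) (∑ a ∈ t, c₂ a • Z a) (∑ a ∈ t, c₃ a • Z a)
        (∑ b ∈ u, c b • Y b) =
      ∑ b ∈ u, ∑ a₁ ∈ t, ∑ a₂ ∈ t, ∑ a₃ ∈ t,
        (c₁ a₁ * c₂ a₂ * c₃ a₃ * c b) • serreWord P (Z a₁) (Z a₂) (Z a₃) (Y b) := by
  have l1 : ∀ x₂ x₃ y : A, serreWord P (∑ a ∈ t, c₁ a • Z a) x₂ x₃ y =
      ∑ a ∈ t, c₁ a • serreWord P (Z a) x₂ x₃ y := by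
    intro x₂ x₃ y
    simp only [serreWord, Finset.sum_mul, Finset.mul_sum, Finset.smul_sum, ← Finset.sum_sub_distrib,
      ← Finset.sum_add_distrib, smul_mul_assoc, mul_smul_comm]
    exact Finset.sum_congr rfl fun a _ => by module
  have l2 : ∀ x₁ x₃ y : A, serreWord P x₁ (∑ a ∈ t, c₂ a • Z a) x₃ y =
      ∑ a ∈ t, c₂ a • serreWord P x₁ (Z a) x₃ y := by
    intro x₂ x₃ y
    simp only [serreWord, Finset.sum_mul, Finset.mul_sum, Finset.smul_sum, ← Finset.sum_sub_distrib,
      ← Finset.sum_add_distrib, smul_mul_assoc, mul_smul_comm]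
    exact Finset.sum_congr rfl fun a _ => by module
  have l3 : ∀ x₁ x₂ y : A, serreWord P x₁ x₂ (∑ a ∈ t, c₃ a • Z a) y =
      ∑ a ∈ t, c₃ a • serreWord P x₁ x₂ (Z a) y := by
    intro x₂ x₃ y
    simp only [serreWord, Finset.sum_mul, Finset.mul_sum, Finset.smul_sum, ← Finset.sum_sub_distrib,
      ← Finset.sum_add_distrib, smul_mul_assoc, mul_smul_comm]
    exact Finset.sum_congr rfl fun a _ => by module
  have l4 : ∀ x₁ x₂ x₃ : A, serreWord P x₁ x₂ x₃ (∑ a ∈ u, c a • Y a) =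
      ∑ a ∈ u, c a • serreWord P x₁ x₂ x₃ (Y a) := by
    intro x₁ x₂ x₃
    simp only [serreWord, Finset.sum_mul, Finset.mul_sum, Finset.smul_sum, ← Finset.sum_sub_distrib,
      ← Finset.sum_add_distrib, smul_mul_assoc, mul_smul_comm]
    exact Finset.sum_congr rfl fun a _ => by module
  rw [l4]
  refine Finset.sum_congr rfl fun b _ => ?_
  rw [l1, Finset.smul_sum]
  refine Finset.sum_congr rfl fun a₁ _ => ?_
  rw [l2, Finset.smul_sum, Finset.smul_sum]
  refine Finset.sum_congr rfl fun a₂ _ => ?_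
  rw [l3, Finset.smul_sum, Finset.smul_sum, Finset.smul_sum]
  refine Finset.sum_congr rfl fun a₃ _ => ?_
  module

/-- Symmetrizing a sum over triples in the exponents is the same as symmetrizing in the letters. -/
lemma sum_perm_current (hX : ∀ (x : Fin 3 → ι), (∀ l, col (x l) = i) → ∀ y, col y = j →
      ∑ σ : Equiv.Perm (Fin 3), serreWord P (X (x (σ 0))) (X (x (σ 1))) (X (x (σ 2))) (X y) = 0)
    (k : Fin 3 → ℤ) (l : ℤ) :
    ∑ σ : Equiv.Perm (Fin 3), serreWord P (current col pos X s i (k (σ 0)))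
      (current col pos X s i (k (σ 1))) (current col pos X s i (k (σ 2)))
      (current col pos X s j l) = 0 := by
  unfold current
  simp only [serreWord_sum]
  rw [Finset.sum_comm]
  refine Finset.sum_eq_zero fun y hy => ?_
  have key : ∀ σ : Equiv.Perm (Fin 3),
      ∑ a₁ ∈ s with col a₁ = i, ∑ a₂ ∈ s with col a₂ = i, ∑ a₃ ∈ s with col a₃ = i,
        (pos a₁ ^ k (σ 0) * pos a₂ ^ k (σ 1) * pos a₃ ^ k (σ 2) * pos y ^ l) •
          serreWord P (X a₁) (X a₂) (X a₃) (X y) =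
      ∑ x : Fin 3 → (s.filter fun b => col b = i), ((∏ a, pos (x a) ^ k a) * pos y ^ l) •
        serreWord P (X (x (σ 0))) (X (x (σ 1))) (X (x (σ 2))) (X y) := by
    intro σ
    rw [← Finset.sum_coe_sort]
    simp only [← Finset.sum_coe_sort (s.filter fun b => col b = i)]
    rw [sum_triple (fun a₁ a₂ a₃ : (s.filter fun b => col b = i) =>
      (pos a₁ ^ k (σ 0) * pos a₂ ^ k (σ 1) * pos a₃ ^ k (σ 2) * pos y ^ l) •
          serreWord P (X a₁) (X a₂) (X a₃) (X y))]
    refine (Fintype.sum_equiv (Equiv.arrowCongr σ.symm (Equiv.refl _)) _ _ fun x => ?_).symm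
    simp only [Equiv.arrowCongr_apply, Equiv.symm_symm, Function.comp_apply, Equiv.refl_apply]
    congr 2
    rw [← Equiv.prod_comp σ, Fin.prod_univ_three]
  rw [Finset.sum_congr rfl fun σ _ => key σ, Finset.sum_comm]
  refine Finset.sum_eq_zero fun x _ => ?_
  rw [← Finset.smul_sum, hX (fun a => x a) (fun a => (Finset.mem_filter.1 (x a).2).2) y
    (Finset.mem_filter.1 hy).2, smul_zero]

lemma IsLetterFamily.serre_current (hX : IsLetterFamily P col pos X) (hP : P.Generic)
    (i : ZMod 2) (k : Fin 3 → ℤ) (l : ℤ) :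
    Toroidal.serre P (current col pos X s i) (current col pos X s (i + 1)) k l = 0 := by
  rw [Toroidal.serre, sum_qComm_eq P (fun a => current col pos X s i (k a))]
  have := sum_perm_current (P := P) (col := col) (pos := pos) (X := X) s (i := i) (j := i + 1)
    (fun x hx y hy => hX.serre hP i x hx y hy) k l
  unfold serreWord at this
  rw [this, smul_zero]

/-! The same relations for families of elements that multiply in the opposite order. -/

lemma op_current (i : ZMod 2) (k : ℤ) :
    MulOpposite.op (current col pos X s i k) =
      current col pos (fun b => MulOpposite.op (X b)) s i k := by
  simp only [current, Finset.op_sum, MulOpposite.op_smul]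

lemma exchange'_current (hX : IsLetterFamily P col pos fun b => MulOpposite.op (X b))
    (i j : ZMod 2) (m n : ℤ) :
    Toroidal.exchange' P i j (current col pos X s i) (current col pos X s j) m n = 0 := by
  have h := hX.exchange_current s i j m n
  have e : MulOpposite.op
      (Toroidal.exchange' P i j (current col pos X s i) (current col pos X s j) m n) =
      sgn i j • Toroidal.exchange P i j (current col pos (fun b => MulOpposite.op (X b)) s i)
        (current col pos (fun b => MulOpposite.op (X b)) s j) m n := by
    have hs : sgn i j * sgn i j = 1 := by unfold sgn; split_ifs <;> norm_num
    rw [Toroidal.exchange, smul_add, smul_smul, hs, one_smul]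
    simp only [Toroidal.exchange', ← op_current, ← MulOpposite.op_mul, mulG]
    split_ifs <;>
    simp only [← MulOpposite.op_smul, ← MulOpposite.op_sub, ← MulOpposite.op_add] <;>
    rw [_root_.add_comm]
  rw [h, smul_zero] at e
  exact MulOpposite.op_injective e

lemma op_serreWord (x₁ x₂ x₃ y : A) : MulOpposite.op (serreWord P x₁ x₂ x₃ y) =
    -serreWord P (MulOpposite.op x₃) (MulOpposite.op x₂) (MulOpposite.op x₁)
      (MulOpposite.op y) := by
  simp only [serreWord, MulOpposite.op_sub, MulOpposite.op_add, MulOpposite.op_smul,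
    MulOpposite.op_mul, ← mul_assoc]
  module

lemma serre_current_of_op (hX : IsLetterFamily P col pos fun b => MulOpposite.op (X b))
    (hP : P.Generic) (i : ZMod 2) (k : Fin 3 → ℤ) (l : ℤ) :
    Toroidal.serre P (current col pos X s i) (current col pos X s (i + 1)) k l = 0 := by
  rw [Toroidal.serre, sum_qComm_eq P (fun a => current col pos X s i (k a))]
  have := sum_perm_current (P := P) (col := col) (pos := pos) (X := X) s (i := i) (j := i + 1)
    (fun x hx y hy => by
      refine MulOpposite.op_injective ?_
      rw [Finset.op_sum, MulOpposite.op_zero]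
      simp only [op_serreWord]
      rw [Finset.sum_neg_distrib, neg_eq_zero,
        ← (hX.serre hP i x hx y hy : _ = (0 : Aᵐᵒᵖ))]
      refine Fintype.sum_equiv (Equiv.mulRight (Equiv.swap 0 2)) _ _ fun σ => ?_
      rw [serreWord]
      have h1 : (Equiv.swap (0 : Fin 3) 2) 1 = 1 := by decide
      simp [h1]) k l
  unfold serreWord at this
  rw [this, smul_zero]

end Currents

end Toroidal

namespace Toroidal

variable {P : Params}

namespace BoxSystem

variable {B : BoxSystem P} {S : Set B.State} {Ψ : ZMod 2 → RatFunc ℂ}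

/-! ### The coefficients of the action -/

/-- The value of the affine root of the box `b` at the box `c`. -/
def rootValue (b c : B.boxes) : ℂ := value (boxRoot b c.1.color) (c.1.position P)

lemma sgn_mul_self (i j : ZMod 2) : sgn i j * sgn i j = 1 := by
  unfold sgn; split_ifs <;> norm_num

lemma sgn_comm (i j : ZMod 2) : sgn i j = sgn j i := by
  unfold sgn; simp only [eq_comm]

lemma rootValue_eq {b c : B.boxes} (h : ¬ Edge c b) :
    rootValue b c = -sgn b.1.color c.1.color *
      gval P b.1.color c.1.color (b.1.position P) (c.1.position P) /
        gval P c.1.color b.1.color (c.1.position P) (b.1.position P) :=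
  value_rootA _ _ h

/-- The root of a box takes the value `-1` at the box itself, which is the source of the sign in the
commutator of `E` and `F`. -/
lemma rootValue_self (hP : P.Generic) (b : B.boxes) : rootValue b b = -1 := by
  have h := gval_self_ne_zero hP b.1.color (Box.position_ne_zero (P := P) b.1)
  rw [rootValue_eq h, sgn, if_pos rfl]
  field_simp

lemma rootValue_mul_swap {b c : B.boxes} (h : ¬ Edge b c) (h' : ¬ Edge c b) :
    rootValue b c * rootValue c b = 1 := by
  rw [rootValue_eq h, rootValue_eq h', sgn_comm c.1.color]
  have hs := sgn_mul_self b.1.color c.1.color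
  unfold Edge at h h'
  field_simp
  linear_combination hs

lemma residue_mul_div_X {f g : RatFunc ℂ} {a : ℂ} (ha : a ≠ 0) (hf0 : f ≠ 0) (hg0 : g ≠ 0)
    (hf : -1 ≤ ordAt a f) (hg : 0 ≤ ordAt a g) :
    residue (f * g / RatFunc.X) a = residue (f / RatFunc.X) a * value g a := by
  rw [residue_div_X ha (mul_ne_zero hf0 hg0) (by rw [ordAt_mul a hf0 hg0]; omega),
    residue_div_X ha hf0 hf, residue_mul hf0 hg0 hf hg]
  ring

lemma aCoeff_of_positive {b : B.boxes} (hb : b ∈ B.positive) (s : B.State) :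
    B.aCoeff Ψ s b = value (B.weightGT Ψ s b b.1.color) (b.1.position P) := if_pos hb

lemma aCoeff_of_negative {b : B.boxes} (hb : b ∉ B.positive) (s : B.State) :
    B.aCoeff Ψ s b = -1 / (P.q - P.q⁻¹) *
      residue (B.weightGT Ψ s b b.1.color / RatFunc.X) (b.1.position P) := if_neg hb

lemma bCoeff_of_positive {b : B.boxes} (hb : b ∈ B.positive) (s : B.State) :
    B.bCoeff Ψ s b = 1 / (P.q - P.q⁻¹) *
      residue (B.weightLT Ψ s b b.1.color / RatFunc.X) (b.1.position P) := if_pos hb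

lemma bCoeff_of_negative {b : B.boxes} (hb : b ∉ B.positive) (s : B.State) :
    B.bCoeff Ψ s b = value (B.weightLT Ψ s b b.1.color) (b.1.position P) := if_neg hb

lemma aCoeff_remove_self {s : B.State} {b : B.boxes} (h : Occ s b) :
    B.aCoeff Ψ (B.remove s b) b = B.aCoeff Ψ s b := by
  unfold aCoeff
  rw [weightGT_remove h, if_neg (lt_irrefl b), mul_one]

lemma bCoeff_remove_self {s : B.State} {b : B.boxes} (h : Occ s b) :
    B.bCoeff Ψ (B.remove s b) b = B.bCoeff Ψ s b := by
  unfold bCoeff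
  rw [weightLT_remove h, if_neg (lt_irrefl b), mul_one]

namespace Admissible

variable (h : Admissible S Ψ)
include h

lemma aCoeff_ne_zero {s : B.State} (hs : s ∈ S) {b : B.boxes}
    (hb : b ∈ B.concave S s ∨ b ∈ B.convex S s) : B.aCoeff Ψ s b ≠ 0 := by
  have hp := Box.position_ne_zero (P := P) b.1
  have h0 := h.weightGT_ne_zero s b b.1.color
  by_cases hbp : b ∈ B.positive
  · rw [aCoeff_of_positive hbp]
    exact value_ne_zero h0 (h.ordAt_of_positive hs hbp hb).2
  · have ho := (h.ordAt_of_negative hs hbp hb).2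
    rw [aCoeff_of_negative hbp, residue_div_X hp h0 ho.ge]
    exact mul_ne_zero (div_ne_zero (by norm_num) h.generic.q_sub_inv_ne_zero)
      (div_ne_zero (residue_ne_zero h0 ho) hp)

lemma bCoeff_ne_zero {s : B.State} (hs : s ∈ S) {b : B.boxes}
    (hb : b ∈ B.concave S s ∨ b ∈ B.convex S s) : B.bCoeff Ψ s b ≠ 0 := by
  have hp := Box.position_ne_zero (P := P) b.1
  have h0 := h.weightLT_ne_zero s b b.1.color
  by_cases hbp : b ∈ B.positive
  · have ho := (h.ordAt_of_positive hs hbp hb).1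
    rw [bCoeff_of_positive hbp, residue_div_X hp h0 ho.ge]
    exact mul_ne_zero (div_ne_zero (by norm_num) h.generic.q_sub_inv_ne_zero)
      (div_ne_zero (residue_ne_zero h0 ho) hp)
  · rw [bCoeff_of_negative hbp]
    exact value_ne_zero h0 (h.ordAt_of_negative hs hbp hb).1

/-- Freeing a box `c` changes the coefficient at `b` by the value of the root of `c`, if `c` is
above `b`, and not at all otherwise. -/
lemma aCoeff_remove {s : B.State} (hs : s ∈ S) {b c : B.boxes}
    (hb : b ∈ B.concave S s ∨ b ∈ B.convex S s) (hc : Occ s c) (hcb : boxOrd c b = 0) :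
    B.aCoeff Ψ (B.remove s c) b = B.aCoeff Ψ s b * if b < c then rootValue c b else 1 := by
  have hp := Box.position_ne_zero (P := P) b.1
  have h0 := h.weightGT_ne_zero s b b.1.color
  by_cases hbp : b ∈ B.positive
  · rw [aCoeff_of_positive hbp, aCoeff_of_positive hbp, weightGT_remove hc]
    split_ifs
    · exact value_mul (h.ordAt_of_positive hs hbp hb).2.ge hcb.ge
    · rw [mul_one, mul_one]
  · rw [aCoeff_of_negative hbp, aCoeff_of_negative hbp, weightGT_remove hc]
    split_ifs
    · rw [residue_mul_div_X hp h0 (boxRoot_ne_zero _ _) (h.ordAt_of_negative hs hbp hb).2.ge hcb.ge,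
        mul_assoc]
      rfl
    · rw [mul_one, mul_one]

/-- Freeing a box `c` changes the coefficient at `b` by the value of the root of `c`, if `c` is
below `b`, and not at all otherwise. -/
lemma bCoeff_remove {s : B.State} (hs : s ∈ S) {b c : B.boxes}
    (hb : b ∈ B.concave S s ∨ b ∈ B.convex S s) (hc : Occ s c) (hcb : boxOrd c b = 0) :
    B.bCoeff Ψ (B.remove s c) b = B.bCoeff Ψ s b * if c < b then rootValue c b else 1 := by
  have hp := Box.position_ne_zero (P := P) b.1
  have h0 := h.weightLT_ne_zero s b b.1.color
  by_cases hbp : b ∈ B.positive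
  · rw [bCoeff_of_positive hbp, bCoeff_of_positive hbp, weightLT_remove hc]
    split_ifs
    · rw [residue_mul_div_X hp h0 (boxRoot_ne_zero _ _) (h.ordAt_of_positive hs hbp hb).1.ge hcb.ge,
        mul_assoc]
      rfl
    · rw [mul_one, mul_one]
  · rw [bCoeff_of_negative hbp, bCoeff_of_negative hbp, weightLT_remove hc]
    split_ifs
    · exact value_mul (h.ordAt_of_negative hs hbp hb).1.ge hcb.ge
    · rw [mul_one, mul_one]

open Classical in
/-- The residue of the weight at a concave or convex box is, up to sign, the product of the two
coefficients which belong to the box: the weight is the product of its two parts and, possibly,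
of the root of the box itself, which has the value `-1` there. -/
lemma residue_weight {s : B.State} (hs : s ∈ S) {b : B.boxes}
    (hb : b ∈ B.concave S s ∨ b ∈ B.convex S s) :
    (P.q - P.q⁻¹)⁻¹ * residue (B.weight Ψ s b.1.color / RatFunc.X) (b.1.position P) =
      (if Occ s b then -1 else 1) * (B.aCoeff Ψ s b * B.bCoeff Ψ s b) := by
  have hp := Box.position_ne_zero (P := P) b.1
  have hL := h.weightLT_ne_zero s b b.1.color
  have hG := h.weightGT_ne_zero s b b.1.color
  have hq := h.generic.q_sub_inv_ne_zero
  have ho : ordAt (b.1.position P) (boxRoot b b.1.color) = 0 := boxOrd_self h.generic b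
  have hr : value (boxRoot b b.1.color) (b.1.position P) = -1 := rootValue_self h.generic b
  have h1 : ordAt (b.1.position P) (1 : RatFunc ℂ) = 0 :=
    ordAt_eq_zero_of_value_ne_zero (by simp [value])
  have hF0 : (if b ∈ s then B.factor b b.1.color else 1) ≠ 0 := by
    split_ifs
    · exact factor_ne_zero _ _
    · exact one_ne_zero
  have hF : ordAt (b.1.position P) (if b ∈ s then B.factor b b.1.color else 1) = 0 ∧
      value (if b ∈ s then B.factor b b.1.color else 1) (b.1.position P) =
        if b ∈ s then -1 else 1 := by
    split_ifs
    · unfold factor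
      split_ifs
      · constructor
        · exact (ordAt_inv _ (boxRoot_ne_zero b _)).trans (neg_eq_zero.2 ho)
        · exact (value_inv (boxRoot_ne_zero b _) ho).trans (by rw [hr]; norm_num)
      · exact ⟨ho, hr⟩
    · exact ⟨h1, by simp [value]⟩
  rw [weight_eq_mul s b]
  by_cases hbp : b ∈ B.positive
  · obtain ⟨o1, o2⟩ := h.ordAt_of_positive hs hbp hb
    rw [residue_mul_div_X hp (mul_ne_zero hL hG) hF0 (by rw [ordAt_mul _ hL hG]; omega) hF.1.ge,
      residue_mul_div_X hp hL hG o1.ge o2.ge, hF.2, aCoeff_of_positive hbp, bCoeff_of_positive hbp]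
    simp only [Occ, hbp, iff_true]
    ring
  · obtain ⟨o1, o2⟩ := h.ordAt_of_negative hs hbp hb
    rw [residue_mul_div_X hp (mul_ne_zero hL hG) hF0 (by rw [ordAt_mul _ hL hG]; omega) hF.1.ge,
      mul_comm (B.weightLT Ψ s b _),
      residue_mul_div_X hp hG hL o2.ge o1.ge, hF.2, aCoeff_of_negative hbp, bCoeff_of_negative hbp]
    simp only [Occ, hbp, iff_false]
    split_ifs <;> ring

end Admissible

/-! ### Operators adding and removing a single box -/

open Classical in
variable (S) in
/-- The basis vector of a state, or zero for a state outside of `S`. -/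
def vec (s : B.State) : B.Space S := if hs : s ∈ S then B.ket S s hs else 0

lemma vec_of_mem {s : B.State} (hs : s ∈ S) : vec S s = B.ket S s hs := dif_pos hs

lemma vec_of_notMem {s : B.State} (hs : s ∉ S) : vec S s = 0 := dif_neg hs

lemma end_ext {T U : Module.End ℂ (B.Space S)} (h : ∀ s ∈ S, T (vec S s) = U (vec S s)) :
    T = U := by
  refine Finsupp.lhom_ext' fun s => LinearMap.ext_ring ?_
  have := h s.1 s.2
  rw [vec_of_mem s.2] at this
  exact this

open Classical in
variable (S Ψ) in
/-- The operator which removes the box `b`, with the coefficient of the current `E`. -/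
def eOp (b : B.boxes) : Module.End ℂ (B.Space S) :=
  Finsupp.linearCombination ℂ fun s : S =>
    if Occ s.1 b then B.bCoeff Ψ s.1 b • vec S (B.remove s.1 b) else 0

open Classical in
variable (S Ψ) in
/-- The operator which adds the box `b`, with the coefficient of the current `F`. -/
def fOp (b : B.boxes) : Module.End ℂ (B.Space S) :=
  Finsupp.linearCombination ℂ fun s : S =>
    if Occ s.1 b then 0 else B.aCoeff Ψ s.1 b • vec S (B.add s.1 b)

open Classical in
lemma eOp_vec {s : B.State} (hs : s ∈ S) (b : B.boxes) : eOp S Ψ b (vec S s) =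
    if b ∈ B.convex S s then B.bCoeff Ψ s b • vec S (B.remove s b) else 0 := by
  rw [vec_of_mem hs, ket, eOp, Finsupp.linearCombination_single, one_smul]
  by_cases hr : B.remove s b ∈ S
  · simp only [mem_convex, hr, and_true]
  · rw [vec_of_notMem hr]; simp

open Classical in
lemma fOp_vec {s : B.State} (hs : s ∈ S) (b : B.boxes) : fOp S Ψ b (vec S s) =
    if b ∈ B.concave S s then B.aCoeff Ψ s b • vec S (B.add s b) else 0 := by
  rw [vec_of_mem hs, ket, fOp, Finsupp.linearCombination_single, one_smul]
  by_cases hr : B.add s b ∈ S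
  · simp only [mem_concave, hr, and_true, ite_not]
  · rw [vec_of_notMem hr]; simp

lemma eOp_vec_of_mem {s : B.State} (hs : s ∈ S) {b : B.boxes} (hb : b ∈ B.convex S s) :
    eOp S Ψ b (vec S s) = B.bCoeff Ψ s b • vec S (B.remove s b) := by
  rw [eOp_vec hs, if_pos hb]

lemma eOp_vec_of_notMem {s : B.State} (hs : s ∈ S) {b : B.boxes} (hb : b ∉ B.convex S s) :
    eOp S Ψ b (vec S s) = 0 := by
  rw [eOp_vec hs, if_neg hb]

lemma fOp_vec_of_mem {s : B.State} (hs : s ∈ S) {b : B.boxes} (hb : b ∈ B.concave S s) :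
    fOp S Ψ b (vec S s) = B.aCoeff Ψ s b • vec S (B.add s b) := by
  rw [fOp_vec hs, if_pos hb]

lemma fOp_vec_of_notMem {s : B.State} (hs : s ∈ S) {b : B.boxes} (hb : b ∉ B.concave S s) :
    fOp S Ψ b (vec S s) = 0 := by
  rw [fOp_vec hs, if_neg hb]

open Classical in
lemma eOp_mul_eOp_vec {s : B.State} (hs : s ∈ S) (b c : B.boxes) :
    (eOp S Ψ b * eOp S Ψ c) (vec S s) =
      if c ∈ B.convex S s ∧ b ∈ B.convex S (B.remove s c) then
        (B.bCoeff Ψ s c * B.bCoeff Ψ (B.remove s c) b) • vec S (B.remove (B.remove s c) b)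
      else 0 := by
  rw [Module.End.mul_apply]
  by_cases hc : c ∈ B.convex S s
  · rw [eOp_vec_of_mem hs hc, map_smul]
    by_cases hb : b ∈ B.convex S (B.remove s c)
    · rw [eOp_vec_of_mem hc.2 hb, if_pos ⟨hc, hb⟩, smul_smul]
    · rw [eOp_vec_of_notMem hc.2 hb, if_neg fun h => hb h.2, smul_zero]
  · rw [eOp_vec_of_notMem hs hc, map_zero, if_neg fun h => hc h.1]

open Classical in
lemma fOp_mul_fOp_vec {s : B.State} (hs : s ∈ S) (b c : B.boxes) :
    (fOp S Ψ b * fOp S Ψ c) (vec S s) =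
      if c ∈ B.concave S s ∧ b ∈ B.concave S (B.add s c) then
        (B.aCoeff Ψ s c * B.aCoeff Ψ (B.add s c) b) • vec S (B.add (B.add s c) b)
      else 0 := by
  rw [Module.End.mul_apply]
  by_cases hc : c ∈ B.concave S s
  · rw [fOp_vec_of_mem hs hc, map_smul]
    by_cases hb : b ∈ B.concave S (B.add s c)
    · rw [fOp_vec_of_mem hc.2 hb, if_pos ⟨hc, hb⟩, smul_smul]
    · rw [fOp_vec_of_notMem hc.2 hb, if_neg fun h => hb h.2, smul_zero]
  · rw [fOp_vec_of_notMem hs hc, map_zero, if_neg fun h => hc h.1]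

end BoxSystem

end Toroidal

namespace Toroidal

variable {P : Params}

namespace BoxSystem

variable {B : BoxSystem P} {S : Set B.State} {Ψ : ZMod 2 → RatFunc ℂ}

/-! ### Relations between the one-box operators -/

namespace Admissible

variable (h : Admissible S Ψ)
include h

/-- If two boxes can be removed in one order but not in the other, they are neighbours. -/
lemma edge_of_convex_remove {s : B.State} (hs : s ∈ S) {b c : B.boxes} (hc : c ∈ B.convex S s)
    (hb : b ∈ B.convex S (B.remove s c)) (hb' : b ∉ B.convex S s) : Edge b c := by
  have hco := (mem_convex.1 hc).1
  refine (h.edge_of_lost_convex hc.2 (mem_concave_remove hs hco) hb ?_).1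
  rwa [add_remove hco]

/-- The exchange relation of two one-box operators. If both orders are possible, the coefficients
are compared by means of the values of affine roots; if only one is, its coefficient in the relation is
zero because the boxes are neighbours. -/
lemma exchange_eOp (b c : B.boxes) :
    (sgn b.1.color c.1.color *
        gval P b.1.color c.1.color (b.1.position P) (c.1.position P)) •
        (eOp S Ψ b * eOp S Ψ c) +
      gval P c.1.color b.1.color (c.1.position P) (b.1.position P) •
        (eOp S Ψ c * eOp S Ψ b) = 0 := by
  classical
  refine end_ext fun s hs => ?_
  rw [LinearMap.add_apply, LinearMap.smul_apply, LinearMap.smul_apply, LinearMap.zero_apply,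
    eOp_mul_eOp_vec hs, eOp_mul_eOp_vec hs]
  by_cases hbc : b = c
  · subst hbc
    rw [if_neg fun hx => ((occ_remove s b b).1 (mem_convex.1 hx.2).1).1 rfl, smul_zero, smul_zero,
      add_zero]
  by_cases h1 : c ∈ B.convex S s ∧ b ∈ B.convex S (B.remove s c) <;>
    by_cases h2 : b ∈ B.convex S s ∧ c ∈ B.convex S (B.remove s b)
  · rw [if_pos h1, if_pos h2, remove_comm s c b, smul_smul, smul_smul, ← add_smul]
    have ho' := h.boxOrd_eq_zero_of_convex hs h2.1 h1.1
    have ho := h.boxOrd_eq_zero_of_convex hs h1.1 h2.1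
    obtain ⟨e1, e2⟩ := not_edge_of_boxOrd_eq_zero h.generic ho
    rw [h.bCoeff_remove hs (Or.inr h2.1) (mem_convex.1 h1.1).1 ho',
      h.bCoeff_remove hs (Or.inr h1.1) (mem_convex.1 h2.1).1 ho, rootValue_eq e1, rootValue_eq e2]
    have hsg := sgn_mul_self b.1.color c.1.color
    rw [sgn_comm c.1.color]
    unfold Edge at e1 e2
    convert zero_smul ℂ _ using 2
    rcases lt_or_gt_of_ne hbc with hlt | hlt
    · rw [if_neg hlt.not_gt, if_pos hlt]
      field_simp
      ring
    · rw [if_pos hlt, if_neg hlt.not_gt]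
      field_simp
      linear_combination (-B.bCoeff Ψ s c * B.bCoeff Ψ s b *
        gval P c.1.color b.1.color (c.1.position P) (b.1.position P)) * hsg
  · have e : Edge b c := by
      refine h.edge_of_convex_remove hs h1.1 h1.2 fun hb => h2 ⟨hb, ?_⟩
      exact h.convex_remove hs h1.1 hb (Ne.symm hbc)
    rw [if_neg h2, show gval P _ _ _ _ = 0 from e]
    simp
  · have e : Edge c b := by
      refine h.edge_of_convex_remove hs h2.1 h2.2 fun hc => h1 ⟨hc, ?_⟩
      exact h.convex_remove hs h2.1 hc hbc
    rw [if_neg h1, show gval P c.1.color b.1.color _ _ = 0 from e]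
    simp
  · rw [if_neg h1, if_neg h2, smul_zero, smul_zero, add_zero]

lemma eOp_mul_eOp_of_same {b c : B.boxes} (hbc : Same b c) : eOp S Ψ b * eOp S Ψ c = 0 := by
  classical
  refine end_ext fun s hs => ?_
  rw [eOp_mul_eOp_vec hs, if_neg, LinearMap.zero_apply]
  rintro ⟨h1, h2⟩
  have hco := (mem_convex.1 h1).1
  have := h.eq_of_same h1.2 (Or.inr h2) (Or.inl (mem_concave_remove hs hco)) hbc
  exact ((occ_remove s c b).1 (mem_convex.1 h2).1).1 this

lemma eOp_triangle {u v w : B.boxes} (huv : Edge u v) (hvw : Edge v w) (hwu : Edge w u) :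
    eOp S Ψ u * eOp S Ψ v * eOp S Ψ w = 0 := by
  refine end_ext fun s hs => ?_
  rw [LinearMap.zero_apply, Module.End.mul_apply]
  by_cases hw : w ∈ B.convex S s
  · rw [eOp_vec_of_mem hs hw, map_smul, Module.End.mul_apply]
    by_cases hv : v ∈ B.convex S (B.remove s w)
    · rw [eOp_vec_of_mem hw.2 hv, map_smul]
      by_cases hu : u ∈ B.convex S (B.remove (B.remove s w) v)
      · have hwo := (mem_convex.1 hw).1
        have hvo := (mem_convex.1 hv).1
        have huo := (mem_convex.1 hu).1
        refine absurd ?_ (h.not_wheel (B.remove (B.remove (B.remove s w) v) u) u v w)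
        refine ⟨hu.2, mem_concave_remove hv.2 huo, ?_, ?_, huv, hvw, hwu⟩
        · rw [add_remove huo]; exact mem_concave_remove hw.2 hvo
        · rw [add_remove huo, add_remove hvo]; exact mem_concave_remove hs hwo
      · rw [eOp_vec_of_notMem hv.2 hu, smul_zero, smul_zero]
    · rw [eOp_vec_of_notMem hw.2 hv, map_zero, smul_zero]
  · rw [eOp_vec_of_notMem hs hw, map_zero]

theorem isLetterFamily_eOp : IsLetterFamily P (fun b : B.boxes => b.1.color)
    (fun b => b.1.position P) (eOp S Ψ) where
  pos_ne_zero _ := Box.position_ne_zero _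
  exchange := h.exchange_eOp
  same _ _ h1 h2 := h.eOp_mul_eOp_of_same ⟨h1, h2⟩
  triangle _ _ _ h1 h2 h3 := h.eOp_triangle h1 h2 h3

/-- If two boxes can be added in one order but not in the other, they are neighbours. -/
lemma edge_of_concave_add {s : B.State} (hs : s ∈ S) {b c : B.boxes} (hb : b ∈ B.concave S s)
    (hc : c ∈ B.concave S (B.add s b)) (hc' : c ∉ B.concave S s) : Edge b c :=
  (h.edge_of_new_concave hs hb hc hc').1

/-- The effect of adding a box on the coefficient of another concave box. -/
lemma aCoeff_add {s : B.State} {b c : B.boxes} (hc : c ∈ B.concave S s)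
    (hb : b ∈ B.concave S (B.add s c)) (hcb : boxOrd c b = 0) :
    B.aCoeff Ψ s b = B.aCoeff Ψ (B.add s c) b * if b < c then rootValue c b else 1 := by
  have := h.aCoeff_remove hc.2 (Or.inl hb) ((occ_add s c c).2 (Or.inl rfl)) hcb
  rwa [remove_add (mem_concave.1 hc).1] at this

lemma exchange_fOp (b c : B.boxes) :
    (sgn b.1.color c.1.color *
        gval P b.1.color c.1.color (b.1.position P) (c.1.position P)) •
        (fOp S Ψ c * fOp S Ψ b) +
      gval P c.1.color b.1.color (c.1.position P) (b.1.position P) •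
        (fOp S Ψ b * fOp S Ψ c) = 0 := by
  classical
  refine end_ext fun s hs => ?_
  rw [LinearMap.add_apply, LinearMap.smul_apply, LinearMap.smul_apply, LinearMap.zero_apply,
    fOp_mul_fOp_vec hs, fOp_mul_fOp_vec hs]
  by_cases hbc : b = c
  · subst hbc
    rw [if_neg fun hx => (mem_concave.1 hx.2).1 ((occ_add s b b).2 (Or.inl rfl)), smul_zero,
      smul_zero, add_zero]
  by_cases h1 : b ∈ B.concave S s ∧ c ∈ B.concave S (B.add s b) <;>
    by_cases h2 : c ∈ B.concave S s ∧ b ∈ B.concave S (B.add s c)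
  · rw [if_pos h1, if_pos h2, add_comm s b c, smul_smul, smul_smul, ← add_smul]
    have ho' := h.boxOrd_eq_zero_of_concave hs h1.1 h2.1
    have ho := h.boxOrd_eq_zero_of_concave hs h2.1 h1.1
    obtain ⟨e1, e2⟩ := not_edge_of_boxOrd_eq_zero h.generic ho
    rw [h.aCoeff_add h2.1 h2.2 ho', h.aCoeff_add h1.1 h1.2 ho, rootValue_eq e1, rootValue_eq e2]
    have hsg := sgn_mul_self b.1.color c.1.color
    rw [sgn_comm c.1.color]
    unfold Edge at e1 e2
    convert zero_smul ℂ _ using 2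
    rcases lt_or_gt_of_ne hbc with hlt | hlt
    · rw [if_neg hlt.not_gt, if_pos hlt]
      field_simp
      linear_combination (-B.aCoeff Ψ (B.add s c) b * B.aCoeff Ψ (B.add s b) c *
        gval P c.1.color b.1.color (c.1.position P) (b.1.position P)) * hsg
    · rw [if_pos hlt, if_neg hlt.not_gt]
      field_simp
      ring
  · have e : Edge b c := by
      refine h.edge_of_concave_add hs h1.1 h1.2 fun hc => h2 ⟨hc, ?_⟩
      exact h.concave_add hs h1.1 hc hbc
    rw [if_neg h2, show gval P b.1.color c.1.color _ _ = 0 from e]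
    simp
  · have e : Edge c b := by
      refine h.edge_of_concave_add hs h2.1 h2.2 fun hb => h1 ⟨hb, ?_⟩
      exact h.concave_add hs h2.1 hb (Ne.symm hbc)
    rw [if_neg h1, show gval P c.1.color b.1.color _ _ = 0 from e]
    simp
  · rw [if_neg h1, if_neg h2, smul_zero, smul_zero, add_zero]

lemma fOp_mul_fOp_of_same {b c : B.boxes} (hbc : Same b c) : fOp S Ψ c * fOp S Ψ b = 0 := by
  classical
  refine end_ext fun s hs => ?_
  rw [fOp_mul_fOp_vec hs, if_neg, LinearMap.zero_apply]
  rintro ⟨h1, h2⟩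
  have hbo := (mem_concave.1 h1).1
  have := h.eq_of_same h1.2 (Or.inl h2) (Or.inr (mem_convex_add hs hbo)) hbc.symm
  exact (mem_concave.1 h2).1 ((occ_add s b c).2 (Or.inl this))

lemma fOp_triangle {u v w : B.boxes} (huv : Edge u v) (hvw : Edge v w) (hwu : Edge w u) :
    fOp S Ψ w * (fOp S Ψ v * fOp S Ψ u) = 0 := by
  refine end_ext fun s hs => ?_
  rw [LinearMap.zero_apply, Module.End.mul_apply, Module.End.mul_apply]
  by_cases hu : u ∈ B.concave S s
  · rw [fOp_vec_of_mem hs hu, map_smul, map_smul]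
    by_cases hv : v ∈ B.concave S (B.add s u)
    · rw [fOp_vec_of_mem hu.2 hv, map_smul]
      by_cases hw : w ∈ B.concave S (B.add (B.add s u) v)
      · exact absurd ⟨hs, hu, hv, hw, huv, hvw, hwu⟩ (h.not_wheel s u v w)
      · rw [fOp_vec_of_notMem hv.2 hw, smul_zero, smul_zero]
    · rw [fOp_vec_of_notMem hu.2 hv, map_zero, smul_zero]
  · rw [fOp_vec_of_notMem hs hu, map_zero, map_zero]

/-- The operators `fOp` are a letter family for the opposite multiplication, because boxes are added
in the reverse of the order in which they are removed. -/
theorem isLetterFamily_fOp : IsLetterFamily P (fun b : B.boxes => b.1.color)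
    (fun b => b.1.position P) (fun b => MulOpposite.op (fOp S Ψ b)) where
  pos_ne_zero _ := Box.position_ne_zero _
  exchange b c := by
    simp only [← MulOpposite.op_mul, ← MulOpposite.op_smul, ← MulOpposite.op_add,
      h.exchange_fOp b c, MulOpposite.op_zero]
  same b c h1 h2 := by
    rw [← MulOpposite.op_mul, h.fOp_mul_fOp_of_same ⟨h1, h2⟩, MulOpposite.op_zero]
  triangle u v w h1 h2 h3 := by
    rw [← MulOpposite.op_mul, ← MulOpposite.op_mul, h.fOp_triangle h1 h2 h3, MulOpposite.op_zero]

/-- Adding a box commutes with removing another one. -/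
lemma eOp_mul_fOp_of_ne {b c : B.boxes} (hbc : b ≠ c) :
    eOp S Ψ b * fOp S Ψ c = fOp S Ψ c * eOp S Ψ b := by
  refine end_ext fun s hs => ?_
  rw [Module.End.mul_apply, Module.End.mul_apply]
  -- The two intermediate states are in `S` or not at the same time.
  have key : (c ∈ B.concave S s ∧ b ∈ B.convex S (B.add s c)) ↔
      (b ∈ B.convex S s ∧ c ∈ B.concave S (B.remove s b)) := by
    constructor
    · rintro ⟨hc, hb⟩
      have hco := (mem_concave.1 hc).1
      have hb2 := h.convex_remove hc.2 hb (mem_convex_add hs hco) hbc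
      rw [remove_add hco] at hb2
      refine ⟨hb2, mem_concave.2 ⟨fun ho => hco ((occ_remove s b c).1 ho).2, ?_⟩⟩
      rw [← remove_add_comm s hbc.symm]
      exact hb.2
    · rintro ⟨hb, hc⟩
      have hbo := (mem_convex.1 hb).1
      have hc2 := h.concave_add hb.2 hc (mem_concave_remove hs hbo) (Ne.symm hbc)
      rw [add_remove hbo] at hc2
      refine ⟨hc2, mem_convex.2 ⟨(occ_add s c b).2 (Or.inr hbo), ?_⟩⟩
      rw [remove_add_comm s hbc.symm]
      exact hc.2
  by_cases h1 : c ∈ B.concave S s ∧ b ∈ B.convex S (B.add s c)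
  · have h2 := key.1 h1
    have hco := (mem_concave.1 h1.1).1
    have ho' := h.boxOrd_eq_zero_of_convex h1.1.2 h1.2 (mem_convex_add hs hco)
    have ho := h.boxOrd_eq_zero_of_convex h1.1.2 (mem_convex_add hs hco) h1.2
    obtain ⟨e1, e2⟩ := not_edge_of_boxOrd_eq_zero h.generic ho
    have hB := h.bCoeff_remove h1.1.2 (Or.inr h1.2) ((occ_add s c c).2 (Or.inl rfl)) ho'
    rw [remove_add hco] at hB
    have hA := h.aCoeff_remove hs (Or.inl h1.1) (mem_convex.1 h2.1).1 ho
    rw [fOp_vec_of_mem hs h1.1, map_smul, eOp_vec_of_mem h1.1.2 h1.2, eOp_vec_of_mem hs h2.1,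
      map_smul, fOp_vec_of_mem h2.1.2 h2.2, smul_smul, smul_smul,
      remove_add_comm s hbc.symm, hA, hB]
    congr 1
    split_ifs
    · linear_combination (-B.aCoeff Ψ s c * B.bCoeff Ψ (B.add s c) b) * rootValue_mul_swap e1 e2
    · ring
  · have h2 := mt key.2 h1
    rw [not_and] at h1 h2
    have l1 : eOp S Ψ b (fOp S Ψ c (vec S s)) = 0 := by
      by_cases hc : c ∈ B.concave S s
      · rw [fOp_vec_of_mem hs hc, map_smul, eOp_vec_of_notMem hc.2 (h1 hc), smul_zero]
      · rw [fOp_vec_of_notMem hs hc, map_zero]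
    have l2 : fOp S Ψ c (eOp S Ψ b (vec S s)) = 0 := by
      by_cases hb : b ∈ B.convex S s
      · rw [eOp_vec_of_mem hs hb, map_smul, fOp_vec_of_notMem hb.2 (h2 hb), smul_zero]
      · rw [eOp_vec_of_notMem hs hb, map_zero]
    rw [l1, l2]

open Classical in
/-- Removing and adding the same box: the commutator is given by the residue of the weight. -/
lemma commutator_vec {s : B.State} (hs : s ∈ S) (b : B.boxes) :
    (eOp S Ψ b * fOp S Ψ b - fOp S Ψ b * eOp S Ψ b) (vec S s) =
      (if b ∈ B.concave S s ∨ b ∈ B.convex S s then (P.q - P.q⁻¹)⁻¹ *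
        residue (B.weight Ψ s b.1.color / RatFunc.X) (b.1.position P) else 0) • vec S s := by
  rw [LinearMap.sub_apply, Module.End.mul_apply, Module.End.mul_apply]
  by_cases ho : Occ s b
  · have hnc : b ∉ B.concave S s := fun hc => (mem_concave.1 hc).1 ho
    rw [fOp_vec_of_notMem hs hnc, map_zero, zero_sub]
    by_cases hb : b ∈ B.convex S s
    · rw [if_pos (Or.inr hb), h.residue_weight hs (Or.inr hb), if_pos ho, eOp_vec_of_mem hs hb,
        map_smul, fOp_vec_of_mem hb.2 (mem_concave_remove hs ho), smul_smul, add_remove ho,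
        aCoeff_remove_self ho]
      module
    · rw [eOp_vec_of_notMem hs hb, map_zero, if_neg (not_or.2 ⟨hnc, hb⟩), neg_zero, zero_smul]
  · have hnc : b ∉ B.convex S s := fun hc => ho (mem_convex.1 hc).1
    rw [eOp_vec_of_notMem hs hnc, map_zero, sub_zero]
    by_cases hb : b ∈ B.concave S s
    · have hc := mem_convex_add hs ho
      have hcoef := bCoeff_remove_self (Ψ := Ψ) (mem_convex.1 hc).1
      rw [remove_add ho] at hcoef
      rw [if_pos (Or.inl hb), h.residue_weight hs (Or.inl hb), if_neg ho, fOp_vec_of_mem hs hb,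
        map_smul, eOp_vec_of_mem hb.2 hc, smul_smul, remove_add ho, ← hcoef, one_mul]
    · rw [fOp_vec_of_notMem hs hb, map_zero, if_neg (not_or.2 ⟨hb, hnc⟩), zero_smul]

end Admissible

end BoxSystem

end Toroidal

namespace Toroidal

variable {P : Params}

/-! ### The Cartan currents and their exchange relations -/

lemma mem_roots_toFinset {f : RatFunc ℂ} {a : ℂ} : a ∈ f.denom.roots.toFinset ↔ IsPole f a := by
  rw [Multiset.mem_toFinset, Polynomial.mem_roots f.denom_ne_zero]
  rfl

section Exchange

variable {A C : Type*} [Ring A] [Algebra ℂ A] [Ring C] [Algebra ℂ C]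

lemma map_mulG (φ : A →ₐ[ℂ] C) (i j : ZMod 2) (T : ℤ → ℤ → A) (m n : ℤ) :
    φ (mulG P i j T m n) = mulG P i j (fun a b => φ (T a b)) m n := by
  unfold mulG
  split_ifs <;> simp only [map_sub, map_add, map_smul]

lemma map_exchange (φ : A →ₐ[ℂ] C) (i j : ZMod 2) (X Y : ℤ → A) (m n : ℤ) :
    φ (exchange P i j X Y m n) =
      exchange P i j (fun k => φ (X k)) (fun k => φ (Y k)) m n := by
  simp only [exchange, map_add, map_smul, map_mulG, map_mul]

lemma map_exchange' (φ : A →ₐ[ℂ] C) (i j : ZMod 2) (X Y : ℤ → A) (m n : ℤ) :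
    φ (exchange' P i j X Y m n) =
      exchange' P i j (fun k => φ (X k)) (fun k => φ (Y k)) m n := by
  simp only [exchange', map_add, map_smul, map_mulG, map_mul]

lemma map_serre (φ : A →ₐ[ℂ] C) (X Y : ℤ → A) (k : Fin 3 → ℤ) (l : ℤ) :
    φ (serre P X Y k l) = serre P (fun k => φ (X k)) (fun k => φ (Y k)) k l := by
  simp only [serre, qComm, map_smul, map_sum, map_sub, map_mul]

lemma exchange_sum {κ : Type*} (s : Finset κ) (i j : ZMod 2) (X : ℤ → A) (Y : κ → ℤ → A)
    (m n : ℤ) : exchange P i j X (fun k => ∑ u ∈ s, Y u k) m n =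
      ∑ u ∈ s, exchange P i j X (Y u) m n := by
  simp only [exchange, Finset.mul_sum, Finset.sum_mul, mulG_sum, Finset.smul_sum,
    Finset.sum_add_distrib]

lemma exchange'_sum {κ : Type*} (s : Finset κ) (i j : ZMod 2) (X : ℤ → A) (Y : κ → ℤ → A)
    (m n : ℤ) : exchange' P i j X (fun k => ∑ u ∈ s, Y u k) m n =
      ∑ u ∈ s, exchange' P i j X (Y u) m n := by
  simp only [exchange', Finset.mul_sum, Finset.sum_mul, mulG_sum, Finset.smul_sum,
    Finset.sum_add_distrib]

lemma current_commutator {ι : Type*} {col : ι → ZMod 2} {pos : ι → ℂ} {X Y : ι → A}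
    (hpos : ∀ b, pos b ≠ 0) (hXY : ∀ b c, b ≠ c → X b * Y c = Y c * X b) (s : Finset ι)
    (i j : ZMod 2) (m n : ℤ) :
    current col pos X s i m * current col pos Y s j n -
        current col pos Y s j n * current col pos X s i m =
      if i = j then ∑ b ∈ s with col b = i, pos b ^ (m + n) • (X b * Y b - Y b * X b) else 0 := by
  have e2 : current col pos Y s j n * current col pos X s i m =
      ∑ b ∈ s with col b = i, ∑ c ∈ s with col c = j, (pos c ^ n * pos b ^ m) • (Y c * X b) := by
    rw [current_mul_current, Finset.sum_comm]
  rw [e2, current_mul_current, ← Finset.sum_sub_distrib]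
  have e3 : ∀ b c : ι, b ≠ c →
      (pos b ^ m * pos c ^ n) • (X b * Y c) - (pos c ^ n * pos b ^ m) • (Y c * X b) = 0 := by
    intro b c hbc
    rw [hXY b c hbc, mul_comm, sub_self]
  split_ifs with hij
  · subst hij
    refine Finset.sum_congr rfl fun b hb => ?_
    rw [← Finset.sum_sub_distrib, Finset.sum_eq_single_of_mem b hb fun c _ hcb => e3 b c hcb.symm,
      zpow_add₀ (hpos b), smul_sub, mul_comm (pos b ^ n)]
  · refine Finset.sum_eq_zero fun b hb => ?_
    rw [← Finset.sum_sub_distrib]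
    refine Finset.sum_eq_zero fun c hc => e3 b c ?_
    rintro rfl
    exact hij ((Finset.mem_filter.1 hb).2.symm.trans (Finset.mem_filter.1 hc).2)

lemma mulG_apply {V : Type*} [AddCommGroup V] [Module ℂ V] (i j : ZMod 2)
    {T : ℤ → ℤ → Module.End ℂ V} {t : ℤ → ℤ → ℂ} {v w : V} (hT : ∀ a b, T a b v = t a b • w)
    (m n : ℤ) : mulG P i j T m n v = mulG P i j t m n • w := by
  unfold mulG
  split_ifs <;> simp only [LinearMap.sub_apply, LinearMap.add_apply, LinearMap.smul_apply, hT,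
    smul_eq_mul] <;> module

/-- The exchange relation between a Cartan current and `δ(w/p)`, when the passage changes the
eigenvalue by an affine root. -/
lemma IsExpansion.exchange {c : RatFunc ℂ → ℤ → ℂ} (hc : IsExpansion c) (i j : ZMod 2) {p : ℂ}
    (hp : p ≠ 0) (φ : RatFunc ℂ) (m n : ℤ) :
    sgn i j * mulG P i j (fun a b => c (φ * rootA P j p i) a * p ^ b) m n +
      mulG P j i (fun b a => c φ a * p ^ b) n m = 0 := by
  unfold mulG sgn rootA
  by_cases hij : i = j
  · rw [if_pos hij, if_pos hij, if_pos hij.symm, if_pos hij.symm]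
    have key : (RatFunc.X - RatFunc.C (P.q₂ * p)) * (φ * ((RatFunc.C P.q₂ * RatFunc.X -
        RatFunc.C p) / (RatFunc.X - RatFunc.C (P.q₂ * p)))) =
        (RatFunc.C P.q₂ * RatFunc.X - RatFunc.C p) * φ := by
      have := X_sub_C_ne_zero (P.q₂ * p)
      field_simp
    have h2 := congrArg (fun f => c f m) key
    simp only [hc.X_sub_C_mul, hc.C_mul_X_sub_C_mul] at h2
    simp only [smul_eq_mul, zpow_add_one₀ hp]
    linear_combination p ^ n * h2
  · rw [if_neg hij, if_neg hij, if_neg (Ne.symm hij), if_neg (Ne.symm hij)]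
    have key : (RatFunc.X - RatFunc.C (P.q₁ * p)) * ((RatFunc.X - RatFunc.C (P.q₃ * p)) *
        (φ * (((RatFunc.C P.q₁ * RatFunc.X - RatFunc.C p) *
          (RatFunc.C P.q₃ * RatFunc.X - RatFunc.C p)) / ((RatFunc.X - RatFunc.C (P.q₁ * p)) *
          (RatFunc.X - RatFunc.C (P.q₃ * p)))))) =
        (RatFunc.C P.q₁ * RatFunc.X - RatFunc.C p) *
          ((RatFunc.C P.q₃ * RatFunc.X - RatFunc.C p) * φ) := by
      have cancel : ∀ u v N : RatFunc ℂ, u ≠ 0 → v ≠ 0 → u * (v * (φ * (N / (u * v)))) = N * φ :=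
        fun u v N hu hv => by field_simp
      rw [cancel _ _ _ (X_sub_C_ne_zero _) (X_sub_C_ne_zero _), mul_assoc]
    have h2 := congrArg (fun f => c f m) key
    simp only [hc.X_sub_C_mul, hc.C_mul_X_sub_C_mul] at h2
    have e2 : ∀ a : ℤ, a + 2 = a + 1 + 1 := fun a => by ring
    simp only [smul_eq_mul, e2, zpow_add_one₀ hp]
    linear_combination -p ^ n * h2

end Exchange

namespace BoxSystem

variable {B : BoxSystem P} {S : Set B.State} {Ψ : ZMod 2 → RatFunc ℂ}

variable (S Ψ) in
/-- The coefficient of `z ^ (-m)` of a Cartan current. Its eigenvalues are the coefficients of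
the weights in the expansion `c`. -/
def cartan (c : RatFunc ℂ → ℤ → ℂ) (i : ZMod 2) (m : ℤ) : Module.End ℂ (B.Space S) :=
  Finsupp.linearCombination ℂ fun s : S => c (B.weight Ψ s.1 i) m • vec S s.1

lemma cartan_vec (c : RatFunc ℂ → ℤ → ℂ) (i : ZMod 2) (m : ℤ) {s : B.State} (hs : s ∈ S) :
    cartan S Ψ c i m (vec S s) = c (B.weight Ψ s i) m • vec S s := by
  conv_lhs => rw [vec_of_mem hs, ket, cartan, Finsupp.linearCombination_single, one_smul]

lemma cartan_mul_comm (c c' : RatFunc ℂ → ℤ → ℂ) (i j : ZMod 2) (m n : ℤ) :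
    cartan S Ψ c i m * cartan S Ψ c' j n = cartan S Ψ c' j n * cartan S Ψ c i m := by
  refine end_ext fun s hs => ?_
  simp only [Module.End.mul_apply, cartan_vec _ _ _ hs, map_smul, smul_smul]
  rw [mul_comm]

lemma exchange_cartan_eOp {c : RatFunc ℂ → ℤ → ℂ} (hc : IsExpansion c) (i : ZMod 2)
    (b : B.boxes) (m n : ℤ) :
    exchange P i b.1.color (cartan S Ψ c i) (fun k => b.1.position P ^ k • eOp S Ψ b) m n = 0 := by
  refine end_ext fun s hs => ?_
  have hp := Box.position_ne_zero (P := P) b.1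
  rw [exchange, LinearMap.add_apply, LinearMap.smul_apply, LinearMap.zero_apply]
  by_cases hb : b ∈ B.convex S s
  · have hb' := hb.2
    rw [mulG_apply _ _ (t := fun k l => c (B.weight Ψ s i * rootA P b.1.color (b.1.position P) i) k
        * b.1.position P ^ l) (w := B.bCoeff Ψ s b • vec S (B.remove s b)),
      mulG_apply _ _ (t := fun l k => c (B.weight Ψ s i) k * b.1.position P ^ l)
        (w := B.bCoeff Ψ s b • vec S (B.remove s b)), smul_smul, ← add_smul,
      hc.exchange i _ hp, zero_smul]
    · intro l k
      rw [Module.End.mul_apply, cartan_vec _ _ _ hs, map_smul, LinearMap.smul_apply,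
        eOp_vec_of_mem hs hb, smul_smul]
    · intro k l
      rw [Module.End.mul_apply, LinearMap.smul_apply, eOp_vec_of_mem hs hb, map_smul, map_smul,
        cartan_vec _ _ _ hb', weight_remove (mem_convex.1 hb).1, smul_smul, smul_smul, smul_smul]
      congr 1
      unfold boxRoot
      ring
  · rw [mulG_apply _ _ (t := fun _ _ => 0) (w := 0), mulG_apply _ _ (t := fun _ _ => 0) (w := 0)]
    · simp
    · intro l k
      rw [Module.End.mul_apply, cartan_vec _ _ _ hs, map_smul, LinearMap.smul_apply,
        eOp_vec_of_notMem hs hb]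
      simp
    · intro k l
      rw [Module.End.mul_apply, LinearMap.smul_apply, eOp_vec_of_notMem hs hb]
      simp

lemma exchange'_cartan_fOp {c : RatFunc ℂ → ℤ → ℂ} (hc : IsExpansion c) (i : ZMod 2)
    (b : B.boxes) (m n : ℤ) :
    exchange' P i b.1.color (cartan S Ψ c i) (fun k => b.1.position P ^ k • fOp S Ψ b) m n = 0 := by
  refine end_ext fun s hs => ?_
  have hp := Box.position_ne_zero (P := P) b.1
  rw [exchange', LinearMap.add_apply, LinearMap.smul_apply, LinearMap.zero_apply]
  by_cases hb : b ∈ B.concave S s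
  · have hb' := hb.2
    have hw := weight_remove (Ψ := Ψ) ((occ_add s b b).2 (Or.inl rfl)) i
    rw [remove_add (mem_concave.1 hb).1] at hw
    rw [mulG_apply _ _ (t := fun l k => c (B.weight Ψ (B.add s b) i) k * b.1.position P ^ l)
        (w := B.aCoeff Ψ s b • vec S (B.add s b)),
      mulG_apply _ _ (t := fun k l => c (B.weight Ψ (B.add s b) i *
        rootA P b.1.color (b.1.position P) i) k * b.1.position P ^ l)
        (w := B.aCoeff Ψ s b • vec S (B.add s b)), smul_smul, ← add_smul]
    · convert zero_smul ℂ _ using 2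
      linear_combination sgn i b.1.color * hc.exchange i b.1.color hp (B.weight Ψ (B.add s b) i)
        (P := P) m n - mulG P i b.1.color (fun k l => c (B.weight Ψ (B.add s b) i *
        rootA P b.1.color (b.1.position P) i) k * b.1.position P ^ l) m n *
        sgn_mul_self i b.1.color
    · intro k l
      rw [Module.End.mul_apply, cartan_vec _ _ _ hs, map_smul, LinearMap.smul_apply,
        fOp_vec_of_mem hs hb, smul_smul, hw]
      rfl
    · intro l k
      rw [Module.End.mul_apply, LinearMap.smul_apply, fOp_vec_of_mem hs hb, map_smul, map_smul,
        cartan_vec _ _ _ hb', smul_smul, smul_smul, smul_smul]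
      congr 1
      ring
  · rw [mulG_apply _ _ (t := fun _ _ => 0) (w := 0), mulG_apply _ _ (t := fun _ _ => 0) (w := 0)]
    · simp
    · intro l k
      rw [Module.End.mul_apply, cartan_vec _ _ _ hs, map_smul, LinearMap.smul_apply,
        fOp_vec_of_notMem hs hb]
      simp
    · intro k l
      rw [Module.End.mul_apply, LinearMap.smul_apply, fOp_vec_of_notMem hs hb]
      simp

variable (S Ψ) in
/-- The part of a mode of the current `E` which removes boxes of the finite set `s`. -/
abbrev eCurrent (s : Finset B.boxes) (i : ZMod 2) (k : ℤ) : Module.End ℂ (B.Space S) :=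
  current (fun b : B.boxes => b.1.color) (fun b => b.1.position P) (eOp S Ψ) s i k

variable (S Ψ) in
/-- The part of a mode of the current `F` which adds boxes of the finite set `s`. -/
abbrev fCurrent (s : Finset B.boxes) (i : ZMod 2) (k : ℤ) : Module.End ℂ (B.Space S) :=
  current (fun b : B.boxes => b.1.color) (fun b => b.1.position P) (fOp S Ψ) s i k

lemma exchange_cartan_eCurrent {c : RatFunc ℂ → ℤ → ℂ} (hc : IsExpansion c) (i j : ZMod 2)
    (s : Finset B.boxes) (m n : ℤ) :
    exchange P i j (cartan S Ψ c i) (eCurrent S Ψ s j) m n = 0 := by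
  refine (exchange_sum _ _ _ _ (fun b k => b.1.position P ^ k • eOp S Ψ b) _ _).trans ?_
  refine Finset.sum_eq_zero fun b hb => ?_
  rw [← (Finset.mem_filter.1 hb).2]
  exact exchange_cartan_eOp hc i b m n

lemma exchange'_cartan_fCurrent {c : RatFunc ℂ → ℤ → ℂ} (hc : IsExpansion c) (i j : ZMod 2)
    (s : Finset B.boxes) (m n : ℤ) :
    exchange' P i j (cartan S Ψ c i) (fCurrent S Ψ s j) m n = 0 := by
  refine (exchange'_sum _ _ _ _ (fun b k => b.1.position P ^ k • fOp S Ψ b) _ _).trans ?_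
  refine Finset.sum_eq_zero fun b hb => ?_
  rw [← (Finset.mem_filter.1 hb).2]
  exact exchange'_cartan_fOp hc i b m n

/-! ### The commutator of `E` and `F` -/

namespace Admissible

variable (h : Admissible S Ψ)
include h

lemma finite_boxes {s : B.State} (hs : s ∈ S) (i : ZMod 2) : (B.CC S i s ∪ B.CV S i s).Finite := by
  refine Set.Finite.of_finite_image ?_ (h.poles s hs i).injOn
  rw [(h.poles s hs i).image_eq]
  exact (B.weight Ψ s i).denom.roots.toFinset.finite_toSet.subset fun a ha =>
    mem_roots_toFinset.2 ha

lemma commutator_eCurrent_fCurrent (s : Finset B.boxes) (i j : ZMod 2) (m n : ℤ) :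
    eCurrent S Ψ s i m * fCurrent S Ψ s j n - fCurrent S Ψ s j n * eCurrent S Ψ s i m =
      if i = j then ∑ b ∈ s with b.1.color = i, b.1.position P ^ (m + n) •
        (eOp S Ψ b * fOp S Ψ b - fOp S Ψ b * eOp S Ψ b) else 0 :=
  current_commutator (fun _ => Box.position_ne_zero _) (fun _ _ hbc => h.eOp_mul_fOp_of_ne hbc)
    s i j m n

/-- On a given vector the commutator is the difference of the two expansions of the weight, as
soon as the finite set contains all boxes that can be added or removed: these are the poles of
the weight, and the statement becomes the residue theorem. -/
lemma commutator_eq_cartan {t : B.State} (ht : t ∈ S) (i : ZMod 2) {s : Finset B.boxes}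
    (hs : ∀ b ∈ B.CC S i t ∪ B.CV S i t, b ∈ s) (m : ℤ) :
    (∑ b ∈ s with b.1.color = i, b.1.position P ^ m •
        (eOp S Ψ b * fOp S Ψ b - fOp S Ψ b * eOp S Ψ b)) (vec S t) =
      ((P.q - P.q⁻¹)⁻¹ • (cartan S Ψ coeffInfty i m - cartan S Ψ coeffZero i m)) (vec S t) := by
  classical
  obtain ⟨hbal, hsimple⟩ := h.simple t ht i
  rw [LinearMap.smul_apply, LinearMap.sub_apply, cartan_vec _ _ _ ht, cartan_vec _ _ _ ht,
    ← sub_smul, coeffInfty_sub_coeffZero hbal.1 hsimple, LinearMap.sum_apply]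
  simp only [LinearMap.smul_apply, h.commutator_vec ht, smul_smul]
  rw [← Finset.sum_smul]
  congr 1
  have hD : ∀ b : B.boxes, b ∈ B.CC S i t ∪ B.CV S i t ↔
      (b ∈ B.concave S t ∨ b ∈ B.convex S t) ∧ b.1.color = i := by
    intro b
    constructor
    · rintro (hb | hb)
      · exact ⟨Or.inl hb.1, hb.2⟩
      · exact ⟨Or.inr hb.1, hb.2⟩
    · rintro ⟨hb | hb, hc⟩
      · exact Or.inl ⟨hb, hc⟩
      · exact Or.inr ⟨hb, hc⟩
  have e1 : ∑ b ∈ s with b.1.color = i, b.1.position P ^ m *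
      (if b ∈ B.concave S t ∨ b ∈ B.convex S t then (P.q - P.q⁻¹)⁻¹ *
        residue (B.weight Ψ t b.1.color / RatFunc.X) (b.1.position P) else 0) =
      ∑ b ∈ s with b ∈ B.CC S i t ∪ B.CV S i t, (P.q - P.q⁻¹)⁻¹ *
        (residue (B.weight Ψ t i / RatFunc.X) (b.1.position P) * b.1.position P ^ m) := by
    rw [Finset.sum_filter, Finset.sum_filter]
    refine Finset.sum_congr rfl fun b _ => ?_
    by_cases hc : b.1.color = i
    · by_cases hb : b ∈ B.concave S t ∨ b ∈ B.convex S t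
      · rw [if_pos hc, if_pos hb, if_pos ((hD b).2 ⟨hb, hc⟩), hc]; ring
      · rw [if_pos hc, if_neg hb, if_neg fun hx => hb ((hD b).1 hx).1, mul_zero]
    · rw [if_neg hc, if_neg fun hx => hc ((hD b).1 hx).2]
  rw [e1, ← Finset.mul_sum]
  congr 1
  have hbij := h.poles t ht i
  refine Finset.sum_bij (fun b _ => b.1.position P) (fun b hb => ?_) (fun b hb c hc hbc => ?_)
    (fun a ha => ?_) fun _ _ => rfl
  · exact mem_roots_toFinset.2 (hbij.mapsTo (Finset.mem_filter.1 hb).2)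
  · exact hbij.injOn (Finset.mem_filter.1 hb).2 (Finset.mem_filter.1 hc).2 hbc
  · obtain ⟨b, hb, hba⟩ := hbij.surjOn (mem_roots_toFinset.1 ha)
    exact ⟨b, Finset.mem_filter.2 ⟨hs b hb, hb⟩, hba⟩

end Admissible

end BoxSystem

end Toroidal

namespace Toroidal

variable {P : Params}

namespace BoxSystem

variable {B : BoxSystem P} {S : Set B.State} {Ψ : ZMod 2 → RatFunc ℂ}

/-! ### The representation -/

variable (S Ψ) in
/-- The action of the generators, with the currents `E` and `F` given by `e` and `f`. -/
def genAction (τ : ℂ) (e f : ZMod 2 → ℤ → Module.End ℂ (B.Space S)) :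
    Gen → Module.End ℂ (B.Space S)
  | Gen.E i k => e i k
  | Gen.F i k => f i k
  | Gen.Kp i k => cartan S Ψ coeffInfty i k
  | Gen.Km i k => cartan S Ψ coeffZero i (-k)
  | Gen.t => algebraMap ℂ _ τ
  | Gen.tInv => algebraMap ℂ _ τ⁻¹

variable (S Ψ) in
/-- The action in which only the boxes of a finite set can be added and removed. -/
def truncated (τ : ℂ) (s : Finset B.boxes) : Free →ₐ[ℂ] Module.End ℂ (B.Space S) :=
  FreeAlgebra.lift ℂ (genAction S Ψ τ (eCurrent S Ψ s) (fCurrent S Ψ s))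

variable (S Ψ) in
/-- The action of the modes of the current `E`. -/
def eMode (i : ZMod 2) (k : ℤ) : Module.End ℂ (B.Space S) :=
  Finsupp.linearCombination ℂ fun s : S => ∑ᶠ b : B.CV S i s.1,
    (B.bCoeff Ψ s.1 b.1 * b.1.1.position P ^ k) • vec S (B.remove s.1 b.1)

variable (S Ψ) in
/-- The action of the modes of the current `F`. -/
def fMode (i : ZMod 2) (k : ℤ) : Module.End ℂ (B.Space S) :=
  Finsupp.linearCombination ℂ fun s : S => ∑ᶠ b : B.CC S i s.1,
    (B.aCoeff Ψ s.1 b.1 * b.1.1.position P ^ k) • vec S (B.add s.1 b.1)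

variable (S Ψ) in
/-- The action of the free algebra on the space of states. -/
def freeAction (τ : ℂ) : Free →ₐ[ℂ] Module.End ℂ (B.Space S) :=
  FreeAlgebra.lift ℂ (genAction S Ψ τ (eMode S Ψ) (fMode S Ψ))

lemma eMode_vec (i : ZMod 2) (k : ℤ) {s : B.State} (hs : s ∈ S) : eMode S Ψ i k (vec S s) =
    ∑ᶠ b : B.CV S i s, (B.bCoeff Ψ s b.1 * b.1.1.position P ^ k) • vec S (B.remove s b.1) := by
  rw [vec_of_mem hs, ket, eMode, Finsupp.linearCombination_single, one_smul]

lemma fMode_vec (i : ZMod 2) (k : ℤ) {s : B.State} (hs : s ∈ S) : fMode S Ψ i k (vec S s) =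
    ∑ᶠ b : B.CC S i s, (B.aCoeff Ψ s b.1 * b.1.1.position P ^ k) • vec S (B.add s b.1) := by
  rw [vec_of_mem hs, ket, fMode, Finsupp.linearCombination_single, one_smul]

lemma finsum_subtype_eq_sum {ι M : Type*} [AddCommMonoid M] {D : Set ι} {s : Finset ι}
    (hs : ∀ b ∈ D, b ∈ s) (f g : ι → M) (hfg : ∀ b ∈ D, f b = g b) (hg : ∀ b ∉ D, g b = 0) :
    ∑ᶠ b : D, f b = ∑ b ∈ s, g b := by
  rw [finsum_set_coe_eq_finsum_mem D, finsum_mem_congr rfl hfg]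
  refine finsum_mem_eq_sum_of_inter_support_eq g (Set.ext fun b => ?_)
  simp only [Set.mem_inter_iff, Function.mem_support, Finset.mem_coe]
  exact ⟨fun hb => ⟨hs b hb.1, hb.2⟩, fun hb => ⟨by_contra fun hD => hb.2 (hg b hD), hb.2⟩⟩

open Filter

/-- Convergence of a family of operators, in the sense that its values on any vector are
eventually constant, can be tested on the basis. -/
lemma eventually_apply_eq {T : Finset B.boxes → Module.End ℂ (B.Space S)}
    {U : Module.End ℂ (B.Space S)}
    (hTU : ∀ t ∈ S, ∀ᶠ s in atTop, T s (vec S t) = U (vec S t)) (v : B.Space S) :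
    ∀ᶠ s in atTop, T s v = U v := by
  induction v using Finsupp.induction_linear with
  | zero => exact Eventually.of_forall fun s => by rw [map_zero, map_zero]
  | add v w hv hw => filter_upwards [hv, hw] with s h1 h2; rw [map_add, map_add, h1, h2]
  | single t a =>
    filter_upwards [hTU t.1 t.2] with s hs
    have e : Finsupp.single t a = a • vec S t.1 := by
      rw [vec_of_mem t.2, ket, Finsupp.smul_single, smul_eq_mul, mul_one]
    rw [e, map_smul, map_smul, hs]

namespace Admissible

variable (h : Admissible S Ψ)
include h

lemma eventually_subset {t : B.State} (ht : t ∈ S) (i : ZMod 2) :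
    ∀ᶠ s : Finset B.boxes in atTop, ∀ b ∈ B.CC S i t ∪ B.CV S i t, b ∈ s := by
  filter_upwards [eventually_ge_atTop (h.finite_boxes ht i).toFinset] with s hs b hb
  exact hs ((h.finite_boxes ht i).mem_toFinset.2 hb)

lemma eventually_eCurrent (i : ZMod 2) (k : ℤ) (v : B.Space S) :
    ∀ᶠ s in atTop, eCurrent S Ψ s i k v = eMode S Ψ i k v := by
  classical
  refine eventually_apply_eq (fun t ht => ?_) v
  filter_upwards [h.eventually_subset ht i] with s hs
  rw [eMode_vec _ _ ht, eCurrent, current, Finset.sum_filter, LinearMap.sum_apply]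
  refine (finsum_subtype_eq_sum (fun b hb => hs b (Or.inr hb)) (fun b =>
    (B.bCoeff Ψ t b * b.1.position P ^ k) • vec S (B.remove t b)) _ (fun b hb => ?_)
    fun b hb => ?_).symm
  · rw [if_pos hb.2, LinearMap.smul_apply, eOp_vec_of_mem ht hb.1, smul_smul, mul_comm]
  · split_ifs with hc
    · rw [LinearMap.smul_apply, eOp_vec_of_notMem ht fun hx => hb ⟨hx, hc⟩, smul_zero]
    · rfl

lemma eventually_fCurrent (i : ZMod 2) (k : ℤ) (v : B.Space S) :
    ∀ᶠ s in atTop, fCurrent S Ψ s i k v = fMode S Ψ i k v := by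
  classical
  refine eventually_apply_eq (fun t ht => ?_) v
  filter_upwards [h.eventually_subset ht i] with s hs
  rw [fMode_vec _ _ ht, fCurrent, current, Finset.sum_filter, LinearMap.sum_apply]
  refine (finsum_subtype_eq_sum (fun b hb => hs b (Or.inl hb)) (fun b =>
    (B.aCoeff Ψ t b * b.1.position P ^ k) • vec S (B.add t b)) _ (fun b hb => ?_)
    fun b hb => ?_).symm
  · rw [if_pos hb.2, LinearMap.smul_apply, fOp_vec_of_mem ht hb.1, smul_smul, mul_comm]
  · split_ifs with hc
    · rw [LinearMap.smul_apply, fOp_vec_of_notMem ht fun hx => hb ⟨hx, hc⟩, smul_zero]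
    · rfl

/-- On a given vector every element of the free algebra acts by its truncated action for
sufficiently large finite sets of boxes. -/
lemma eventually_truncated (τ : ℂ) (x : Free) (v : B.Space S) :
    ∀ᶠ s in atTop, truncated S Ψ τ s x v = freeAction S Ψ τ x v := by
  induction x using FreeAlgebra.induction generalizing v with
  | grade0 r => exact Eventually.of_forall fun s => by rw [AlgHom.commutes, AlgHom.commutes]
  | grade1 g =>
    simp only [truncated, freeAction, FreeAlgebra.lift_ι_apply]
    cases g with
    | E i k => exact h.eventually_eCurrent i k v
    | F i k => exact h.eventually_fCurrent i k v
    | _ => exact Eventually.of_forall fun s => rfl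
  | mul x y hx hy =>
    filter_upwards [hy v, hx (freeAction S Ψ τ y v)] with s h1 h2
    rw [map_mul, map_mul, Module.End.mul_apply, Module.End.mul_apply, h1, h2]
  | add x y hx hy =>
    filter_upwards [hx v, hy v] with s h1 h2
    rw [map_add, map_add, LinearMap.add_apply, LinearMap.add_apply, h1, h2]

/-- Two elements act in the same way if on every basis vector they do so in all sufficiently large
truncations. -/
lemma freeAction_eq {τ : ℂ} {x y : Free}
    (hxy : ∀ t ∈ S, ∀ᶠ s in atTop,
      truncated S Ψ τ s x (vec S t) = truncated S Ψ τ s y (vec S t)) :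
    freeAction S Ψ τ x = freeAction S Ψ τ y := by
  refine end_ext fun t ht => ?_
  obtain ⟨s, h1, h2, h3⟩ := ((hxy t ht).and ((h.eventually_truncated τ x (vec S t)).and
    (h.eventually_truncated τ y (vec S t)))).exists
  rw [← h2, ← h3, h1]

lemma freeAction_eq_zero {τ : ℂ} {x : Free} (hx : ∀ s, truncated S Ψ τ s x = 0) :
    freeAction S Ψ τ x = freeAction S Ψ τ 0 :=
  h.freeAction_eq fun t _ => Eventually.of_forall fun s => by rw [hx, map_zero]

omit h in
lemma truncated_gE (τ : ℂ) (s : Finset B.boxes) (i : ZMod 2) (k : ℤ) :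
    truncated S Ψ τ s (gE i k) = eCurrent S Ψ s i k := by
  rw [truncated, gE, FreeAlgebra.lift_ι_apply]; rfl

omit h in
lemma truncated_gF (τ : ℂ) (s : Finset B.boxes) (i : ZMod 2) (k : ℤ) :
    truncated S Ψ τ s (gF i k) = fCurrent S Ψ s i k := by
  rw [truncated, gF, FreeAlgebra.lift_ι_apply]; rfl

lemma cartan_coeffInfty_eq_zero (i : ZMod 2) {m : ℤ} (hm : m < 0) :
    cartan S Ψ coeffInfty i m = 0 := by
  refine end_ext fun t ht => ?_
  rw [cartan_vec _ _ _ ht, coeffInfty_eq_zero (h.simple t ht i).1.2.1 hm, zero_smul,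
    LinearMap.zero_apply]

lemma cartan_coeffZero_eq_zero (i : ZMod 2) {m : ℤ} (hm : 0 < m) :
    cartan S Ψ coeffZero i m = 0 := by
  refine end_ext fun t ht => ?_
  rw [cartan_vec _ _ _ ht, coeffZero_eq_zero (h.simple t ht i).1.1 hm, zero_smul,
    LinearMap.zero_apply]

lemma truncated_gKp (τ : ℂ) (s : Finset B.boxes) (i : ZMod 2) (m : ℤ) :
    truncated S Ψ τ s (gKp i m) = cartan S Ψ coeffInfty i m := by
  unfold gKp
  split_ifs with hm
  · rw [truncated, FreeAlgebra.lift_ι_apply, genAction, Int.toNat_of_nonneg hm]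
  · rw [map_zero, h.cartan_coeffInfty_eq_zero i (not_le.1 hm)]

lemma truncated_gKm (τ : ℂ) (s : Finset B.boxes) (i : ZMod 2) (m : ℤ) :
    truncated S Ψ τ s (gKm i m) = cartan S Ψ coeffZero i m := by
  unfold gKm
  split_ifs with hm
  · rw [truncated, FreeAlgebra.lift_ι_apply, genAction, Int.toNat_of_nonneg (by omega), neg_neg]
  · rw [map_zero, h.cartan_coeffZero_eq_zero i (not_le.1 hm)]

lemma cartan_zero_mul_cartan_zero (i : ZMod 2) :
    cartan S Ψ coeffInfty i 0 * cartan S Ψ coeffZero i 0 = 1 := by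
  refine end_ext fun t ht => ?_
  obtain ⟨h0, h1, h2⟩ := (h.simple t ht i).1
  rw [Module.End.mul_apply, cartan_vec _ _ _ ht, map_smul, cartan_vec _ _ _ ht, smul_smul,
    coeffZero, coeffInfty, neg_zero, (laurentCoeff_of_regular h0).2, (laurentCoeff_of_regular h1).2,
    h2, one_smul, Module.End.one_apply]

lemma freeAction_eq_of_rel {τ : ℂ} (hτ : τ ≠ 0) {x y : Free} (hxy : Rel P x y) :
    freeAction S Ψ τ x = freeAction S Ψ τ y := by
  have hcomm : ∀ {x y : Free}, (∀ s, truncated S Ψ τ s x = truncated S Ψ τ s y) →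
      freeAction S Ψ τ x = freeAction S Ψ τ y := fun hs =>
    h.freeAction_eq fun t _ => Eventually.of_forall fun s => by rw [hs]
  have ht : ∀ s, truncated S Ψ τ s gt = algebraMap ℂ _ τ := fun s => by
    rw [truncated, gt, FreeAlgebra.lift_ι_apply]; rfl
  have hti : ∀ s, truncated S Ψ τ s gtInv = algebraMap ℂ _ τ⁻¹ := fun s => by
    rw [truncated, gtInv, FreeAlgebra.lift_ι_apply]; rfl
  cases hxy with
  | t_mul =>
    exact hcomm fun s => by
      rw [map_mul, ht, hti, ← map_mul, mul_inv_cancel₀ hτ, map_one, map_one]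
  | mul_t =>
    exact hcomm fun s => by
      rw [map_mul, ht, hti, ← map_mul, inv_mul_cancel₀ hτ, map_one, map_one]
  | t_central x => exact hcomm fun s => by rw [map_mul, map_mul, ht, Algebra.commutes]
  | K_mul i =>
    exact hcomm fun s => by
      rw [map_mul, h.truncated_gKp, h.truncated_gKm, h.cartan_zero_mul_cartan_zero, map_one]
  | mul_K i =>
    exact hcomm fun s => by
      rw [map_mul, h.truncated_gKp, h.truncated_gKm, cartan_mul_comm,
        h.cartan_zero_mul_cartan_zero, map_one]
  | KpKp i j m n =>
    exact hcomm fun s => by rw [map_mul, map_mul, h.truncated_gKp, h.truncated_gKp, cartan_mul_comm]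
  | KmKm i j m n =>
    exact hcomm fun s => by rw [map_mul, map_mul, h.truncated_gKm, h.truncated_gKm, cartan_mul_comm]
  | KpKm i j m n =>
    exact hcomm fun s => by rw [map_mul, map_mul, h.truncated_gKp, h.truncated_gKm, cartan_mul_comm]
  | KpE i j m n =>
    refine h.freeAction_eq_zero fun s => ?_
    refine (map_exchange (A := Free) (C := Module.End ℂ (B.Space S))
      (truncated S Ψ τ s) i j _ _ m n).trans ?_
    simp only [h.truncated_gKp, truncated_gE]
    exact exchange_cartan_eCurrent isExpansion_coeffInfty i j s m n
  | KmE i j m n =>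
    refine h.freeAction_eq_zero fun s => ?_
    refine (map_exchange (A := Free) (C := Module.End ℂ (B.Space S))
      (truncated S Ψ τ s) i j _ _ m n).trans ?_
    simp only [h.truncated_gKm, truncated_gE]
    exact exchange_cartan_eCurrent isExpansion_coeffZero i j s m n
  | KpF i j m n =>
    refine h.freeAction_eq_zero fun s => ?_
    refine (map_exchange' (A := Free) (C := Module.End ℂ (B.Space S))
      (truncated S Ψ τ s) i j _ _ m n).trans ?_
    simp only [h.truncated_gKp, truncated_gF]
    exact exchange'_cartan_fCurrent isExpansion_coeffInfty i j s m n
  | KmF i j m n =>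
    refine h.freeAction_eq_zero fun s => ?_
    refine (map_exchange' (A := Free) (C := Module.End ℂ (B.Space S))
      (truncated S Ψ τ s) i j _ _ m n).trans ?_
    simp only [h.truncated_gKm, truncated_gF]
    exact exchange'_cartan_fCurrent isExpansion_coeffZero i j s m n
  | EF i j m n =>
    refine h.freeAction_eq fun t ht => ?_
    filter_upwards [h.eventually_subset ht i] with s hs
    rw [map_sub, map_mul, map_mul, truncated_gE, truncated_gF, h.commutator_eCurrent_fCurrent]
    split_ifs
    · rw [h.commutator_eq_cartan ht i hs, map_smul, map_sub, h.truncated_gKp, h.truncated_gKm]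
    · rw [map_zero]
  | EE i j m n =>
    refine h.freeAction_eq_zero fun s => ?_
    refine (map_exchange (A := Free) (C := Module.End ℂ (B.Space S))
      (truncated S Ψ τ s) i j _ _ m n).trans ?_
    simp only [truncated_gE]
    exact h.isLetterFamily_eOp.exchange_current s i j m n
  | FF i j m n =>
    refine h.freeAction_eq_zero fun s => ?_
    refine (map_exchange' (A := Free) (C := Module.End ℂ (B.Space S))
      (truncated S Ψ τ s) i j _ _ m n).trans ?_
    simp only [truncated_gF]
    exact exchange'_current s h.isLetterFamily_fOp i j m n
  | serreE i k l =>
    refine h.freeAction_eq_zero fun s => ?_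
    refine (map_serre (A := Free) (C := Module.End ℂ (B.Space S))
      (truncated S Ψ τ s) _ _ k l).trans ?_
    simp only [truncated_gE]
    exact h.isLetterFamily_eOp.serre_current s h.generic i k l
  | serreF i k l =>
    refine h.freeAction_eq_zero fun s => ?_
    refine (map_serre (A := Free) (C := Module.End ℂ (B.Space S))
      (truncated S Ψ τ s) _ _ k l).trans ?_
    simp only [truncated_gF]
    exact serre_current_of_op s h.isLetterFamily_fOp h.generic i k l

/-- The action of the quantum toroidal algebra on the space of states. -/
def action {τ : ℂ} (hτ : τ ≠ 0) : QTor P →ₐ[ℂ] Module.End ℂ (B.Space S) :=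
  RingQuot.liftAlgHom ℂ ⟨freeAction S Ψ τ, fun _ _ hxy => h.freeAction_eq_of_rel hτ hxy⟩

lemma action_gen {τ : ℂ} (hτ : τ ≠ 0) (x : Gen) :
    h.action hτ (gen P x) = genAction S Ψ τ (eMode S Ψ) (fMode S Ψ) x := by
  rw [action, gen, RingQuot.liftAlgHom_mkAlgHom_apply, freeAction, FreeAlgebra.lift_ι_apply]

lemma isLWeightVector_vec {τ : ℂ} (hτ : τ ≠ 0) {s : B.State} (hs : s ∈ S) :
    IsLWeightVector (h.action hτ) (B.weight Ψ s) (vec S s) := by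
  intro i k
  rw [h.action_gen, h.action_gen]
  simp only [genAction]
  rw [cartan_vec _ _ _ hs, cartan_vec _ _ _ hs, coeffZero, neg_neg]
  exact ⟨rfl, rfl⟩

theorem actsByFormulas {τ : ℂ} (hτ : τ ≠ 0) : B.ActsByFormulas S Ψ τ (h.action hτ) where
  K s hs := by
    rw [← vec_of_mem hs]
    exact h.isLWeightVector_vec hτ hs
  F s hs i k := by
    rw [h.action_gen, genAction, ← vec_of_mem hs, fMode_vec _ _ hs]
    exact finsum_congr fun b => by rw [vec_of_mem b.2.1.2]
  E s hs i k := by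
    rw [h.action_gen, genAction, ← vec_of_mem hs, eMode_vec _ _ hs]
    exact finsum_congr fun b => by rw [vec_of_mem b.2.1.2]
  t s hs := by
    rw [h.action_gen, genAction]
    rfl

theorem isTame (hd : B.DistinctWeights S Ψ) {τ : ℂ} (hτ : τ ≠ 0) : IsTame (h.action hτ) := by
  refine ⟨S, Finsupp.basisSingleOne, fun s => B.weight Ψ s.1, fun s t hst => ?_,
    fun s i => (h.simple s.1 s.2 i).1, fun s => ?_⟩
  · exact Subtype.ext (hd s.2 t.2 hst)
  · have := h.isLWeightVector_vec hτ s.2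
    rw [vec_of_mem s.2, ket] at this
    rw [Finsupp.coe_basisSingleOne]
    exact this

end Admissible

end BoxSystem

end Toroidal

namespace Toroidal

variable {P : Params}

namespace BoxSystem

variable {B : BoxSystem P} {S : Set B.State} {Ψ : ZMod 2 → RatFunc ℂ}

/-! ### Irreducibility -/

open scoped RatFunc in
lemma exists_laurentCoeff_ne {f g : RatFunc ℂ} (hf : IsRegularAt f 0) (hg : IsRegularAt g 0)
    (hfg : f ≠ g) : ∃ k : ℕ, laurentCoeff f k ≠ laurentCoeff g k := by
  by_contra! hall
  refine hfg ((algebraMap (RatFunc ℂ) (LaurentSeries ℂ)).injective (HahnSeries.ext ?_))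
  funext n
  rcases lt_or_ge n 0 with hn | hn
  · exact ((laurentCoeff_of_regular hf).1 n hn).trans ((laurentCoeff_of_regular hg).1 n hn).symm
  · obtain ⟨k, rfl⟩ := Int.eq_ofNat_of_zero_le hn
    exact hall k

namespace Admissible

variable (h : Admissible S Ψ)
include h

/-- A subspace which is stable under the Cartan currents contains every state which occurs in one
of its vectors: the weights separate the states. -/
lemma vec_mem_of_apply_ne_zero (hd : B.DistinctWeights S Ψ) {N : Submodule ℂ (B.Space S)}
    (hN : ∀ i (k : ℕ), ∀ v ∈ N, cartan S Ψ coeffZero i (-k) v ∈ N) {v : B.Space S} (hv : v ∈ N)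
    {s : S} (hs : v s ≠ 0) : vec S s.1 ∈ N := by
  induction hn : v.support.card using Nat.strong_induction_on generalizing v with
  | _ n ih =>
    by_cases hone : ∀ t : S, v t ≠ 0 → t = s
    · have hv' : v = v s • vec S s.1 := by
        rw [vec_of_mem s.2, ket, Finsupp.smul_single, smul_eq_mul, mul_one]
        ext t
        by_cases hts : t = s
        · rw [hts, Finsupp.single_eq_same]
        · rw [Finsupp.single_eq_of_ne hts]
          exact by_contra fun hx => hts (hone t hx)
      rw [hv'] at hv
      exact (N.smul_mem_iff hs).1 hv
    · push Not at hone
      obtain ⟨t, ht, hts⟩ := hone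
      -- Subtract a multiple so as to eliminate the state `t`, keeping `s`.
      obtain ⟨i, hi⟩ : ∃ i, B.weight Ψ s.1 i ≠ B.weight Ψ t.1 i := by
        by_contra! hall
        exact hts (Subtype.ext (hd t.2 s.2 (funext fun i => (hall i).symm)))
      obtain ⟨k, hk⟩ := exists_laurentCoeff_ne (h.simple s.1 s.2 i).1.1 (h.simple t.1 t.2 i).1.1 hi
      have happ : ∀ (u : B.Space S) (r : S), cartan S Ψ coeffZero i (-k) u r =
          laurentCoeff (B.weight Ψ r.1 i) k * u r := by
        intro u r
        induction u using Finsupp.induction_linear with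
        | zero => simp
        | add u w hu hw => rw [map_add, Finsupp.add_apply, hu, hw, Finsupp.add_apply, mul_add]
        | single r' a =>
          rw [cartan, Finsupp.linearCombination_single, vec_of_mem r'.2, ket, Finsupp.smul_single,
            Finsupp.smul_single, coeffZero, neg_neg]
          by_cases hr : r = r'
          · subst hr
            simp only [Finsupp.single_eq_same, smul_eq_mul]
            ring
          · rw [Finsupp.single_eq_of_ne hr, Finsupp.single_eq_of_ne hr, mul_zero]
      set w := cartan S Ψ coeffZero i (-k) v - laurentCoeff (B.weight Ψ t.1 i) k • v with hw
      have hwapp : ∀ r : S, w r = (laurentCoeff (B.weight Ψ r.1 i) k -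
          laurentCoeff (B.weight Ψ t.1 i) k) * v r := by
        intro r
        rw [hw, Finsupp.sub_apply, happ, Finsupp.smul_apply, smul_eq_mul, sub_mul]
      refine ih w.support.card ?_ (N.sub_mem (hN i k v hv) (N.smul_mem _ hv)) ?_ rfl
      · rw [← hn]
        refine Finset.card_lt_card ⟨fun r hr => ?_, fun hsub => ?_⟩
        · rw [Finsupp.mem_support_iff, hwapp] at hr
          exact Finsupp.mem_support_iff.2 (right_ne_zero_of_mul hr)
        · have := Finsupp.mem_support_iff.1 (hsub (Finsupp.mem_support_iff.2 ht))
          rw [hwapp, sub_self, zero_mul] at this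
          exact this rfl
      · rw [hwapp]
        exact mul_ne_zero (sub_ne_zero.2 hk) hs

lemma vec_remove_mem (hd : B.DistinctWeights S Ψ) {N : Submodule ℂ (B.Space S)}
    (hN : ∀ i (k : ℕ), ∀ v ∈ N, cartan S Ψ coeffZero i (-k) v ∈ N)
    (hE : ∀ i k, ∀ v ∈ N, eMode S Ψ i k v ∈ N) {s : B.State} (hs : s ∈ S) {b : B.boxes}
    (hb : b ∈ B.convex S s) (hsN : vec S s ∈ N) : vec S (B.remove s b) ∈ N := by
  refine h.vec_mem_of_apply_ne_zero hd hN (hE b.1.color 0 _ hsN) (s := ⟨_, hb.2⟩) ?_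
  have hfin : (B.CV S b.1.color s).Finite :=
    (h.finite_boxes hs b.1.color).subset Set.subset_union_right
  have := hfin.fintype
  rw [eMode_vec _ _ hs, finsum_eq_sum_of_fintype, Finsupp.finsetSum_apply,
    Finset.sum_eq_single_of_mem (⟨b, hb, rfl⟩ : B.CV S b.1.color s) (Finset.mem_univ _)]
  · rw [zpow_zero, mul_one, vec_of_mem hb.2, ket, Finsupp.smul_apply, Finsupp.single_eq_same,
      smul_eq_mul, mul_one]
    exact h.bCoeff_ne_zero hs (Or.inr hb)
  · intro c _ hcb
    have hne : B.remove s b ≠ B.remove s c.1 := by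
      intro heq
      have hco := (mem_convex.1 c.2.1).1
      have h1 : Occ (B.remove s b) c.1 :=
        (occ_remove s b c.1).2 ⟨fun hx => hcb (Subtype.ext hx), hco⟩
      rw [heq] at h1
      exact ((occ_remove s c.1 c.1).1 h1).1 rfl
    rw [vec_of_mem c.2.1.2, ket, Finsupp.smul_apply, Finsupp.single_eq_of_ne, smul_zero]
    exact fun hx => hne (congrArg Subtype.val hx)

lemma vec_add_mem (hd : B.DistinctWeights S Ψ) {N : Submodule ℂ (B.Space S)}
    (hN : ∀ i (k : ℕ), ∀ v ∈ N, cartan S Ψ coeffZero i (-k) v ∈ N)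
    (hF : ∀ i k, ∀ v ∈ N, fMode S Ψ i k v ∈ N) {s : B.State} (hs : s ∈ S) {b : B.boxes}
    (hb : b ∈ B.concave S s) (hsN : vec S s ∈ N) : vec S (B.add s b) ∈ N := by
  refine h.vec_mem_of_apply_ne_zero hd hN (hF b.1.color 0 _ hsN) (s := ⟨_, hb.2⟩) ?_
  have hfin : (B.CC S b.1.color s).Finite :=
    (h.finite_boxes hs b.1.color).subset Set.subset_union_left
  have := hfin.fintype
  rw [fMode_vec _ _ hs, finsum_eq_sum_of_fintype, Finsupp.finsetSum_apply,
    Finset.sum_eq_single_of_mem (⟨b, hb, rfl⟩ : B.CC S b.1.color s) (Finset.mem_univ _)]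
  · rw [zpow_zero, mul_one, vec_of_mem hb.2, ket, Finsupp.smul_apply, Finsupp.single_eq_same,
      smul_eq_mul, mul_one]
    exact h.aCoeff_ne_zero hs (Or.inl hb)
  · intro c _ hcb
    have hne : B.add s b ≠ B.add s c.1 := by
      intro heq
      have hco := (mem_concave.1 c.2.1).1
      have h1 : Occ (B.add s b) c.1 := heq ▸ (occ_add s c.1 c.1).2 (Or.inl rfl)
      rcases (occ_add s b c.1).1 h1 with hx | hx
      · exact hcb (Subtype.ext hx)
      · exact hco hx
    rw [vec_of_mem c.2.1.2, ket, Finsupp.smul_apply, Finsupp.single_eq_of_ne, smul_zero]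
    exact fun hx => hne (congrArg Subtype.val hx)

/-- All states are connected by the currents, in both directions. -/
lemma vec_mem_iff (hd : B.DistinctWeights S Ψ) {N : Submodule ℂ (B.Space S)}
    (hN : ∀ i (k : ℕ), ∀ v ∈ N, cartan S Ψ coeffZero i (-k) v ∈ N)
    (hE : ∀ i k, ∀ v ∈ N, eMode S Ψ i k v ∈ N) (hF : ∀ i k, ∀ v ∈ N, fMode S Ψ i k v ∈ N)
    {s : B.State} (hs : s ∈ S) : vec S s ∈ N ↔ vec S (∅ : B.State) ∈ N := by
  have hpath := h.connected s hs
  induction hpath using Relation.ReflTransGen.head_induction_on with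
  | refl => rfl
  | @head s s' hstep hpath ih =>
    obtain ⟨hs', b, hb, rfl⟩ := hstep
    refine Iff.trans ?_ (ih hs')
    by_cases hbp : b ∈ B.positive
    · have ho : Occ s b := iff_of_true hb hbp
      rw [← remove_eq_erase hbp] at hs' ⊢
      refine ⟨h.vec_remove_mem hd hN hE hs (mem_convex.2 ⟨ho, hs'⟩), fun hx => ?_⟩
      have := h.vec_add_mem hd hN hF hs' (mem_concave_remove hs ho) hx
      rwa [add_remove ho] at this
    · have ho : ¬ Occ s b := fun ho => hbp (ho.1 hb)
      rw [← add_eq_erase hbp] at hs' ⊢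
      refine ⟨h.vec_add_mem hd hN hF hs (mem_concave.2 ⟨ho, hs'⟩), fun hx => ?_⟩
      have := h.vec_remove_mem hd hN hE hs' (mem_convex_add hs ho) hx
      rwa [remove_add ho] at this

theorem isIrred (hd : B.DistinctWeights S Ψ) {τ : ℂ} (hτ : τ ≠ 0) : IsIrred (h.action hτ) := by
  let _ : Module (QTor P) (B.Space S) := Module.compHom _ (h.action hτ).toRingHom
  have hsmul : ∀ (x : QTor P) (v : B.Space S), x • v = h.action hτ x v := fun _ _ => rfl
  have : Nontrivial (B.Space S) :=
    ⟨vec S ∅, 0, by rw [vec_of_mem h.empty_mem]; exact Finsupp.single_ne_zero.2 one_ne_zero⟩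
  refine isSimpleModule_iff _ _ |>.2 ⟨fun M => ?_⟩
  rw [or_iff_not_imp_left]
  intro hM
  obtain ⟨v, hv, hv0⟩ := M.ne_bot_iff.1 hM
  let N : Submodule ℂ (B.Space S) :=
    { carrier := M
      add_mem' := M.add_mem
      zero_mem' := M.zero_mem
      smul_mem' := fun c v hv => by
        have := M.smul_mem (algebraMap ℂ (QTor P) c) hv
        rwa [hsmul, AlgHom.commutes] at this }
  have hgen : ∀ x : Gen, ∀ v ∈ N, genAction S Ψ τ (eMode S Ψ) (fMode S Ψ) x v ∈ N := by
    intro x v hv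
    have := M.smul_mem (gen P x) hv
    rwa [hsmul, h.action_gen] at this
  have hN : ∀ i (k : ℕ), ∀ v ∈ N, cartan S Ψ coeffZero i (-k) v ∈ N := fun i k => hgen (Gen.Km i k)
  have hE : ∀ i k, ∀ v ∈ N, eMode S Ψ i k v ∈ N := fun i k => hgen (Gen.E i k)
  have hF : ∀ i k, ∀ v ∈ N, fMode S Ψ i k v ∈ N := fun i k => hgen (Gen.F i k)
  obtain ⟨s, hs⟩ := Finsupp.ne_iff.1 hv0
  have hempty : vec S (∅ : B.State) ∈ N := (h.vec_mem_iff hd hN hE hF s.2).1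
    (h.vec_mem_of_apply_ne_zero hd hN (v := v) hv hs)
  refine M.eq_top_iff'.2 fun w => show w ∈ N from ?_
  induction w using Finsupp.induction_linear with
  | zero => exact N.zero_mem
  | add u w hu hw => exact N.add_mem hu hw
  | single t a =>
    have := N.smul_mem a ((h.vec_mem_iff hd hN hE hF t.2).2 hempty)
    rwa [vec_of_mem t.2, ket, Finsupp.smul_single, smul_eq_mul, mul_one] at this

end Admissible

end BoxSystem

end Toroidal

end

theorem theorem3 (P : Toroidal.Params) (hP : P.Generic)
    (B : Toroidal.BoxSystem P) (S : Set B.State) (hS : (∅ : B.State) ∈ S) (hconn : B.Connected S)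
    (Ψ : ZMod 2 → RatFunc ℂ) (hΨ : ∀ i, Toroidal.IsBalanced (Ψ i))
    (hdistinct : B.DistinctWeights S Ψ) (hsimple : B.SimplePoles S Ψ)
    (hpoles : B.PolesAreBoxes S Ψ) (hregular : B.PartialRegular S Ψ) (haligned : B.Aligned S)
    (τ : ℂ) (hτ : τ ≠ 0) :
    ∃ ρ : Toroidal.QTor P →ₐ[ℂ] Module.End ℂ (B.Space S),
      B.ActsByFormulas S Ψ τ ρ ∧ Toroidal.IsTame ρ ∧ Toroidal.IsIrred ρ := by
  have h : Toroidal.BoxSystem.Admissible S Ψ := ⟨hP, hS, hconn, hsimple, hpoles, haligned⟩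
  exact ⟨h.action hτ, h.actsByFormulas hτ, h.isTame hdistinct hτ, h.isIrred hdistinct hτ⟩
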